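/- Let $d\ge 1$, let $\xi_1,\dots,\xi_d$ be the complex $d$-th roots of unity (in any order), and let $R=\mathbb{C}[u^{\pm1},v^{\pm1}]$ with $u,v$ indeterminates. **Algebras.** For $n\ge1$ let $\mathcal H_n$ be the Iwahori–Hecke algebra of type $A_{n-1}$: the unital $R$-algebra with generators $T_1,\dots,T_{n-1}$ and relations $T_iT_j=T_jT_i$ ($|i-j|>1$), $T_iT_{i+1}T_i=T_{i+1}T_iT_{i+1}$, $T_i^2=u^2+vT_i$; put $\mathcal H_0=R$. Let $Y_{d,n}$ be the Yokonuma–Hecke algebra: the unital $R$-algebra with generators $g_1,\dots,g_{n-1},t_1,\dots,t_n$ and relations $g_ig_j=g_jg_i$ ($|i-j|>1$), $g_ig_{i+1}g_i=g_{i+1}g_ig_{i+1}$, $t_it_j=t_jt_i$, $g_it_j=t_{s_i(j)}g_i$, $t_j^d=1$, $g_i^2=u^2+v\,e_ig_i$, where $s_i=(i,i+1)$ and $e_i=\frac1d\sum_{0\le s\le d-1}t_i^st_{i+1}^{-s}$. The $T_i$ and $g_i$ are invertible; an element of $\mathcal H_n$ (resp. $Y_{d,n}$) is also regarded as an element of $\mathcal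 H_{n+1}$ (resp. $Y_{d,n+1}$) via the homomorphism that sends each generator to the generator of the same name. For $w\in\mathfrak S_n$ of length $\ell(w)=r$ with a reduced expression $w=s_{i_1}\cdots s_{i_r}$ put $\widetilde T_w=u^{-r}T_{i_1}\cdots T_{i_r}$ and $\widetilde g_w=u^{-r}g_{i_1}\cdots g_{i_r}$. **Markov traces.** A Markov trace on $\{Y_{d,n}\}_{n\ge1}$ is a family of $R$-linear maps $\rho_n:Y_{d,n}\to R$ ($n\ge1$) with $\rho_n(xy)=\rho_n(yx)$ for $x,y\in Y_{d,n}$ and $\rho_{n+1}(xg_n)=\rho_{n+1}(xg_n^{-1})=\rho_n(x)$ for $x\in Y_{d,n}$, for all $n\geq 1$. A Markov trace on $\{\mathcal H_n\}_{n\ge1}$ is defined in the same way, with $T_n$ in place of $g_n$; it is normalized if its value at $1\in\mathcal H_1$ is $1$. **Combinatorics.** Let $\mathrm{Comp}_d(n)$ be the set of $\mu=(\mu_1,\dots,\mu_d)\in\mathbb Z_{\ge0}^d$ with $\sum_a\mu_a=n$; let $[\mu]$ be the $d$-tuple with $[\mu]_a=1$ if $\mu_a\ge1$ and $[\mu]_a=0$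 otherwise; let $\mathrm{Comp}_d^0$ be the set of nonzero $d$-tuples with entries in $\{0,1\}$. Characters $\chi$ of $(\mathbb Z/d\mathbb Z)^n=\langle t_1,\dots,t_n\rangle$ are permuted by $\mathfrak S_n$ via $w(\chi)(t_i)=\chi(t_{w^{-1}(i)})$. For $\mu\in\mathrm{Comp}_d(n)$ let $\mathcal O(\mu)$ be the set of the $\chi$ with $\#\{j:\chi(t_j)=\xi_a\}=\mu_a$ for all $a$, let $m_\mu=\#\mathcal O(\mu)$, and let $\chi_1^\mu\in\mathcal O(\mu)$ be the character equal to $\xi_1$ on the first $\mu_1$ of the $t_j$, to $\xi_2$ on the next $\mu_2$ of them, and so on. Its stabilizer is the Young subgroup $\mathfrak S^\mu=\mathfrak S_{\mu_1}\times\dots\times\mathfrak S_{\mu_d}$. For $\chi\in\mathcal O(\mu)$ let $\pi_\chi\in\mathfrak S_n$ be the element of minimal length with $\pi_\chi(\chi_1^\mu)=\chi$. Put $$E_\chi=\prod_{1\le i\le n}\Bigl(\frac1d\sum_{0\le s\le d-1}\chi(t_i)^st_i^{-s}\Bigr),\qquad E_\mu=\sum_{\chi\in\mathcal O(\mu)}E_\chi,\qquad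 \mathcal H^\mu=\mathcal H_{\mu_1}\otimes_R\dots\otimes_R\mathcal H_{\mu_d}.$$ Write $\widetilde T_y=\widetilde T_{y_1}\otimes\dots\otimes\widetilde T_{y_d}\in\mathcal H^\mu$ for $y=(y_1,\dots,y_d)\in\mathfrak S^\mu$, and let $\mathrm M_{\chi,\psi}$ ($\chi,\psi\in\mathcal O(\mu)$) be the elementary matrices in $\mathrm{Mat}_{m_\mu}(\mathcal H^\mu)$, with rows and columns indexed by $\mathcal O(\mu)$. **Theorem.** 1. There is exactly one normalized Markov trace $\{\tau_n\}_{n\ge1}$ on $\{\mathcal H_n\}_{n\ge1}$. (Let $\tau_0$ be the identity map of $\mathcal H_0=R$.) For every $n\ge1$ and $\mu\in\mathrm{Comp}_d(n)$ there is exactly one $R$-linear map $\Psi_\mu:E_\mu Y_{d,n}\to\mathrm{Mat}_{m_\mu}(\mathcal H^\mu)$ with $$\Psi_\mu(E_\chi\widetilde g_w)=\widetilde T_{\pi_\chi^{-1}w\pi_\psi}\,\mathrm M_{\chi,\psi}\qquad\text{for all }\chi\in\mathcal O(\mu),\ w\in\mathfrak S_n,\text{ where }\psi=w^{-1}(\chi).$$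 2. A family of $R$-linear maps $\rho_n:Y_{d,n}\to R$ ($n\ge1$) is a Markov trace on $\{Y_{d,n}\}_{n\ge1}$ if and only if there are parameters $\alpha_{\mu^0}\in R$ ($\mu^0\in\mathrm{Comp}_d^0$) such that, for all $n\ge1$ and $x\in Y_{d,n}$, $$\rho_n(x)=\sum_{\mu\in\mathrm{Comp}_d(n)}\alpha_{[\mu]}\,\bigl((\tau_{\mu_1}\otimes\dots\otimes\tau_{\mu_d})\circ\mathrm{Tr}\circ\Psi_\mu\bigr)(E_\mu x),$$ where $\mathrm{Tr}:\mathrm{Mat}_{m_\mu}(\mathcal H^\mu)\to\mathcal H^\mu$ is the sum of the diagonal entries. 3. The $R$-module of Markov traces on $\{Y_{d,n}\}_{n\ge1}$ is free of rank $2^d-1$, with a basis $\{\rho_{\mu^0}\}_{\mu^0\in\mathrm{Comp}_d^0}$ given by $$\rho_{\mu^0,n}(x)=\sum_{\mu\in\mathrm{Comp}_d(n),\ [\mu]=\mu^0}\bigl((\tau_{\mu_1}\otimes\dots\otimes\tau_{\mu_d})\circ\mathrm{Tr}\circ\Psi_\mu\bigr)(E_\mu x).$$ -/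

import Mathlib

open scoped TensorProduct

namespace YH

noncomputable section

/-! ### The ground ring -/

/-- The ring `ℂ[u^{±1}, v^{±1}]`, as Laurent polynomials in `v` over Laurent polynomials in `u`. -/
def GroundRing : Type := LaurentPolynomial (LaurentPolynomial ℂ)

instance instCommRingGroundRing : CommRing GroundRing :=
  inferInstanceAs (CommRing (LaurentPolynomial (LaurentPolynomial ℂ)))

/-- An element of the ground ring, as a Laurent polynomial. -/
def ofLaurent : LaurentPolynomial (LaurentPolynomial ℂ) ≃+* GroundRing := RingEquiv.refl _

/-- The constants `ℂ → ℂ[u^{±1}, v^{±1}]`. -/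
def const : ℂ →+* GroundRing :=
  ofLaurent.toRingHom.comp
    ((LaurentPolynomial.C (R := LaurentPolynomial ℂ)).comp (LaurentPolynomial.C (R := ℂ)))

/-- The indeterminate `u`, as a unit. -/
def u : GroundRingˣ where
  val := ofLaurent (LaurentPolynomial.C (LaurentPolynomial.T 1))
  inv := ofLaurent (LaurentPolynomial.C (LaurentPolynomial.T (-1)))
  val_inv := by rw [← map_mul, ← map_mul, ← LaurentPolynomial.T_add]; simp
  inv_val := by rw [← map_mul, ← map_mul, ← LaurentPolynomial.T_add]; simp

/-- The indeterminate `v`. -/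
def v : GroundRing := ofLaurent (LaurentPolynomial.T 1)

/-! ### The symmetric group: simple transpositions, length, reduced words -/

/-- Labels of the simple transpositions of `𝔖_n`. The letters are `0, …, n - 1`, and the label `i`
stands for the transposition of the letters `i` and `i + 1`. -/
abbrev Gen (n : ℕ) : Type := {i : ℕ // i + 1 < n}

/-- The letter `i` moved by the simple transposition labelled `i`. -/
def Gen.lo {n : ℕ} (i : Gen n) : Fin n := ⟨i.1, Nat.lt_of_succ_lt i.2⟩

/-- The letter `i + 1` moved by the simple transposition labelled `i`. -/
def Gen.hi {n : ℕ} (i : Gen n) : Fin n := ⟨i.1 + 1, i.2⟩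

/-- The label `i` seen in `𝔖_{n+1}`. -/
def Gen.up {n : ℕ} (i : Gen n) : Gen (n + 1) := ⟨i.1, Nat.lt_succ_of_lt i.2⟩

/-- The last label in `𝔖_{n+2}`, the one that is new with respect to `𝔖_{n+1}`. -/
def Gen.last (n : ℕ) : Gen (n + 1 + 1) := ⟨n, Nat.lt_succ_self (n + 1)⟩

/-- The simple transposition `s_i`. -/
def simpleRefl {n : ℕ} (i : Gen n) : Equiv.Perm (Fin n) := Equiv.swap i.lo i.hi

/-- The word `l` in the simple transpositions is an expression of `w`. -/
def IsExpr {n : ℕ} (w : Equiv.Perm (Fin n)) (l : List (Gen n)) : Prop :=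
  (l.map simpleRefl).prod = w

/-- The length `ℓ(w)`: the least number of letters of an expression of `w`. -/
def len {n : ℕ} (w : Equiv.Perm (Fin n)) : ℕ := sInf {k | ∃ l, IsExpr w l ∧ l.length = k}

theorem exists_isExpr {n : ℕ} (w : Equiv.Perm (Fin n)) : ∃ l, IsExpr w l := by
  cases n with
  | zero => exact ⟨[], Subsingleton.elim _ _⟩
  | succ m =>
    have hw : w ∈ Submonoid.closure (Set.range fun i : Fin m =>
        Equiv.swap i.castSucc i.succ) := by
      rw [Equiv.Perm.mclosure_swap_castSucc_succ]; trivial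
    induction hw using Submonoid.closure_induction with
    | mem x hx =>
      obtain ⟨i, rfl⟩ := hx
      refine ⟨[⟨i.1, by omega⟩], ?_⟩
      simp only [IsExpr, List.map_cons, List.map_nil, List.prod_cons, List.prod_nil, mul_one]
      rfl
    | one => exact ⟨[], rfl⟩
    | mul x y _ _ hx hy =>
      obtain ⟨l, hl⟩ := hx
      obtain ⟨l', hl'⟩ := hy
      refine ⟨l ++ l', ?_⟩
      simp only [IsExpr] at hl hl' ⊢
      rw [List.map_append, List.prod_append, hl, hl']

theorem exists_reduced {n : ℕ} (w : Equiv.Perm (Fin n)) :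
    ∃ l : List (Gen n), IsExpr w l ∧ l.length = len w := by
  obtain ⟨l, hl⟩ := exists_isExpr w
  exact Nat.sInf_mem (s := {k | ∃ l, IsExpr w l ∧ l.length = k}) ⟨_, l, hl, rfl⟩

/-- A reduced expression of `w`. -/
def reducedWord {n : ℕ} (w : Equiv.Perm (Fin n)) : List (Gen n) := (exists_reduced w).choose

theorem reducedWord_spec {n : ℕ} (w : Equiv.Perm (Fin n)) :
    IsExpr w (reducedWord w) ∧ (reducedWord w).length = len w := (exists_reduced w).choose_spec

/-! ### The Iwahori--Hecke algebra of type `A` -/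

/-- Defining relations of the Iwahori--Hecke algebra. -/
inductive HeckeRel (n : ℕ) : FreeAlgebra GroundRing (Gen n) → FreeAlgebra GroundRing (Gen n) → Prop
  | comm (i j : Gen n) (h : i.1 + 1 < j.1 ∨ j.1 + 1 < i.1) :
      HeckeRel n (FreeAlgebra.ι GroundRing i * FreeAlgebra.ι GroundRing j)
        (FreeAlgebra.ι GroundRing j * FreeAlgebra.ι GroundRing i)
  | braid (i j : Gen n) (h : j.1 = i.1 + 1) :
      HeckeRel n
        (FreeAlgebra.ι GroundRing i * FreeAlgebra.ι GroundRing j * FreeAlgebra.ι GroundRing i)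
        (FreeAlgebra.ι GroundRing j * FreeAlgebra.ι GroundRing i * FreeAlgebra.ι GroundRing j)
  | quad (i : Gen n) :
      HeckeRel n (FreeAlgebra.ι GroundRing i ^ 2)
        (algebraMap GroundRing _ ((u : GroundRing) ^ 2) + v • FreeAlgebra.ι GroundRing i)

/-- The Iwahori--Hecke algebra `ℋ_n` over `ℂ[u^{±1}, v^{±1}]`, with `ℋ_0 = ℋ_1` the ground ring. -/
def Hecke (n : ℕ) : Type := RingQuot (HeckeRel n)

instance instRingHecke (n : ℕ) : Ring (Hecke n) := inferInstanceAs (Ring (RingQuot (HeckeRel n)))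

instance instAlgebraHecke (n : ℕ) : Algebra GroundRing (Hecke n) :=
  inferInstanceAs (Algebra GroundRing (RingQuot (HeckeRel n)))

namespace Hecke

/-- The quotient map from the free algebra. -/
def mk (n : ℕ) : FreeAlgebra GroundRing (Gen n) →ₐ[GroundRing] Hecke n :=
  RingQuot.mkAlgHom GroundRing (HeckeRel n)

/-- The generators. -/
def T {n : ℕ} (i : Gen n) : Hecke n := mk n (FreeAlgebra.ι GroundRing i)

theorem mk_rel {n : ℕ} {x y : FreeAlgebra GroundRing (Gen n)} (h : HeckeRel n x y) :
    mk n x = mk n y := RingQuot.mkAlgHom_rel GroundRing h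

theorem T_comm {n : ℕ} (i j : Gen n) (h : i.1 + 1 < j.1 ∨ j.1 + 1 < i.1) :
    T i * T j = T j * T i := by
  have := mk_rel (HeckeRel.comm i j h)
  simp only [map_mul] at this
  exact this

theorem T_braid {n : ℕ} (i j : Gen n) (h : j.1 = i.1 + 1) :
    T i * T j * T i = T j * T i * T j := by
  have := mk_rel (HeckeRel.braid i j h)
  simp only [map_mul] at this
  exact this

theorem T_sq {n : ℕ} (i : Gen n) :
    T i * T i = algebraMap GroundRing _ ((u : GroundRing) ^ 2) + v • T i := by
  have := mk_rel (HeckeRel.quad i)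
  rwa [pow_two, map_mul, map_add, map_smul, AlgHom.commutes] at this

/-- The natural embedding `ℋ_n → ℋ_{n+1}`, sending each generator to the generator of the same
label. -/
def incl (n : ℕ) : Hecke n →ₐ[GroundRing] Hecke (n + 1) :=
  RingQuot.liftAlgHom GroundRing ⟨FreeAlgebra.lift GroundRing fun i : Gen n => T i.up, by
    intro x y h
    induction h with
    | comm i j h => simpa using T_comm i.up j.up h
    | braid i j h => simpa using T_braid i.up j.up h
    | quad i => simpa [pow_two] using T_sq i.up⟩

theorem incl_T {n : ℕ} (i : Gen n) : incl n (T i) = T i.up := by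
  have := RingQuot.liftAlgHom_mkAlgHom_apply GroundRing (s := HeckeRel n)
    (FreeAlgebra.lift GroundRing fun i : Gen n => T i.up) (by
      intro x y h
      induction h with
      | comm i j h => simpa using T_comm i.up j.up h
      | braid i j h => simpa using T_braid i.up j.up h
      | quad i => simpa [pow_two] using T_sq i.up) (FreeAlgebra.ι GroundRing i)
  rw [FreeAlgebra.lift_ι_apply] at this
  exact this

theorem u_inv_sq_mul : ((u⁻¹ : GroundRingˣ) : GroundRing) ^ 2 * (u : GroundRing) ^ 2 = 1 := by
  rw [← mul_pow, Units.inv_mul, one_pow]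

/-- The generators as units, with `T_i⁻¹ = u⁻² T_i - u⁻² v`. -/
def TUnit {n : ℕ} (i : Gen n) : (Hecke n)ˣ where
  val := T i
  inv := (((u⁻¹ : GroundRingˣ) : GroundRing) ^ 2) • (T i - algebraMap GroundRing _ v)
  val_inv := by
    rw [mul_smul_comm, mul_sub, T_sq, ← Algebra.commutes, ← Algebra.smul_def, add_sub_cancel_right,
      Algebra.smul_def, ← map_mul, u_inv_sq_mul, map_one]
  inv_val := by
    rw [smul_mul_assoc, sub_mul, T_sq, ← Algebra.smul_def, add_sub_cancel_right,
      Algebra.smul_def, ← map_mul, u_inv_sq_mul, map_one]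

/-- The basis element `T̃_w = u^{-ℓ(w)} T_{i_1} ⋯ T_{i_r}`, for a reduced expression of `w`. -/
def Ttilde {n : ℕ} (w : Equiv.Perm (Fin n)) : Hecke n :=
  (((u⁻¹ : GroundRingˣ) : GroundRing) ^ len w) • ((reducedWord w).map T).prod

end Hecke

/-- `τ` is a normalized Markov trace on the algebras `ℋ_n`, `n ≥ 1`, extended by the identity map
`τ_0` of `ℋ_0`, which is the ground ring. The Markov condition relates `ℋ_{n+1}` to the last
generator of `ℋ_{n+2}`. -/
structure IsNormalizedMarkovTrace (τ : ∀ n : ℕ, Hecke n →ₗ[GroundRing] GroundRing) : Prop where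
  zero : τ 0 1 = 1
  one : τ 1 1 = 1
  trace : ∀ (n : ℕ) (x y : Hecke (n + 1)), τ (n + 1) (x * y) = τ (n + 1) (y * x)
  markov : ∀ (n : ℕ) (x : Hecke (n + 1)),
    τ (n + 2) (Hecke.incl (n + 1) x * (Hecke.TUnit (Gen.last n)).val) =
      τ (n + 1) x
  markov_inv : ∀ (n : ℕ) (x : Hecke (n + 1)),
    τ (n + 2) (Hecke.incl (n + 1) x * (Hecke.TUnit (Gen.last n))⁻¹.val) =
      τ (n + 1) x

/-- The normalized Markov trace `{τ_n}` of the Iwahori--Hecke algebras (that there is exactly one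
is part of the main statement, so the choice made here is forced). -/
def heckeTrace : ∀ n : ℕ, Hecke n →ₗ[GroundRing] GroundRing :=
  Classical.epsilon IsNormalizedMarkovTrace

/-! ### The Yokonuma--Hecke algebra -/

/-- Generators `g_1, …, g_{n-1}, t_1, …, t_n`. -/
inductive YGen (n : ℕ) : Type
  | g (i : Gen n) : YGen n
  | t (j : Fin n) : YGen n

/-- The free generator `g_i`. -/
def fg {n : ℕ} (i : Gen n) : FreeAlgebra GroundRing (YGen n) := FreeAlgebra.ι GroundRing (YGen.g i)

/-- The free generator `t_j`. -/
def ft {n : ℕ} (j : Fin n) : FreeAlgebra GroundRing (YGen n) := FreeAlgebra.ι GroundRing (YGen.t j)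

/-- `d⁻¹ ∑_{0 ≤ s < d} a^s b^{-s}` for two elements whose `d`-th power is `1`; the power `b^{-s}` is
written `b^{d-s}`. -/
def avg (d : ℕ) {A : Type} [Ring A] [Algebra GroundRing A] (a b : A) : A :=
  const ((d : ℂ)⁻¹) • ∑ s ∈ Finset.range d, a ^ s * b ^ (d - s)

/-- Defining relations of the Yokonuma--Hecke algebra. -/
inductive YRel (d n : ℕ) :
    FreeAlgebra GroundRing (YGen n) → FreeAlgebra GroundRing (YGen n) → Prop
  | comm (i j : Gen n) (h : i.1 + 1 < j.1 ∨ j.1 + 1 < i.1) : YRel d n (fg i * fg j) (fg j * fg i)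
  | braid (i j : Gen n) (h : j.1 = i.1 + 1) : YRel d n (fg i * fg j * fg i) (fg j * fg i * fg j)
  | t_comm (i j : Fin n) : YRel d n (ft i * ft j) (ft j * ft i)
  | g_t (i : Gen n) (j : Fin n) : YRel d n (fg i * ft j) (ft (simpleRefl i j) * fg i)
  | t_pow (j : Fin n) : YRel d n (ft j ^ d) 1
  | quad (i : Gen n) :
      YRel d n (fg i ^ 2)
        (algebraMap GroundRing _ ((u : GroundRing) ^ 2) + v • (avg d (ft i.lo) (ft i.hi) * fg i))

/-- The Yokonuma--Hecke algebra `Y_{d,n}` over `ℂ[u^{±1}, v^{±1}]`. -/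
def Yoko (d n : ℕ) : Type := RingQuot (YRel d n)

instance instRingYoko (d n : ℕ) : Ring (Yoko d n) := inferInstanceAs (Ring (RingQuot (YRel d n)))

instance instAlgebraYoko (d n : ℕ) : Algebra GroundRing (Yoko d n) :=
  inferInstanceAs (Algebra GroundRing (RingQuot (YRel d n)))

namespace Yoko

theorem map_avg (d : ℕ) {A B : Type} [Ring A] [Algebra GroundRing A] [Ring B]
    [Algebra GroundRing B] (f : A →ₐ[GroundRing] B) (a b : A) :
    f (avg d a b) = avg d (f a) (f b) := by
  simp [avg]

/-- The quotient map from the free algebra. -/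
def mk (d n : ℕ) : FreeAlgebra GroundRing (YGen n) →ₐ[GroundRing] Yoko d n :=
  RingQuot.mkAlgHom GroundRing (YRel d n)

/-- The generators `g_i`. -/
def g {d n : ℕ} (i : Gen n) : Yoko d n := mk d n (fg i)

/-- The generators `t_j`. -/
def t {d n : ℕ} (j : Fin n) : Yoko d n := mk d n (ft j)

/-- The idempotent `e_i = d⁻¹ ∑_{0 ≤ s < d} t_i^s t_{i+1}^{-s}`. -/
def e {d n : ℕ} (i : Gen n) : Yoko d n := avg d (t i.lo) (t i.hi)

theorem mk_rel {d n : ℕ} {x y : FreeAlgebra GroundRing (YGen n)} (h : YRel d n x y) :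
    mk d n x = mk d n y := RingQuot.mkAlgHom_rel GroundRing h

theorem g_comm {d n : ℕ} (i j : Gen n) (h : i.1 + 1 < j.1 ∨ j.1 + 1 < i.1) :
    (g i * g j : Yoko d n) = g j * g i := by
  have := mk_rel (YRel.comm (d := d) i j h)
  simp only [map_mul] at this
  exact this

theorem g_braid {d n : ℕ} (i j : Gen n) (h : j.1 = i.1 + 1) :
    (g i * g j * g i : Yoko d n) = g j * g i * g j := by
  have := mk_rel (YRel.braid (d := d) i j h)
  simp only [map_mul] at this
  exact this

theorem t_comm {d n : ℕ} (i j : Fin n) : (t i * t j : Yoko d n) = t j * t i := by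
  have := mk_rel (YRel.t_comm (d := d) i j)
  simp only [map_mul] at this
  exact this

theorem g_t {d n : ℕ} (i : Gen n) (j : Fin n) :
    (g i * t j : Yoko d n) = t (simpleRefl i j) * g i := by
  have := mk_rel (YRel.g_t (d := d) i j)
  simp only [map_mul] at this
  exact this

theorem t_pow {d n : ℕ} (j : Fin n) : (t j ^ d : Yoko d n) = 1 := by
  have := mk_rel (YRel.t_pow (d := d) j)
  simp only [map_pow, map_one] at this
  exact this

theorem g_sq {d n : ℕ} (i : Gen n) :
    (g i * g i : Yoko d n) = algebraMap GroundRing _ ((u : GroundRing) ^ 2) + v • (e i * g i) := by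
  have := mk_rel (YRel.quad (d := d) i)
  rwa [pow_two, map_mul, map_add, map_smul, AlgHom.commutes, map_mul, map_avg] at this

theorem lift_rel {d n : ℕ} ⦃x y : FreeAlgebra GroundRing (YGen n)⦄ (h : YRel d n x y) :
    FreeAlgebra.lift GroundRing
        (fun z : YGen n => YGen.rec (motive := fun _ => Yoko d (n + 1))
          (fun i => g i.up) (fun j => t j.castSucc) z) x =
      FreeAlgebra.lift GroundRing
        (fun z : YGen n => YGen.rec (motive := fun _ => Yoko d (n + 1))
          (fun i => g i.up) (fun j => t j.castSucc) z) y := by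
  induction h with
  | comm i j h => simpa [fg] using g_comm i.up j.up h
  | braid i j h => simpa [fg] using g_braid i.up j.up h
  | t_comm i j => simpa [ft] using t_comm i.castSucc j.castSucc
  | g_t i j =>
    have h := g_t (d := d) i.up j.castSucc
    have h2 : simpleRefl i.up j.castSucc = (simpleRefl i j).castSucc := by
      simp only [simpleRefl]
      exact Equiv.swap_apply_def .. |>.trans (by
        rw [Equiv.swap_apply_def]
        simp only [Fin.ext_iff, Gen.lo, Gen.hi, Gen.up, Fin.val_castSucc]
        split_ifs <;> rfl)
    rw [h2] at h
    simpa [fg, ft] using h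
  | t_pow j => simpa [ft] using t_pow (d := d) j.castSucc
  | quad i =>
    have h := g_sq (d := d) i.up
    simp only [fg, ft, pow_two, map_avg, map_mul, map_add, map_smul, FreeAlgebra.lift_ι_apply,
      AlgHom.commutes] at h ⊢
    exact h

/-- The natural embedding `Y_{d,n} → Y_{d,n+1}`, sending each generator to the generator of the same
label. -/
def incl (d n : ℕ) : Yoko d n →ₐ[GroundRing] Yoko d (n + 1) :=
  RingQuot.liftAlgHom GroundRing ⟨_, lift_rel⟩

theorem incl_g {d n : ℕ} (i : Gen n) : incl d n (g i) = g i.up := by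
  refine (RingQuot.liftAlgHom_mkAlgHom_apply GroundRing _ lift_rel (fg i)).trans ?_
  rw [fg, FreeAlgebra.lift_ι_apply]

theorem incl_t {d n : ℕ} (j : Fin n) : incl d n (t j) = t j.castSucc := by
  refine (RingQuot.liftAlgHom_mkAlgHom_apply GroundRing _ lift_rel (ft j)).trans ?_
  rw [ft, FreeAlgebra.lift_ι_apply]

theorem g_mul_t_pow {d n : ℕ} (i : Gen n) (j : Fin n) (s : ℕ) :
    (g i * t j ^ s : Yoko d n) = t (simpleRefl i j) ^ s * g i :=
  SemiconjBy.pow_right (g_t (d := d) i j) s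

theorem g_e {d n : ℕ} (i : Gen n) : (g i * e i : Yoko d n) = e i * g i := by
  have hlo : simpleRefl i i.lo = i.hi := Equiv.swap_apply_left _ _
  have hhi : simpleRefl i i.hi = i.lo := Equiv.swap_apply_right _ _
  simp only [e, avg, mul_smul_comm, smul_mul_assoc]
  congr 1
  rw [Finset.mul_sum]
  have h1 : ∀ s ∈ Finset.range d, (g i * (t i.lo ^ s * t i.hi ^ (d - s)) : Yoko d n) =
      (t i.lo ^ (d - s) * t i.hi ^ (d - (d - s))) * g i := by
    intro s hs
    have hs' : d - (d - s) = s := by have := Finset.mem_range.1 hs; omega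
    rw [hs', ← mul_assoc, g_mul_t_pow, mul_assoc, g_mul_t_pow, hlo, hhi, ← mul_assoc]
    congr 1
    exact ((show Commute (t i.hi : Yoko d n) (t i.lo) from t_comm _ _).pow_pow _ _)
  rw [Finset.sum_congr rfl h1, ← Finset.sum_mul]
  congr 1
  set f : ℕ → Yoko d n := fun s => t i.lo ^ s * t i.hi ^ (d - s) with hf
  have h0 : f 0 = 1 := by simp [hf, t_pow]
  have hd : f d = 1 := by simp [hf, t_pow]
  have h2 : ∑ s ∈ Finset.range d, f (d - s) = ∑ s ∈ Finset.range d, f (s + 1) := by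
    rw [← Finset.sum_range_reflect]
    refine Finset.sum_congr rfl fun s hs => ?_
    have := Finset.mem_range.1 hs
    congr 1
    omega
  have h3 := Finset.sum_range_succ f d
  rw [Finset.sum_range_succ', h0, hd] at h3
  exact h2.trans (add_right_cancel h3)

/-- The generators `g_i` as units, with `g_i⁻¹ = u⁻² g_i - u⁻² v e_i`. -/
def gUnit {d n : ℕ} (i : Gen n) : (Yoko d n)ˣ where
  val := g i
  inv := (((u⁻¹ : GroundRingˣ) : GroundRing) ^ 2) • (g i - v • e i)
  val_inv := by
    rw [mul_smul_comm, mul_sub, g_sq, mul_smul_comm, g_e, add_sub_cancel_right,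
      Algebra.smul_def, ← map_mul, Hecke.u_inv_sq_mul, map_one]
  inv_val := by
    rw [smul_mul_assoc, sub_mul, g_sq, smul_mul_assoc, add_sub_cancel_right,
      Algebra.smul_def, ← map_mul, Hecke.u_inv_sq_mul, map_one]

/-- The element `g̃_w = u^{-ℓ(w)} g_{i_1} ⋯ g_{i_r}`, for a reduced expression of `w`. -/
def gtilde {d n : ℕ} (w : Equiv.Perm (Fin n)) : Yoko d n :=
  (((u⁻¹ : GroundRingˣ) : GroundRing) ^ len w) • ((reducedWord w).map g).prod

end Yoko

/-- A Markov trace on the algebras `Y_{d,n}`, `n ≥ 1`: the component `ρ n` is the linear function on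
`Y_{d,n+1}`. The Markov condition relates `Y_{d,n+1}` to the last generator `g` of `Y_{d,n+2}`. -/
structure IsMarkovTrace (d : ℕ) (ρ : ∀ n : ℕ, Yoko d (n + 1) →ₗ[GroundRing] GroundRing) :
    Prop where
  trace : ∀ (n : ℕ) (x y : Yoko d (n + 1)), ρ n (x * y) = ρ n (y * x)
  markov : ∀ (n : ℕ) (x : Yoko d (n + 1)),
    ρ (n + 1) (Yoko.incl d (n + 1) x * (Yoko.gUnit (Gen.last n)).val) = ρ n x
  markov_inv : ∀ (n : ℕ) (x : Yoko d (n + 1)),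
    ρ (n + 1) (Yoko.incl d (n + 1) x * (Yoko.gUnit (Gen.last n))⁻¹.val) = ρ n x

/-- The module of Markov traces (pointwise addition and scalar multiplication). -/
def markovTraces (d : ℕ) :
    Submodule GroundRing (∀ n : ℕ, Yoko d (n + 1) →ₗ[GroundRing] GroundRing) where
  carrier := {ρ | IsMarkovTrace d ρ}
  zero_mem' := ⟨fun _ _ _ => rfl, fun _ _ => rfl, fun _ _ => rfl⟩
  add_mem' := fun hρ hσ =>
    ⟨fun n x y => congrArg₂ (· + ·) (hρ.trace n x y) (hσ.trace n x y),
      fun n x => congrArg₂ (· + ·) (hρ.markov n x) (hσ.markov n x),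
      fun n x => congrArg₂ (· + ·) (hρ.markov_inv n x) (hσ.markov_inv n x)⟩
  smul_mem' := fun c _ hρ =>
    ⟨fun n x y => congrArg (c * ·) (hρ.trace n x y), fun n x => congrArg (c * ·) (hρ.markov n x),
      fun n x => congrArg (c * ·) (hρ.markov_inv n x)⟩

/-! ### Compositions -/

/-- The set `Comp_d(n)` of `d`-compositions of `n`. -/
abbrev Comp (d n : ℕ) : Type := {μ : Fin d → ℕ // ∑ a, μ a = n}

instance instFintypeComp (d n : ℕ) : Fintype (Comp d n) :=
  Fintype.subtype (Finset.piAntidiag Finset.univ n) (by simp)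

/-- The set `Comp_d^0` of `d`-compositions of positive size with all parts in `{0, 1}`. -/
abbrev Comp0 (d : ℕ) : Type := {ν : Fin d → ℕ // (∀ a, ν a = 0 ∨ ν a = 1) ∧ 1 ≤ ∑ a, ν a}

/-- The base `[μ]` of a composition of a positive integer. -/
def base {d n : ℕ} (μ : Comp d (n + 1)) : Comp0 d :=
  ⟨fun a => if 1 ≤ μ.1 a then 1 else 0, fun a => by dsimp only; split_ifs <;> simp, by
    by_contra h
    have h0 : ∀ a, (if 1 ≤ μ.1 a then 1 else 0) = 0 := fun a =>
      Finset.sum_eq_zero_iff.1 (Nat.lt_one_iff.1 (not_le.1 h)) a (Finset.mem_univ a)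
    have h1 : ∑ a, μ.1 a = 0 := Finset.sum_eq_zero fun a _ => by
      have := h0 a
      by_contra h2
      rw [if_pos (Nat.one_le_iff_ne_zero.2 h2)] at this
      exact one_ne_zero this
    have := μ.2
    omega⟩

/-! ### Characters of `(ℤ/dℤ)^n` and the idempotents -/

/-- A complex character of `(ℤ/dℤ)^n`, given by the labels of its values: after a labelling
`ξ_a`, `a : Fin d`, of the complex `d`-th roots of unity, `χ` is the character `t_j ↦ ξ_{χ j}`. -/
abbrev Char (d n : ℕ) : Type := Fin n → Fin d

/-- The action of the symmetric group, `w(χ)(t_i) = χ(t_{w⁻¹(i)})`. -/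
def act {d n : ℕ} (w : Equiv.Perm (Fin n)) (χ : Char d n) : Char d n := fun i => χ (w⁻¹ i)

/-- The composition `Comp(χ)`, whose part of index `a` is the number of `j` with
`χ(t_j) = ξ_a`. -/
def compOf {d n : ℕ} (χ : Char d n) : Comp d n :=
  ⟨fun a => (Finset.univ.filter fun j => χ j = a).card, by
    rw [← Finset.card_eq_sum_card_fiberwise (s := Finset.univ) (t := Finset.univ) (f := χ)
      (by simp)]
    simp⟩

/-- The orbit `𝒪(μ)`, of cardinality `m_μ`. It indexes rows and columns of the matrices. -/
abbrev Orbit {d n : ℕ} (μ : Comp d n) : Type := {χ : Char d n // compOf χ = μ}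

section Idempotents

variable {d n : ℕ} (ξ : Fin d ≃ rootsOfUnity d ℂ)

/-- The factor `d⁻¹ ∑_{0 ≤ s < d} ξ_a^s t_i^{-s}`. -/
def proj (a : Fin d) (i : Fin n) : Yoko d n :=
  avg d (algebraMap GroundRing (Yoko d n) (const ((ξ a : ℂˣ) : ℂ))) (Yoko.t i)

theorem proj_commute_t (a : Fin d) (i j : Fin n) : Commute (proj ξ a i) (Yoko.t j) := by
  unfold proj avg
  refine Commute.smul_left (Commute.sum_left _ _ _ fun s _ => Commute.mul_left ?_ ?_) _
  · exact (Algebra.commute_algebraMap_left _ _).pow_left _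
  · exact (show Commute (Yoko.t i : Yoko d n) (Yoko.t j) from Yoko.t_comm i j).pow_left _

theorem proj_commute (a b : Fin d) (i j : Fin n) : Commute (proj ξ a i) (proj ξ b j) := by
  rw [proj.eq_def ξ b j, avg]
  refine Commute.smul_right (Commute.sum_right _ _ _ fun s _ => Commute.mul_right ?_ ?_) _
  · exact (Algebra.commute_algebraMap_right _ _).pow_right _
  · exact (proj_commute_t ξ a i j).pow_right _

/-- The primitive idempotent `E_χ = ∏_i (d⁻¹ ∑_{0 ≤ s < d} χ(t_i)^s t_i^{-s})`. -/
def Echi (χ : Char d n) : Yoko d n :=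
  Finset.univ.noncommProd (fun i => proj ξ (χ i) i) fun _ _ _ _ _ => proj_commute ξ _ _ _ _

/-- The central idempotent `E_μ`. -/
def Emu (μ : Comp d n) : Yoko d n := ∑ χ : Orbit μ, Echi ξ χ.1

/-- The two-sided ideal `E_μ Y_{d,n}`, as a submodule. -/
def block (μ : Comp d n) : Submodule GroundRing (Yoko d n) :=
  LinearMap.range (LinearMap.mulLeft GroundRing (Emu ξ μ))

theorem t_mul_proj (a : Fin d) (i : Fin n) :
    Yoko.t i * proj ξ a i = const ((ξ a : ℂˣ) : ℂ) • proj ξ a i := by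
  set z : GroundRing := const ((ξ a : ℂˣ) : ℂ) with hz
  have hzd : z ^ d = 1 := by
    have h : ((ξ a : ℂˣ)) ^ d = 1 := (ξ a).2
    rw [hz, ← map_pow, ← Units.val_pow_eq_pow_val, h, Units.val_one, map_one]
  have h1 : ∀ s ∈ Finset.range d,
      (Yoko.t i * ((algebraMap GroundRing (Yoko d n) z) ^ s * Yoko.t i ^ (d - s)) : Yoko d n) =
        (algebraMap GroundRing (Yoko d n) z) ^ s * Yoko.t i ^ (d + 1 - s) := by
    intro s hs
    have : d + 1 - s = (d - s) + 1 := by have := Finset.mem_range.1 hs; omega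
    rw [this, pow_succ', ← mul_assoc, ← mul_assoc,
      ((Algebra.commute_algebraMap_left z (Yoko.t i : Yoko d n)).pow_left s).eq]
  have h2 : ∀ s ∈ Finset.range d,
      (z • ((algebraMap GroundRing (Yoko d n) z) ^ s * Yoko.t i ^ (d - s)) : Yoko d n) =
        (algebraMap GroundRing (Yoko d n) z) ^ (s + 1) * Yoko.t i ^ (d + 1 - (s + 1)) := by
    intro s _
    rw [Nat.add_sub_add_right, pow_succ', Algebra.smul_def, mul_assoc]
  simp only [proj, avg]
  rw [mul_smul_comm, smul_comm z]
  congr 1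
  rw [Finset.mul_sum, Finset.smul_sum, Finset.sum_congr rfl h1, Finset.sum_congr rfl h2]
  set f : ℕ → Yoko d n := fun s =>
    (algebraMap GroundRing (Yoko d n) z) ^ s * Yoko.t i ^ (d + 1 - s) with hf
  have h0 : f 0 = Yoko.t i := by simp [hf, pow_succ, Yoko.t_pow]
  have hd : f d = Yoko.t i := by
    have : d + 1 - d = 1 := by omega
    simp [hf, this, ← map_pow, hzd]
  have h3 := Finset.sum_range_succ f d
  rw [Finset.sum_range_succ', h0, hd] at h3
  exact (add_right_cancel h3).symm

theorem proj_mul_proj (a b : Fin d) (i : Fin n) :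
    proj ξ a i * proj ξ b i = if a = b then proj ξ b i else 0 := by
  have hpow : ∀ k : ℕ, Yoko.t i ^ k * proj ξ b i =
      (const ((ξ b : ℂˣ) : ℂ)) ^ k • proj ξ b i := by
    intro k
    induction k with
    | zero => simp
    | succ k ih => rw [pow_succ, mul_assoc, t_mul_proj, mul_smul_comm, ih, smul_smul, pow_succ']
  have hd0 : (d : ℂ) ≠ 0 := Nat.cast_ne_zero.2 (by have := a.2; omega)
  have key : ∑ s ∈ Finset.range d, ((ξ a : ℂˣ) : ℂ) ^ s * ((ξ b : ℂˣ) : ℂ) ^ (d - s) =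
      if a = b then (d : ℂ) else 0 := by
    have ha : ((ξ a : ℂˣ) : ℂ) ^ d = 1 := by
      rw [← Units.val_pow_eq_pow_val, show ((ξ a : ℂˣ)) ^ d = 1 from (ξ a).2, Units.val_one]
    have hb : ((ξ b : ℂˣ) : ℂ) ^ d = 1 := by
      rw [← Units.val_pow_eq_pow_val, show ((ξ b : ℂˣ)) ^ d = 1 from (ξ b).2, Units.val_one]
    split_ifs with hab
    · subst hab
      rw [Finset.sum_congr rfl (g := fun _ => (1 : ℂ)) (fun s hs => by
        rw [← pow_add, Nat.add_sub_cancel' (Finset.mem_range.1 hs).le, ha])]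
      simp
    · have hne : ((ξ a : ℂˣ) : ℂ) - ((ξ b : ℂˣ) : ℂ) ≠ 0 := by
        intro h
        exact hab (ξ.injective (Subtype.ext (Units.ext (sub_eq_zero.1 h))))
      have h := (Commute.all ((ξ a : ℂˣ) : ℂ) ((ξ b : ℂˣ) : ℂ)).geom_sum₂_mul d
      rw [ha, hb, sub_self] at h
      have h' := (mul_eq_zero.1 h).resolve_right hne
      rw [← zero_mul ((ξ b : ℂˣ) : ℂ), ← h', Finset.sum_mul]
      refine Finset.sum_congr rfl fun s hs => ?_
      have : d - s = (d - 1 - s) + 1 := by have := Finset.mem_range.1 hs; omega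
      rw [this, pow_succ, mul_assoc]
  have hsum : proj ξ a i * proj ξ b i = const ((d : ℂ)⁻¹ *
      ∑ s ∈ Finset.range d, ((ξ a : ℂˣ) : ℂ) ^ s * ((ξ b : ℂˣ) : ℂ) ^ (d - s)) •
        proj ξ b i := by
    rw [proj.eq_def ξ a i, avg, smul_mul_assoc, Finset.sum_mul, map_mul, mul_smul, map_sum,
      Finset.sum_smul]
    congr 1
    refine Finset.sum_congr rfl fun s _ => ?_
    rw [mul_assoc, hpow, ← map_pow, ← Algebra.smul_def, smul_smul, map_mul, map_pow, map_pow]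
  rw [hsum, key]
  split_ifs with hab
  · rw [inv_mul_cancel₀ hd0, map_one, one_smul]
  · rw [mul_zero, map_zero, zero_smul]

theorem Echi_mul_Echi (χ ψ : Char d n) :
    Echi ξ χ * Echi ξ ψ = if χ = ψ then Echi ξ ψ else 0 := by
  have hmul := Finset.noncommProd_mul_distrib (s := Finset.univ) (fun i => proj ξ (χ i) i)
    (fun i => proj ξ (ψ i) i) (fun _ _ _ _ _ => proj_commute ξ _ _ _ _)
    (fun _ _ _ _ _ => proj_commute ξ _ _ _ _) (fun _ _ _ _ _ => proj_commute ξ _ _ _ _)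
  refine hmul.symm.trans ?_
  split_ifs with h
  · subst h
    exact Finset.noncommProd_congr rfl (fun i _ => by simp [proj_mul_proj]) _
  · obtain ⟨i, hi⟩ := Function.ne_iff.1 h
    rw [← Finset.mul_noncommProd_erase _ (Finset.mem_univ i)]
    simp [proj_mul_proj, hi]

theorem Emu_mul_Echi {μ : Comp d n} (χ : Orbit μ) : Emu ξ μ * Echi ξ χ.1 = Echi ξ χ.1 := by
  rw [Emu, Finset.sum_mul, Finset.sum_eq_single χ]
  · simp [Echi_mul_Echi]
  · intro ψ _ h
    rw [Echi_mul_Echi, if_neg fun h' => h (Subtype.ext h')]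
  · simp

theorem Emu_mul_mem (μ : Comp d n) (x : Yoko d n) : Emu ξ μ * x ∈ block ξ μ := ⟨x, rfl⟩

theorem Echi_mul_mem {μ : Comp d n} (χ : Orbit μ) (x : Yoko d n) : Echi ξ χ.1 * x ∈ block ξ μ :=
  ⟨Echi ξ χ.1 * x, by rw [LinearMap.mulLeft_apply, ← mul_assoc, Emu_mul_Echi]⟩

end Idempotents

/-! ### Young subgroups, coset representatives, and the algebras `ℋ^μ` -/

section Blocks

variable {d n : ℕ}

/-- The letters cut into consecutive blocks of sizes `μ_1, …, μ_d`: the pair `(a, k)` goes to the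
letter `μ_1 + ⋯ + μ_{a-1} + k`. -/
def blockEquiv (μ : Comp d n) : (Σ a, Fin (μ.1 a)) ≃ Fin n :=
  finSigmaFinEquiv.trans (finCongr μ.2)

/-- The inclusion of the Young subgroup `𝔖_{μ_1} × ⋯ × 𝔖_{μ_d}` in `𝔖_n`, the factor of index `a`
acting on the block of index `a`. -/
def young (μ : Comp d n) (y : ∀ a, Equiv.Perm (Fin (μ.1 a))) : Equiv.Perm (Fin n) :=
  (blockEquiv μ).permCongr (Equiv.Perm.sigmaCongrRight y)

/-- The distinguished character `χ_1^μ`, equal to `ξ_a` on the block of index `a`. -/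
def chiOne (μ : Comp d n) : Char d n := fun i => ((blockEquiv μ).symm i).1

theorem exists_rep {μ : Comp d n} (χ : Orbit μ) :
    ∃ π : Equiv.Perm (Fin n), act π (chiOne μ) = χ.1 := by
  have hcard : ∀ a, Nonempty (Fin (μ.1 a) ≃ {j // χ.1 j = a}) := fun a =>
    Fintype.card_eq.1 (by
      rw [Fintype.card_fin, Fintype.card_subtype]
      exact (congrFun (congrArg Subtype.val χ.2) a).symm)
  let E : ∀ a, Fin (μ.1 a) ≃ {j // χ.1 j = a} := fun a => (hcard a).some
  let π : Equiv.Perm (Fin n) := (blockEquiv μ).symm.trans ((Equiv.sigmaCongrRight E).trans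
    (Equiv.sigmaFiberEquiv χ.1))
  have h : ∀ j, χ.1 (π j) = chiOne μ j := fun j =>
    (E ((blockEquiv μ).symm j).1 ((blockEquiv μ).symm j).2).2
  refine ⟨π, funext fun i => ?_⟩
  rw [act, ← h]
  exact congrArg χ.1 (π.apply_symm_apply i)

theorem exists_minimal_rep {μ : Comp d n} (χ : Orbit μ) :
    ∃ π : Equiv.Perm (Fin n), act π (chiOne μ) = χ.1 ∧
      ∀ σ : Equiv.Perm (Fin n), act σ (chiOne μ) = χ.1 → len π ≤ len σ :=
  Set.exists_min_image {π | act π (chiOne μ) = χ.1} len (Set.toFinite _) (exists_rep χ)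

/-- The element `π` of minimal length with `π(χ_1^μ) = χ`, that is, the distinguished left coset
representative modulo the Young subgroup attached to `χ`. -/
def rep {μ : Comp d n} (χ : Orbit μ) : Equiv.Perm (Fin n) := (exists_minimal_rep χ).choose

theorem rep_spec {μ : Comp d n} (χ : Orbit μ) :
    act (rep χ) (chiOne μ) = χ.1 ∧
      ∀ σ : Equiv.Perm (Fin n), act σ (chiOne μ) = χ.1 → len (rep χ) ≤ len σ :=
  (exists_minimal_rep χ).choose_spec

/-- The algebra `ℋ^μ = ℋ_{μ_1} ⊗ ⋯ ⊗ ℋ_{μ_d}`. -/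
abbrev HeckeTensor (μ : Comp d n) : Type := ⨂[GroundRing] a : Fin d, Hecke (μ.1 a)

/-- The linear function `τ_{μ_1} ⊗ ⋯ ⊗ τ_{μ_d}` on `ℋ^μ`. -/
def tensorTrace (μ : Comp d n) : HeckeTensor μ →ₗ[GroundRing] GroundRing :=
  PiTensorProduct.lift
    ((MultilinearMap.mkPiAlgebra GroundRing (Fin d) GroundRing).compLinearMap
      fun a => heckeTrace (μ.1 a))

/-- The defining property of `Ψ_μ : E_μ Y_{d,n} → Mat_{m_μ}(ℋ^μ)`: if `χ, ψ ∈ 𝒪(μ)` and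
`w(ψ) = χ`, so that `π_χ⁻¹ w π_ψ` is an element `(y_1, …, y_d)` of the Young subgroup, then
`Ψ_μ(E_χ g̃_w)` is the matrix with the single entry `T̃_{y_1} ⊗ ⋯ ⊗ T̃_{y_d}` in position `(χ, ψ)`. -/
def IsPsi (ξ : Fin d ≃ rootsOfUnity d ℂ) (μ : Comp d n)
    (Ψ : block ξ μ →ₗ[GroundRing] Matrix (Orbit μ) (Orbit μ) (HeckeTensor μ)) : Prop :=
  ∀ (χ ψ : Orbit μ) (w : Equiv.Perm (Fin n)) (y : ∀ a, Equiv.Perm (Fin (μ.1 a))),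
    act w ψ.1 = χ.1 → (rep χ)⁻¹ * w * rep ψ = young μ y →
      Ψ ⟨Echi ξ χ.1 * Yoko.gtilde w, Echi_mul_mem ξ χ _⟩ =
        Matrix.single χ ψ (⨂ₜ[GroundRing] a, Hecke.Ttilde (y a))

/-- The linear map `Ψ_μ` (that there is exactly one is part of the main statement, so the
choice made here is forced). -/
def Psi (ξ : Fin d ≃ rootsOfUnity d ℂ) (μ : Comp d n) :
    block ξ μ →ₗ[GroundRing] Matrix (Orbit μ) (Orbit μ) (HeckeTensor μ) :=
  Classical.epsilon (IsPsi ξ μ)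

/-- `((τ_{μ_1} ⊗ ⋯ ⊗ τ_{μ_d}) ∘ Tr ∘ Ψ_μ)(E_μ x)`. -/
def blockTrace (ξ : Fin d ≃ rootsOfUnity d ℂ) (μ : Comp d n) (x : Yoko d n) : GroundRing :=
  tensorTrace μ (Matrix.trace (Psi ξ μ ⟨Emu ξ μ * x, Emu_mul_mem ξ μ x⟩))

end Blocks

end

end YH

/-!
The idempotents `E_χ` reduce everything to Hecke algebras of type `A`.

*Hecke algebras.* Uniqueness of the normalized Markov trace comes from the decomposition `ℋ_{n+2}
= ℋ_{n+1} + ℋ_{n+1} T ℋ_{n+1}` (`Hecke.span_eq_top`): the Markov conditions and `T - u² T⁻¹ = v`,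
with `v` a unit, give the value on both summands. For existence, `ℋ_{n+1}` acts on the would-be
induced module `⊕_p c_p ℋ_n` (`Hecke.induced`), and a suitable `ℋ_n`-linear function on it yields
a bimodule map `ℋ_{n+1} → ℋ_n`, the conditional expectation `Hecke.condExp`. The iterated
conditional expectation is a trace because conjugation by the newest generator is compatible with
it (`Hecke.condExp_T_incl_T`). No basis of `ℋ_n` is needed.

*The map `Ψ_μ`.* There is a homomorphism `repr` from the whole of `Y_{d,n}` to the matrices over
`ℋ^μ`: the `t_j` act diagonally through the characters, and `g_i` by a monomial matrix with entry
`u` where it moves the character `χ`, and with a generator of the tensor factor `a` where both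
letters have the value `ξ_a`; which generator is told by the rank of the letter among those with
the same value. Minimality of `π_χ` means that it lists the letters of each value in increasing
order (`pos_strictMono`), and an induction on ascents, which rests on Matsumoto's theorem
(`prod_eq_of_reduced`), shows that `repr` has the prescribed values on the `E_χ g̃_w`
(`repr_Echi_mul_gtilde`). These elements span, so `Ψ_μ` is the restriction of `repr` to the block.

*Sums of block traces are Markov traces.* On the characters that extend `χ` by the value `ξ_a` the
algebra on one strand less acts through the inclusion of the tensor products
(`extendMatrix_mul_repr`). So the diagonal entry of `x g` at such an extension is `0` unless `ξ_a`
is the value of `χ` on its last letter, and then the Markov property of one tensor factor applies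
(`diagTrace_extend_g`); in that case the extension does not change the base of the composition.

*There are no others.* `Y_{d,n+2}` is spanned by the products `x g y` and `x p_a`, where `x`, `y`
come from `Y_{d,n+1}` and `p_a` forces the value `ξ_a` on the last letter
(`decomposition_eq_top`). Hence a Markov trace that vanishes on `n + 1` strands vanishes on `E_χ
Y_{d,n+2}` as soon as `χ` takes the same value on the last two letters, and, by conjugation, as
soon as `χ` is not injective. If `χ` is injective, `E_χ Y E_χ` is spanned by `E_χ`. So a Markov
trace is determined by its values at the `E_χ` with `χ` injective (`IsMarkovTrace.eq_zero`), which
depend only on the set of values of `χ`. The trace with parameters `α` has the value `α_{[μ]}` at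
`E_χ` for an injective `χ ∈ 𝒪(μ)` (`comboTrace_Echi`), and the nonempty subsets of the `d` labels
give the rank `2^d - 1`.
-/

namespace YH

noncomputable section

/-! ### Length, inversions and reduced words in the symmetric group -/

section Symmetric

variable {n : ℕ}

theorem Gen.lo_lt_hi (i : Gen n) : i.lo < i.hi := Nat.lt_succ_self _

theorem Gen.lo_ne_hi (i : Gen n) : i.lo ≠ i.hi := i.lo_lt_hi.ne

theorem Gen.hi_eq_lo {i j : Gen n} (h : j.1 = i.1 + 1) : i.hi = j.lo := Fin.ext h.symm

@[simp] theorem simpleRefl_lo (i : Gen n) : simpleRefl i i.lo = i.hi := Equiv.swap_apply_left _ _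

@[simp] theorem simpleRefl_hi (i : Gen n) : simpleRefl i i.hi = i.lo := Equiv.swap_apply_right _ _

theorem simpleRefl_of_ne {i : Gen n} {x : Fin n} (h : x ≠ i.lo) (h' : x ≠ i.hi) :
    simpleRefl i x = x := Equiv.swap_apply_of_ne_of_ne h h'

@[simp] theorem simpleRefl_mul_self (i : Gen n) : simpleRefl i * simpleRefl i = 1 :=
  Equiv.swap_mul_self _ _

@[simp] theorem simpleRefl_apply_apply (i : Gen n) (x : Fin n) :
    simpleRefl i (simpleRefl i x) = x := Equiv.swap_apply_self _ _ _

@[simp] theorem simpleRefl_inv (i : Gen n) : (simpleRefl i)⁻¹ = simpleRefl i :=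
  Equiv.swap_inv _ _

@[simp] theorem mul_simpleRefl_cancel (w : Equiv.Perm (Fin n)) (i : Gen n) :
    w * simpleRefl i * simpleRefl i = w := by rw [mul_assoc, simpleRefl_mul_self, mul_one]

theorem simpleRefl_comm {i j : Gen n} (h : i.1 + 1 < j.1 ∨ j.1 + 1 < i.1) :
    simpleRefl i * simpleRefl j = simpleRefl j * simpleRefl i := by
  refine (Equiv.Perm.disjoint_swap_swap ?_).commute.eq
  simp only [List.nodup_cons, List.mem_cons, List.not_mem_nil, or_false, not_or, Gen.lo, Gen.hi,
    Fin.ext_iff, not_false_eq_true, List.nodup_nil, and_true]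
  omega

theorem simpleRefl_braid {i j : Gen n} (h : j.1 = i.1 + 1) :
    simpleRefl i * simpleRefl j * simpleRefl i = simpleRefl j * simpleRefl i * simpleRefl j := by
  have h1 := i.lo_ne_hi
  have h2 := j.lo_ne_hi
  have h3 : i.lo ≠ j.hi := fun e => by
    have := congrArg Fin.val e; simp only [Gen.lo, Gen.hi] at this; omega
  have h4 := Gen.hi_eq_lo h
  simp only [simpleRefl]
  rw [h4, Equiv.swap_mul_swap_mul_swap (h4 ▸ h1) h3, Equiv.swap_comm j.lo j.hi,
    Equiv.swap_comm i.lo j.lo, Equiv.swap_mul_swap_mul_swap h2.symm h3.symm, Equiv.swap_comm]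

/-- The inversions of `w`: the pairs `p < q` with `w p > w q`. -/
def inversions (w : Equiv.Perm (Fin n)) : Finset (Fin n × Fin n) :=
  {p | p.1 < p.2 ∧ w p.2 < w p.1}

theorem mem_inversions {w : Equiv.Perm (Fin n)} {p q : Fin n} :
    (p, q) ∈ inversions w ↔ p < q ∧ w q < w p := by
  simp [inversions]

theorem simpleRefl_lt {i : Gen n} {p q : Fin n} (h : p < q) (hne : ¬(p = i.lo ∧ q = i.hi)) :
    simpleRefl i p < simpleRefl i q := by
  simp only [simpleRefl, Equiv.swap_apply_def, Gen.lo, Gen.hi, Fin.ext_iff, Fin.lt_def] at *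
  split_ifs <;> simp_all <;> omega

theorem card_inversions_mul {w : Equiv.Perm (Fin n)} {i : Gen n} (h : w i.lo < w i.hi) :
    (inversions (w * simpleRefl i)).card = (inversions w).card + 1 := by
  have hnot : (i.lo, i.hi) ∉ (inversions w).map
      (Equiv.prodCongr (simpleRefl i) (simpleRefl i)).toEmbedding := by
    intro hm
    obtain ⟨⟨p, q⟩, hpq, he⟩ := Finset.mem_map.1 hm
    simp only [inversions, Finset.mem_filter, Finset.mem_univ, true_and] at hpq
    simp only [Equiv.coe_toEmbedding, Equiv.prodCongr_apply, Prod.map_apply, Prod.mk.injEq] at he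
    have hp : p = i.hi := by rw [← simpleRefl_apply_apply i p, he.1, simpleRefl_lo]
    have hq : q = i.lo := by rw [← simpleRefl_apply_apply i q, he.2, simpleRefl_hi]
    rw [hp, hq] at hpq
    exact absurd hpq.1 i.lo_lt_hi.not_gt
  rw [← Finset.card_map (s := inversions w)
      (Equiv.prodCongr (simpleRefl i) (simpleRefl i)).toEmbedding,
    ← Finset.card_insert_of_notMem hnot]
  congr 1
  ext ⟨p, q⟩
  have hmap : (p, q) ∈ (inversions w).map
      (Equiv.prodCongr (simpleRefl i) (simpleRefl i)).toEmbedding ↔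
      simpleRefl i p < simpleRefl i q ∧ w (simpleRefl i q) < w (simpleRefl i p) := by
    constructor
    · intro hm
      obtain ⟨⟨p', q'⟩, hpq, he⟩ := Finset.mem_map.1 hm
      simp only [Equiv.coe_toEmbedding, Equiv.prodCongr_apply, Prod.map_apply,
        Prod.mk.injEq] at he
      simpa [inversions, ← he.1, ← he.2] using hpq
    · intro hm
      exact Finset.mem_map.2 ⟨(simpleRefl i p, simpleRefl i q), by simpa [inversions] using hm,
        by simp⟩
  rw [Finset.mem_insert, hmap]
  simp only [mem_inversions, Equiv.Perm.mul_apply, Prod.mk.injEq]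
  by_cases hpq : p = i.lo ∧ q = i.hi
  · simp [hpq.1, hpq.2, h, i.lo_lt_hi]
  · simp only [hpq, false_or]
    refine and_congr_left fun hw => ⟨fun hlt => simpleRefl_lt hlt hpq, fun hlt => ?_⟩
    by_cases hqp : simpleRefl i p = i.lo ∧ simpleRefl i q = i.hi
    · rw [hqp.1, hqp.2] at hw
      exact absurd hw h.not_gt
    · simpa using simpleRefl_lt hlt hqp

theorem card_inversions_mul_of_gt {w : Equiv.Perm (Fin n)} {i : Gen n} (h : w i.hi < w i.lo) :
    (inversions (w * simpleRefl i)).card + 1 = (inversions w).card := by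
  have := card_inversions_mul (w := w * simpleRefl i) (i := i) (by simpa using h)
  rw [mul_simpleRefl_cancel] at this
  exact this.symm

theorem apply_lo_ne_apply_hi (w : Equiv.Perm (Fin n)) (i : Gen n) : w i.lo ≠ w i.hi :=
  w.injective.ne i.lo_ne_hi

theorem eq_one_of_forall_lt {w : Equiv.Perm (Fin n)} (h : ∀ i : Gen n, w i.lo < w i.hi) :
    w = 1 := by
  cases n with
  | zero => exact Subsingleton.elim _ _
  | succ m =>
    have hmono : StrictMono w :=
      Fin.strictMono_iff_lt_succ.2 fun i => h ⟨i.1, Nat.succ_lt_succ i.2⟩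
    refine Equiv.coe_fn_injective (hmono.range_inj strictMono_id |>.1 ?_)
    rw [w.surjective.range_eq, Set.range_id]

/-- Induction on a permutation by ascents: a property of the identity that passes from `w` to
`w s_i` whenever this increases the length holds for all permutations. -/
theorem perm_induction {P : Equiv.Perm (Fin n) → Prop} (one : P 1)
    (step : ∀ (w : Equiv.Perm (Fin n)) (i : Gen n), w i.lo < w i.hi → P w → P (w * simpleRefl i))
    (w : Equiv.Perm (Fin n)) : P w := by
  induction hk : (inversions w).card using Nat.strong_induction_on generalizing w with
  | _ k ih =>
    by_cases hw : ∀ i : Gen n, w i.lo < w i.hi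
    · rw [eq_one_of_forall_lt hw]; exact one
    · push Not at hw
      obtain ⟨i, hi⟩ := hw
      have hlt := lt_of_le_of_ne hi (apply_lo_ne_apply_hi w i).symm
      have hc := card_inversions_mul_of_gt hlt
      have := step (w * simpleRefl i) i (by simpa using hlt) (ih _ (by omega) _ rfl)
      rwa [mul_simpleRefl_cancel] at this

theorem isExpr_append {w : Equiv.Perm (Fin n)} {l : List (Gen n)} {i : Gen n} :
    IsExpr w (l ++ [i]) ↔ IsExpr (w * simpleRefl i) l := by
  simp only [IsExpr, List.map_append, List.map_cons, List.map_nil, List.prod_append,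
    List.prod_cons, List.prod_nil, mul_one]
  constructor
  · intro h; rw [← h, mul_simpleRefl_cancel]
  · intro h; rw [h, mul_simpleRefl_cancel]

theorem len_le {w : Equiv.Perm (Fin n)} {l : List (Gen n)} (h : IsExpr w l) : len w ≤ l.length :=
  Nat.sInf_le ⟨l, h, rfl⟩

theorem card_inversions_le {w : Equiv.Perm (Fin n)} {l : List (Gen n)} (h : IsExpr w l) :
    (inversions w).card ≤ l.length := by
  induction l using List.reverseRecOn generalizing w with
  | nil =>
    have : w = 1 := h.symm
    subst this
    simp only [inversions, Equiv.Perm.one_apply, List.length_nil, Nat.le_zero,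
      Finset.card_eq_zero]
    exact Finset.filter_eq_empty_iff.2 fun p _ hp => absurd hp.1 hp.2.not_gt
  | append_singleton l i ih =>
    have := ih (isExpr_append.1 h)
    rw [List.length_append, List.length_singleton]
    rcases lt_or_gt_of_ne (apply_lo_ne_apply_hi w i) with hlt | hgt
    · have := card_inversions_mul hlt; omega
    · have := card_inversions_mul_of_gt hgt; omega

theorem exists_isExpr_card (w : Equiv.Perm (Fin n)) :
    ∃ l, IsExpr w l ∧ l.length = (inversions w).card := by
  induction w using perm_induction with
  | one => exact ⟨[], rfl, (Nat.le_zero.1 (card_inversions_le (w := 1) (l := []) rfl)).symm⟩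
  | step w i h ih =>
    obtain ⟨l, hl, hc⟩ := ih
    refine ⟨l ++ [i], isExpr_append.2 (by rwa [mul_simpleRefl_cancel]), ?_⟩
    rw [card_inversions_mul h, ← hc, List.length_append, List.length_singleton]

/-- The length of a permutation is its number of inversions. -/
theorem len_eq_card_inversions (w : Equiv.Perm (Fin n)) : len w = (inversions w).card := by
  obtain ⟨l, hl, hc⟩ := exists_isExpr_card w
  obtain ⟨l', hl', hc'⟩ := exists_reduced w
  exact le_antisymm (hc ▸ len_le hl) (hc' ▸ card_inversions_le hl')

@[simp] theorem len_one : len (1 : Equiv.Perm (Fin n)) = 0 :=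
  Nat.le_zero.1 (len_le (l := []) rfl)

theorem len_mul_of_lt {w : Equiv.Perm (Fin n)} {i : Gen n} (h : w i.lo < w i.hi) :
    len (w * simpleRefl i) = len w + 1 := by
  rw [len_eq_card_inversions, len_eq_card_inversions, card_inversions_mul h]

theorem len_mul_of_gt {w : Equiv.Perm (Fin n)} {i : Gen n} (h : w i.hi < w i.lo) :
    len (w * simpleRefl i) + 1 = len w := by
  rw [len_eq_card_inversions, len_eq_card_inversions, card_inversions_mul_of_gt h]

theorem descent_of_reduced {w : Equiv.Perm (Fin n)} {l : List (Gen n)} {i : Gen n}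
    (h : IsExpr w (l ++ [i])) (hl : (l ++ [i]).length = len w) :
    w i.hi < w i.lo ∧ IsExpr (w * simpleRefl i) l ∧ l.length = len (w * simpleRefl i) := by
  have h' := isExpr_append.1 h
  have hle := len_le h'
  rw [List.length_append, List.length_singleton] at hl
  rcases lt_or_gt_of_ne (apply_lo_ne_apply_hi w i) with hlt | hgt
  · have := len_mul_of_lt hlt; omega
  · have := len_mul_of_gt hgt; exact ⟨hgt, h', by omega⟩

/-- Matsumoto's theorem for the symmetric group: if the images of the simple transpositions in a
monoid satisfy the braid relations, the product along a reduced expression of `w` depends only on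
`w`. The two last letters of the expressions are descents of `w`, so that both expressions can be
compared with one that ends in the longest word on these two letters. -/
theorem prod_eq_of_reduced {A : Type*} [Monoid A] {f : Gen n → A}
    (comm : ∀ i j : Gen n, (i.1 + 1 < j.1 ∨ j.1 + 1 < i.1) → f i * f j = f j * f i)
    (braid : ∀ i j : Gen n, j.1 = i.1 + 1 → f i * f j * f i = f j * f i * f j)
    {w : Equiv.Perm (Fin n)} {l l' : List (Gen n)} (hl : IsExpr w l) (hl' : IsExpr w l')
    (hlen : l.length = len w) (hlen' : l'.length = len w) :
    (l.map f).prod = (l'.map f).prod := by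
  induction hk : len w using Nat.strong_induction_on generalizing w l l' with
  | _ k ih =>
    rcases List.eq_nil_or_concat l with rfl | ⟨l₀, i, rfl⟩
    · rw [← hlen] at hlen'
      rw [List.length_eq_zero_iff.1 hlen']
    rcases List.eq_nil_or_concat l' with rfl | ⟨l₀', j, rfl⟩
    · rw [← hlen'] at hlen
      simp at hlen
    rw [List.concat_eq_append] at hl hlen hl' hlen' ⊢
    rw [List.concat_eq_append]
    obtain ⟨hi, he, hle⟩ := descent_of_reduced hl hlen
    obtain ⟨hj, he', hle'⟩ := descent_of_reduced hl' hlen'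
    have hwi := len_mul_of_gt hi
    have hwj := len_mul_of_gt hj
    -- For distant last letters the comparison is with words that end in `j i` and `i j`.
    have far : ∀ i j : Gen n, (i.1 + 1 < j.1 ∨ j.1 + 1 < i.1) →
        w i.hi < w i.lo → w j.hi < w j.lo →
        ∀ l₀ l₀' : List (Gen n), IsExpr (w * simpleRefl i) l₀ →
        l₀.length = len (w * simpleRefl i) → IsExpr (w * simpleRefl j) l₀' →
        l₀'.length = len (w * simpleRefl j) →
        (l₀.map f).prod * f i = (l₀'.map f).prod * f j := by
      intro i j hij hi hj l₀ l₀' he hle he' hle'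
      have hwi := len_mul_of_gt hi
      have hwj := len_mul_of_gt hj
      obtain ⟨m, hm, hml⟩ := exists_reduced (w * simpleRefl i * simpleRefl j)
      have hd : (w * simpleRefl i) j.hi < (w * simpleRefl i) j.lo := by
        simp only [Equiv.Perm.mul_apply]
        rw [simpleRefl_of_ne, simpleRefl_of_ne]
        · exact hj
        all_goals
          simp only [Gen.lo, Gen.hi, ne_eq, Fin.ext_iff]; omega
      have hwij := len_mul_of_gt hd
      rw [ih _ (by omega) (l := l₀) (l' := m ++ [j]) he (isExpr_append.2 hm) hle
          (by simp; omega) rfl,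
        ih _ (by omega) (l := l₀') (l' := m ++ [i]) he'
          (isExpr_append.2 (by
            rwa [mul_assoc, simpleRefl_comm hij.symm, ← mul_assoc])) hle' (by simp; omega) rfl]
      simp [mul_assoc, comm i j hij]
    -- For adjacent last letters it is with words that end in `i j i` and `j i j`.
    have near : ∀ i j : Gen n, j.1 = i.1 + 1 → w i.hi < w i.lo → w j.hi < w j.lo →
        ∀ l₀ l₀' : List (Gen n), IsExpr (w * simpleRefl i) l₀ →
        l₀.length = len (w * simpleRefl i) → IsExpr (w * simpleRefl j) l₀' →
        l₀'.length = len (w * simpleRefl j) →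
        (l₀.map f).prod * f i = (l₀'.map f).prod * f j := by
      intro i j hij hi hj l₀ l₀' he hle he' hle'
      have hwi := len_mul_of_gt hi
      have hwj := len_mul_of_gt hj
      obtain ⟨m, hm, hml⟩ := exists_reduced (w * simpleRefl i * simpleRefl j * simpleRefl i)
      have hb := Gen.hi_eq_lo hij
      have hlo : simpleRefl j i.lo = i.lo := simpleRefl_of_ne (hb ▸ i.lo_ne_hi) (by
        simp only [Gen.lo, Gen.hi, ne_eq, Fin.ext_iff]; omega)
      have hhi : simpleRefl i j.hi = j.hi := simpleRefl_of_ne (by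
        simp only [Gen.lo, Gen.hi, ne_eq, Fin.ext_iff]; omega) (hb ▸ j.lo_ne_hi.symm)
      have hd : (w * simpleRefl i) j.hi < (w * simpleRefl i) j.lo := by
        simp only [Equiv.Perm.mul_apply]
        rw [hhi, ← hb, simpleRefl_hi]
        exact hj.trans (hb ▸ hi)
      have hd' : (w * simpleRefl i * simpleRefl j) i.hi <
          (w * simpleRefl i * simpleRefl j) i.lo := by
        simp only [Equiv.Perm.mul_apply]
        rw [hlo, simpleRefl_lo, hb, simpleRefl_lo, hhi]
        exact hj
      have hwij := len_mul_of_gt hd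
      have hwiji := len_mul_of_gt hd'
      rw [ih _ (by omega) (l := l₀) (l' := (m ++ [i]) ++ [j]) he
          (isExpr_append.2 (isExpr_append.2 hm)) hle (by simp; omega) rfl,
        ih _ (by omega) (l := l₀') (l' := (m ++ [j]) ++ [i]) he'
          (isExpr_append.2 (isExpr_append.2 (by
            rw [mul_assoc w, mul_assoc w, simpleRefl_braid hij] at hm
            rwa [mul_assoc, mul_assoc, ← mul_assoc (simpleRefl j)]))) hle' (by simp; omega) rfl]
      simpa [mul_assoc] using congrArg ((m.map f).prod * ·) (braid i j hij)
    rw [List.map_append, List.prod_append, List.map_append, List.prod_append]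
    simp only [List.map_cons, List.map_nil, List.prod_cons, List.prod_nil, mul_one]
    rcases lt_trichotomy i.1 j.1 with hij | hij | hij
    · rcases Nat.lt_or_ge (i.1 + 1) j.1 with h | h
      · exact far i j (Or.inl h) hi hj _ _ he hle he' hle'
      · exact near i j (by omega) hi hj _ _ he hle he' hle'
    · obtain rfl : i = j := Subtype.ext hij
      rw [ih _ (by omega) he he' hle hle' rfl]
    · rcases Nat.lt_or_ge (j.1 + 1) i.1 with h | h
      · exact far i j (Or.inr h) hi hj _ _ he hle he' hle'
      · exact (near j i (by omega) hj hi _ _ he' hle' he hle).symm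

theorem prod_reducedWord_mul {A : Type*} [Monoid A] {f : Gen n → A}
    (comm : ∀ i j : Gen n, (i.1 + 1 < j.1 ∨ j.1 + 1 < i.1) → f i * f j = f j * f i)
    (braid : ∀ i j : Gen n, j.1 = i.1 + 1 → f i * f j * f i = f j * f i * f j)
    {w : Equiv.Perm (Fin n)} {i : Gen n} (h : w i.lo < w i.hi) :
    ((reducedWord (w * simpleRefl i)).map f).prod = ((reducedWord w).map f).prod * f i := by
  obtain ⟨h1, h2⟩ := reducedWord_spec (w * simpleRefl i)
  obtain ⟨h3, h4⟩ := reducedWord_spec w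
  rw [prod_eq_of_reduced comm braid h1 (l' := reducedWord w ++ [i])
    (isExpr_append.2 (by rwa [mul_simpleRefl_cancel])) h2 (by simp [h4, len_mul_of_lt h])]
  simp

theorem reducedWord_one : reducedWord (1 : Equiv.Perm (Fin n)) = [] :=
  List.length_eq_zero_iff.1 ((reducedWord_spec _).2.trans len_one)

end Symmetric

theorem Hecke.Ttilde_one {n : ℕ} : Hecke.Ttilde (1 : Equiv.Perm (Fin n)) = 1 := by
  simp [Hecke.Ttilde, reducedWord_one]

theorem Hecke.Ttilde_mul {n : ℕ} {w : Equiv.Perm (Fin n)} {i : Gen n} (h : w i.lo < w i.hi) :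
    Hecke.Ttilde (w * simpleRefl i) =
      ((u⁻¹ : GroundRingˣ) : GroundRing) • (Hecke.Ttilde w * Hecke.T i) := by
  rw [Ttilde, prod_reducedWord_mul T_comm T_braid h, len_mul_of_lt h, pow_succ', mul_smul,
    Ttilde, smul_mul_assoc]

theorem Yoko.gtilde_one {d n : ℕ} : (Yoko.gtilde (1 : Equiv.Perm (Fin n)) : Yoko d n) = 1 := by
  simp [Yoko.gtilde, reducedWord_one]

theorem Yoko.gtilde_mul {d n : ℕ} {w : Equiv.Perm (Fin n)} {i : Gen n} (h : w i.lo < w i.hi) :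
    (Yoko.gtilde (w * simpleRefl i) : Yoko d n) =
      ((u⁻¹ : GroundRingˣ) : GroundRing) • (Yoko.gtilde w * Yoko.g i) := by
  rw [gtilde, prod_reducedWord_mul g_comm g_braid h, len_mul_of_lt h, pow_succ', mul_smul,
    gtilde, smul_mul_assoc]

/-! ### Presentations: homomorphisms and spanning sets -/

/-- The inverse of the indeterminate `v`. -/
def vInv : GroundRing := ofLaurent (LaurentPolynomial.T (-1))

theorem v_mul_vInv : v * vInv = 1 := by
  rw [v, vInv, ← map_mul, ← LaurentPolynomial.T_add]; simp

instance : Nontrivial GroundRing :=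
  inferInstanceAs (Nontrivial (LaurentPolynomial (LaurentPolynomial ℂ)))

theorem eq_top_of_mul_mem {A : Type*} [Ring A] [Algebra GroundRing A] {s : Set A}
    (hs : Algebra.adjoin GroundRing s = ⊤) {M : Submodule GroundRing A} (h1 : 1 ∈ M)
    (h : ∀ y ∈ s, ∀ x ∈ M, x * y ∈ M) : M = ⊤ := by
  have key : ∀ y : A, ∀ x ∈ M, x * y ∈ M := by
    intro y
    have hy : y ∈ Algebra.adjoin GroundRing s := hs ▸ Algebra.mem_top
    induction hy using Algebra.adjoin_induction with
    | mem y hy => exact h y hy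
    | algebraMap r =>
      intro x hx
      rw [← Algebra.commutes, ← Algebra.smul_def]
      exact M.smul_mem _ hx
    | add y z _ _ hy hz => intro x hx; rw [mul_add]; exact M.add_mem (hy x hx) (hz x hx)
    | mul y z _ _ hy hz => intro x hx; rw [← mul_assoc]; exact hz _ (hy x hx)
  exact eq_top_iff.2 fun y _ => by simpa using key y 1 h1

theorem mul_mem_of_span {A : Type*} [Ring A] [Algebra GroundRing A] {s : Set A} {y : A}
    {M : Submodule GroundRing A} (h : ∀ x ∈ s, x * y ∈ M) :
    ∀ x ∈ Submodule.span GroundRing s, x * y ∈ M :=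
  fun _ hx => Submodule.span_le (p := M.comap (LinearMap.mulRight GroundRing y)).2 h hx

/-- How the newest generator `t` passes through `a s b`, where `s` is the one before it and `a`, `b`
commute with `t`. -/
theorem mul_mul_mul_of_braid {M : Type*} [Monoid M] {s t a b : M} (ha : a * t = t * a)
    (hb : b * t = t * b) (h : t * s * t = s * t * s) : t * (a * s * b) * t = a * s * t * (s * b) :=
  calc t * (a * s * b) * t = t * a * s * (b * t) := by simp only [mul_assoc]
    _ = a * t * s * (t * b) := by rw [ha, hb]
    _ = a * (t * s * t) * b := by simp only [mul_assoc]
    _ = a * s * t * (s * b) := by rw [h]; simp only [mul_assoc]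

theorem Gen.eq_up_or_last {n : ℕ} (i : Gen (n + 2)) :
    (∃ j : Gen (n + 1), i = j.up) ∨ i = Gen.last n := by
  by_cases h : i.1 + 1 < n + 1
  · exact Or.inl ⟨⟨i.1, h⟩, rfl⟩
  · exact Or.inr (Subtype.ext (by have := i.2; change i.1 = n; omega))

namespace Hecke

section Presentation

variable {n : ℕ}

theorem adjoin_T : Algebra.adjoin GroundRing (Set.range (T : Gen n → Hecke n)) = ⊤ := by
  have h : Set.range (T : Gen n → Hecke n) = mk n '' Set.range (FreeAlgebra.ι GroundRing) :=
    (Set.range_comp (mk n) (FreeAlgebra.ι GroundRing))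
  rw [h, ← AlgHom.map_adjoin, FreeAlgebra.adjoin_range_ι, Algebra.map_top, AlgHom.range_eq_top]
  exact RingQuot.mkAlgHom_surjective GroundRing _

variable {A : Type*} [Ring A] [Algebra GroundRing A]

/-- The homomorphism from the Hecke algebra given by elements that satisfy its relations. -/
def lift (f : Gen n → A)
    (comm : ∀ i j : Gen n, (i.1 + 1 < j.1 ∨ j.1 + 1 < i.1) → f i * f j = f j * f i)
    (braid : ∀ i j : Gen n, j.1 = i.1 + 1 → f i * f j * f i = f j * f i * f j)
    (quad : ∀ i, f i * f i = algebraMap GroundRing A ((u : GroundRing) ^ 2) + v • f i) :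
    Hecke n →ₐ[GroundRing] A :=
  RingQuot.liftAlgHom GroundRing ⟨FreeAlgebra.lift GroundRing f, by
    intro x y h
    induction h with
    | comm i j h => simpa using comm i j h
    | braid i j h => simpa using braid i j h
    | quad i => simpa [pow_two] using quad i⟩

theorem lift_T (f : Gen n → A) (comm) (braid) (quad) (i : Gen n) :
    lift f comm braid quad (T i) = f i :=
  (RingQuot.liftAlgHom_mkAlgHom_apply GroundRing (FreeAlgebra.lift GroundRing f) _ _).trans
    (FreeAlgebra.lift_ι_apply f i)

theorem hom_ext {f g : Hecke n →ₐ[GroundRing] A} (h : ∀ i, f (T i) = g (T i)) : f = g :=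
  AlgHom.ext_of_adjoin_eq_top adjoin_T (by rintro _ ⟨i, rfl⟩; exact h i)

/-- The inclusion `ℋ_m → ℋ_n` for `m ≤ n`. Unlike an iterate of the one-step inclusion it needs no
transport along equalities of indices. -/
def inclLe {m n : ℕ} (h : m ≤ n) : Hecke m →ₐ[GroundRing] Hecke n :=
  lift (fun i => T ⟨i.1, i.2.trans_le h⟩) (fun _ _ hij => T_comm _ _ hij)
    (fun _ _ hij => T_braid _ _ hij) (fun _ => T_sq _)

theorem inclLe_T {m n : ℕ} (h : m ≤ n) (i : Gen m) :
    inclLe h (T i) = T ⟨i.1, i.2.trans_le h⟩ := lift_T ..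

theorem inclLe_refl (h : n ≤ n) : inclLe h = AlgHom.id GroundRing (Hecke n) :=
  hom_ext fun i => inclLe_T h i

theorem inclLe_succ (h : n ≤ n + 1) : inclLe h = incl n :=
  hom_ext fun i => (inclLe_T h i).trans (incl_T i).symm

variable (n) in
/-- The generator `T_k`, with the value `0` for a label `k` out of range. -/
def gen (k : ℕ) : Hecke n := if h : k + 1 < n then T ⟨k, h⟩ else 0

theorem gen_eq {k : ℕ} (h : k + 1 < n) : gen n k = T ⟨k, h⟩ := dif_pos h

theorem gen_zero {k : ℕ} (h : ¬k + 1 < n) : gen n k = 0 := dif_neg h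

theorem gen_comm {j k : ℕ} (h : j + 1 < k ∨ k + 1 < j) : gen n j * gen n k = gen n k * gen n j := by
  by_cases hj : j + 1 < n
  · by_cases hk : k + 1 < n
    · rw [gen_eq hj, gen_eq hk]; exact T_comm _ _ h
    · simp [gen_zero hk]
  · simp [gen_zero hj]

theorem gen_braid (k : ℕ) :
    gen n k * gen n (k + 1) * gen n k = gen n (k + 1) * gen n k * gen n (k + 1) := by
  by_cases hk : k + 1 + 1 < n
  · rw [gen_eq hk, gen_eq (Nat.lt_of_succ_lt hk)]; exact T_braid _ _ rfl
  · simp [gen_zero hk]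

theorem gen_sq {k : ℕ} (h : k + 1 < n) :
    gen n k * gen n k = algebraMap GroundRing _ ((u : GroundRing) ^ 2) + v • gen n k := by
  rw [gen_eq h]; exact T_sq _

end Presentation

/-! ### The bimodule decomposition of the Hecke algebra and uniqueness of its Markov trace -/

theorem exists_algebraMap_eq {n : ℕ} (hn : n ≤ 1) (x : Hecke n) :
    ∃ r, algebraMap GroundRing (Hecke n) r = x := by
  have h : Set.range (T : Gen n → Hecke n) = ∅ := by
    rw [Set.range_eq_empty_iff]
    exact ⟨fun i => by have := i.2; omega⟩
  have hx : x ∈ (⊤ : Subalgebra GroundRing (Hecke n)) := Algebra.mem_top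
  rw [← adjoin_T, h, Algebra.adjoin_empty] at hx
  exact Algebra.mem_bot.1 hx

/-- The newest generator of `ℋ_{n+3}` commutes with `ℋ_{n+1}`. -/
theorem incl_incl_mul_T_last {n : ℕ} (x : Hecke (n + 1)) :
    incl (n + 2) (incl (n + 1) x) * T (Gen.last (n + 1)) =
      T (Gen.last (n + 1)) * incl (n + 2) (incl (n + 1) x) := by
  have hx : x ∈ Algebra.adjoin GroundRing (Set.range (T : Gen (n + 1) → Hecke (n + 1))) :=
    adjoin_T ▸ Algebra.mem_top
  change Commute _ _
  induction hx using Algebra.adjoin_induction with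
  | mem y hy =>
    obtain ⟨i, rfl⟩ := hy
    rw [incl_T, incl_T]
    exact T_comm _ _ (Or.inl (by have := i.2; change i.1 + 1 < n + 1; omega))
  | algebraMap r => rw [AlgHom.commutes, AlgHom.commutes]; exact Algebra.commutes _ _
  | add y z _ _ hy hz => rw [map_add, map_add]; exact hy.add_left hz
  | mul y z _ _ hy hz => rw [map_mul, map_mul]; exact hy.mul_left hz

theorem T_last_braid {n : ℕ} :
    (T (Gen.last (n + 1)) * incl (n + 2) (T (Gen.last n)) * T (Gen.last (n + 1)) : Hecke (n + 3)) =
      incl (n + 2) (T (Gen.last n)) * T (Gen.last (n + 1)) * incl (n + 2) (T (Gen.last n)) := by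
  rw [incl_T]
  exact (T_braid _ _ rfl).symm

/-- `ℋ_{n+2} = ℋ_{n+1} + ℋ_{n+1} T ℋ_{n+1}`, where `T` is the newest generator. -/
theorem span_eq_top (n : ℕ) :
    Submodule.span GroundRing (Set.range (incl (n + 1)) ∪
      Set.range fun p : Hecke (n + 1) × Hecke (n + 1) =>
        incl (n + 1) p.1 * T (Gen.last n) * incl (n + 1) p.2) = ⊤ := by
  induction n with
  | zero =>
    refine eq_top_of_mul_mem adjoin_T (Submodule.subset_span (Or.inl ⟨1, map_one _⟩)) ?_
    rintro _ ⟨i, rfl⟩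
    obtain ⟨j, -⟩ | rfl := Gen.eq_up_or_last i
    · exact absurd j.2 (by omega)
    refine mul_mem_of_span ?_
    rintro _ (⟨a, rfl⟩ | ⟨⟨a, b⟩, rfl⟩)
    · exact Submodule.subset_span (Or.inr ⟨(a, 1), by simp⟩)
    · obtain ⟨r, rfl⟩ := exists_algebraMap_eq (by omega) b
      simp only [AlgHom.commutes]
      rw [mul_assoc, Algebra.commutes, ← mul_assoc, mul_assoc _ (T _) (T _), T_sq,
        mul_add, add_mul]
      refine add_mem (Submodule.subset_span (Or.inl
                ⟨a * algebraMap GroundRing _ ((u : GroundRing) ^ 2) *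
        algebraMap _ _ r, by simp⟩)) ?_
      rw [mul_smul_comm, smul_mul_assoc]
      exact Submodule.smul_mem _ _ (Submodule.subset_span
        (Or.inr ⟨(a, algebraMap _ _ r), by simp⟩))
  | succ n ih =>
    refine eq_top_of_mul_mem adjoin_T (Submodule.subset_span (Or.inl ⟨1, map_one _⟩)) ?_
    rintro _ ⟨i, rfl⟩
    obtain ⟨j, rfl⟩ | rfl := Gen.eq_up_or_last i
    · refine mul_mem_of_span ?_
      rintro _ (⟨a, rfl⟩ | ⟨⟨a, b⟩, rfl⟩)
      · exact Submodule.subset_span (Or.inl ⟨a * T j, by rw [map_mul, incl_T]⟩)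
      · exact Submodule.subset_span
          (Or.inr ⟨(a, b * T j), by simp only [map_mul, incl_T, mul_assoc]⟩)
    · refine mul_mem_of_span ?_
      rintro _ (⟨a, rfl⟩ | ⟨⟨a, b⟩, rfl⟩)
      · exact Submodule.subset_span (Or.inr ⟨(a, 1), by simp⟩)
      · have hb : b ∈ Submodule.span GroundRing _ := ih ▸ Submodule.mem_top
        dsimp only
        induction hb using Submodule.span_induction with
        | mem b hb =>
          obtain ⟨c, rfl⟩ | ⟨⟨c, e⟩, rfl⟩ := hb
          · rw [mul_assoc, incl_incl_mul_T_last, ← mul_assoc, mul_assoc _ (T _) (T _), T_sq,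
              mul_add, add_mul]
            refine add_mem (Submodule.subset_span (Or.inl
                ⟨a * algebraMap GroundRing _ ((u : GroundRing) ^ 2) *
              incl (n + 1) c, by simp⟩)) ?_
            rw [mul_smul_comm, smul_mul_assoc]
            exact Submodule.smul_mem _ _ (Submodule.subset_span
              (Or.inr ⟨(a, incl (n + 1) c), by simp⟩))
          · refine Submodule.subset_span (Or.inr ⟨(a * incl (n + 1) c * T (Gen.last n),
              T (Gen.last n) * incl (n + 1) e), ?_⟩)
            simp only [map_mul]
            rw [mul_assoc (incl (n + 1 + 1) a) (T (Gen.last (n + 1))),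
              mul_assoc (incl (n + 1 + 1) a) (T (Gen.last (n + 1)) * _),
              mul_mul_mul_of_braid (incl_incl_mul_T_last c) (incl_incl_mul_T_last e) T_last_braid]
            simp only [mul_assoc]
        | zero => simp
        | add b c _ _ hb hc => rw [map_add, mul_add, add_mul]; exact add_mem hb hc
        | smul r b _ hb =>
          rw [map_smul, mul_smul_comm, smul_mul_assoc]; exact Submodule.smul_mem _ _ hb

theorem smul_one_eq {n : ℕ} (i : Gen n) :
    v • (1 : Hecke n) = (TUnit i).val - ((u : GroundRing) ^ 2) • (TUnit i)⁻¹.val := by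
  change _ = T i - ((u : GroundRing) ^ 2) • (((u⁻¹ : GroundRingˣ) : GroundRing) ^ 2) •
    (T i - algebraMap GroundRing _ v)
  rw [smul_smul, mul_comm, u_inv_sq_mul, one_smul, sub_sub_cancel, Algebra.algebraMap_eq_smul_one]

/-- A Markov trace is multiplied by a factor `z` with `v z = 1 - u²` when the number of strands
grows. -/
theorem v_mul_trace_incl {τ : ∀ n : ℕ, Hecke n →ₗ[GroundRing] GroundRing}
    (h : IsNormalizedMarkovTrace τ) (n : ℕ) (x : Hecke (n + 1)) :
    v * τ (n + 2) (incl (n + 1) x) = (1 - (u : GroundRing) ^ 2) * τ (n + 1) x := by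
  have h1 := congrArg (τ (n + 2)) (congrArg (incl (n + 1) x * ·) (smul_one_eq (Gen.last n)))
  simp only [mul_sub, mul_smul_comm, mul_one, map_sub, map_smul, h.markov, h.markov_inv,
    smul_eq_mul] at h1
  rw [h1]; ring

theorem eq_of_v_mul_eq {a b : GroundRing} (h : v * a = v * b) : a = b := by
  have := congrArg (vInv * ·) h
  simpa only [← mul_assoc, mul_comm vInv v, v_mul_vInv, one_mul] using this

theorem isNormalizedMarkovTrace_unique {τ σ : ∀ n : ℕ, Hecke n →ₗ[GroundRing] GroundRing}
    (hτ : IsNormalizedMarkovTrace τ) (hσ : IsNormalizedMarkovTrace σ) : τ = σ := by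
  have base : ∀ n, n ≤ 1 → τ n = σ n := by
    intro n hn
    refine LinearMap.ext fun x => ?_
    obtain ⟨r, rfl⟩ := exists_algebraMap_eq hn x
    have h1 : τ n 1 = σ n 1 := by
      obtain rfl | rfl : n = 0 ∨ n = 1 := by omega
      · rw [hτ.zero, hσ.zero]
      · rw [hτ.one, hσ.one]
    rw [Algebra.algebraMap_eq_smul_one, map_smul, map_smul, h1]
  have main : ∀ n, τ (n + 1) = σ (n + 1) := by
    intro n
    induction n with
    | zero => exact base 1 le_rfl
    | succ n ih =>
      refine LinearMap.ext_on (span_eq_top n) ?_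
      rintro _ (⟨a, rfl⟩ | ⟨⟨a, b⟩, rfl⟩)
      · refine eq_of_v_mul_eq ?_
        rw [v_mul_trace_incl hτ, v_mul_trace_incl hσ, ih]
      · dsimp only
        rw [hτ.trace, hσ.trace, ← mul_assoc, ← map_mul]
        exact (hτ.markov n _).trans ((LinearMap.congr_fun ih _).trans (hσ.markov n _).symm)
  funext n
  cases n with
  | zero => exact base 0 (by omega)
  | succ n => exact main n

end Hecke

namespace Hecke

/-! ### Existence of the Markov trace of the Hecke algebras -/

section Induced

variable {n : ℕ}

/-- The action of the generator `T_j` of `ℋ_{n+1}` on `⊕_p c_p ℋ_n`, where `0 ≤ p ≤ n` and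
`c_p = T_p T_{p+1} ⋯ T_{n-1}`, in terms of the coefficients at the `c_p`. -/
def inducedGen (j : Gen (n + 1)) :
    (Fin (n + 1) → Hecke n) →ₗ[GroundRing] (Fin (n + 1) → Hecke n) where
  toFun m q :=
    if q < j.lo then gen n (j.1 - 1) * m q
    else if q = j.lo then m j.hi + v • m q
    else if q = j.hi then ((u : GroundRing) ^ 2) • m j.lo
    else gen n j.1 * m q
  map_add' m m' := by
    ext q; simp only [Pi.add_apply]; split_ifs <;> simp only [mul_add, smul_add]; abel
  map_smul' r m := by
    ext q
    simp only [Pi.smul_apply, RingHom.id_apply]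
    split_ifs <;> simp only [mul_smul_comm, smul_add, smul_comm r]

variable {j : Gen (n + 1)} (m : Fin (n + 1) → Hecke n) {q : Fin (n + 1)}

theorem inducedGen_of_lt (h : q.1 < j.1) : inducedGen j m q = gen n (j.1 - 1) * m q :=
  if_pos h

theorem inducedGen_lo (h : q = j.lo) : inducedGen j m q = m j.hi + v • m j.lo := by
  subst h; simp [inducedGen]

theorem inducedGen_hi (h : q = j.hi) :
    inducedGen j m q = ((u : GroundRing) ^ 2) • m j.lo := by
  subst h; simp [inducedGen, j.lo_lt_hi.not_gt, j.lo_ne_hi.symm]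

theorem inducedGen_of_gt (h : j.1 + 1 < q.1) : inducedGen j m q = gen n j.1 * m q := by
  have h1 : ¬q < j.lo := fun hq => by simp only [Gen.lo, Fin.lt_def] at hq; omega
  have h2 : ¬q = j.lo := fun hq => by simp only [Gen.lo, Fin.ext_iff] at hq; omega
  have h3 : ¬q = j.hi := fun hq => by simp only [Gen.hi, Fin.ext_iff] at hq; omega
  simp [inducedGen, h1, h2, h3]

theorem Gen.cases_position {n : ℕ} (j : Gen n) (q : Fin n) :
    q.1 < j.1 ∨ q = j.lo ∨ q = j.hi ∨ j.1 + 1 < q.1 := by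
  simp only [Gen.lo, Gen.hi, Fin.ext_iff]; omega

theorem inducedGen_sq (j : Gen (n + 1)) : inducedGen j * inducedGen j =
    algebraMap GroundRing (Module.End GroundRing (Fin (n + 1) → Hecke n)) ((u : GroundRing) ^ 2) +
      v • inducedGen j := by
  refine LinearMap.ext fun m => funext fun q => ?_
  simp only [Module.End.mul_apply, LinearMap.add_apply, Module.algebraMap_end_apply,
    LinearMap.smul_apply, Pi.add_apply, Pi.smul_apply]
  have hj := j.2
  rcases Gen.cases_position j q with h | h | h | h
  · rw [inducedGen_of_lt _ h, inducedGen_of_lt _ h, ← mul_assoc, gen_sq (by omega), add_mul,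
      ← Algebra.smul_def, smul_mul_assoc]
  · rw [inducedGen_lo _ h, inducedGen_lo _ h, inducedGen_hi _ rfl, inducedGen_lo _ rfl, h]
  · rw [inducedGen_hi _ h, inducedGen_hi _ h, inducedGen_lo _ rfl, h]
    simp only [smul_add, smul_comm v]
  · rw [inducedGen_of_gt _ h, inducedGen_of_gt _ h, ← mul_assoc,
      gen_sq (by have := q.2; omega), add_mul, ← Algebra.smul_def, smul_mul_assoc]

theorem inducedGen_comm_of_lt {i j : Gen (n + 1)} (hij : i.1 + 1 < j.1) :
    inducedGen i * inducedGen j = inducedGen j * inducedGen i := by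
  refine LinearMap.ext fun m => funext fun q => ?_
  simp only [Module.End.mul_apply]
  have hlo : i.lo.1 < j.1 := by change i.1 < j.1; omega
  have hhi : i.hi.1 < j.1 := hij
  have hlo' : i.1 + 1 < j.lo.1 := hij
  have hhi' : i.1 + 1 < j.hi.1 := by change i.1 + 1 < j.1 + 1; omega
  rcases Gen.cases_position i q with h | h | h | h
  · rw [inducedGen_of_lt _ h, inducedGen_of_lt _ (by omega), inducedGen_of_lt _ (by omega),
      inducedGen_of_lt _ h, ← mul_assoc, ← mul_assoc]
    -- Here `q < i`, so that the truncated subtraction in `i - 1` does no harm.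
    rw [gen_comm (by omega)]
  · subst h
    rw [inducedGen_lo _ rfl, inducedGen_of_lt _ hlo, inducedGen_of_lt _ hhi,
      inducedGen_of_lt _ hlo, inducedGen_lo _ rfl, mul_add, mul_smul_comm]
  · subst h
    rw [inducedGen_hi _ rfl, inducedGen_of_lt _ hlo, inducedGen_of_lt _ hhi,
      inducedGen_hi _ rfl, mul_smul_comm]
  · rcases Gen.cases_position j q with h' | h' | h' | h'
    · rw [inducedGen_of_gt _ h, inducedGen_of_lt _ h', inducedGen_of_lt _ h',
        inducedGen_of_gt _ h, ← mul_assoc, ← mul_assoc, gen_comm (by omega)]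
    · subst h'
      rw [inducedGen_of_gt _ h, inducedGen_lo _ rfl, inducedGen_lo _ rfl,
        inducedGen_of_gt _ hlo', inducedGen_of_gt _ hhi', mul_add, mul_smul_comm]
    · subst h'
      rw [inducedGen_of_gt _ h, inducedGen_hi _ rfl, inducedGen_hi _ rfl,
        inducedGen_of_gt _ hlo', mul_smul_comm]
    · rw [inducedGen_of_gt _ h, inducedGen_of_gt _ h', inducedGen_of_gt _ h',
        inducedGen_of_gt _ h, ← mul_assoc, ← mul_assoc, gen_comm (Or.inl hij)]

theorem inducedGen_braid {i j : Gen (n + 1)} (hij : j.1 = i.1 + 1) :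
    inducedGen i * inducedGen j * inducedGen i = inducedGen j * inducedGen i * inducedGen j := by
  refine LinearMap.ext fun m => funext fun q => ?_
  simp only [Module.End.mul_apply]
  have hb := Gen.hi_eq_lo hij
  have hlo : i.lo.1 < j.1 := by change i.1 < j.1; omega
  have hhi : i.1 + 1 < j.hi.1 := by change i.1 + 1 < j.1 + 1; omega
  have hj : j.1 - 1 = i.1 := by omega
  have hsq := gen_sq (n := n) (k := i.1) (by have := j.2; omega)
  rcases Gen.cases_position i q with h | h | h | h
  · simp only [inducedGen_of_lt _ h, inducedGen_of_lt (j := j) _ (show q.1 < j.1 by omega),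
      ← mul_assoc, hj]
    have h' := gen_braid (n := n) (i.1 - 1)
    rw [show i.1 - 1 + 1 = i.1 by omega] at h'
    rw [h']
  · subst h
    simp only [inducedGen_lo (j := i) _ rfl, inducedGen_of_lt _ hlo, hj, hb,
      inducedGen_lo (j := j) _ rfl, inducedGen_hi (j := i) _ hb.symm, inducedGen_of_gt _ hhi,
      mul_add, smul_add, mul_smul_comm]
    rw [← mul_assoc, hsq, add_mul, ← Algebra.smul_def, smul_mul_assoc]
    simp only [smul_add]
    rw [smul_comm v ((u : GroundRing) ^ 2)]
    abel
  · subst h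
    rw [inducedGen_hi _ rfl, inducedGen_of_lt _ hlo, hj, inducedGen_lo _ rfl, hb,
      inducedGen_lo _ rfl, inducedGen_of_gt _ hhi, inducedGen_hi _ rfl,
      inducedGen_hi _ hb.symm, inducedGen_of_lt _ hlo, hj]
    simp only [mul_add, mul_smul_comm, smul_add]
    rw [smul_comm v]
  · rcases Gen.cases_position j q with h' | h' | h' | h'
    · omega
    · exact absurd (congrArg Fin.val h') (by change q.1 ≠ j.1; omega)
    · subst h'
      rw [inducedGen_of_gt _ hhi, inducedGen_hi _ rfl, ← hb, inducedGen_hi _ rfl,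
        inducedGen_hi _ rfl, ← hb, inducedGen_hi _ rfl, inducedGen_of_lt _ hlo, hj]
      simp only [mul_smul_comm]
    · simp only [inducedGen_of_gt _ h, inducedGen_of_gt _ h', ← mul_assoc]
      rw [hij, gen_braid]

/-- The induced `ℋ_{n+1}`-module `⊕_p c_p ℋ_n`, a copy of the regular module. -/
def induced (n : ℕ) : Hecke (n + 1) →ₐ[GroundRing] Module.End GroundRing (Fin (n + 1) → Hecke n) :=
  lift inducedGen
    (fun _ _ h => h.elim inducedGen_comm_of_lt fun h => (inducedGen_comm_of_lt h).symm)
    (fun _ _ h => inducedGen_braid h) inducedGen_sq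

theorem induced_T (j : Gen (n + 1)) : induced n (T j) = inducedGen j := lift_T ..

/-- The action commutes with right multiplication by `ℋ_n`. -/
theorem induced_mul_right (x : Hecke (n + 1)) (m : Fin (n + 1) → Hecke n) (h : Hecke n) :
    induced n x (fun q => m q * h) = fun q => induced n x m q * h := by
  have hx : x ∈ Algebra.adjoin GroundRing (Set.range (T : Gen (n + 1) → Hecke (n + 1))) :=
    adjoin_T ▸ Algebra.mem_top
  induction hx using Algebra.adjoin_induction generalizing m with
  | mem y hy =>
    obtain ⟨j, rfl⟩ := hy
    funext q
    rw [induced_T]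
    rcases Gen.cases_position j q with h | h | h | h
    · rw [inducedGen_of_lt _ h, inducedGen_of_lt _ h, mul_assoc]
    · rw [inducedGen_lo _ h, inducedGen_lo _ h, add_mul, smul_mul_assoc]
    · rw [inducedGen_hi _ h, inducedGen_hi _ h, smul_mul_assoc]
    · rw [inducedGen_of_gt _ h, inducedGen_of_gt _ h, mul_assoc]
  | algebraMap r =>
    funext q
    simp only [AlgHom.commutes, Module.algebraMap_end_apply, Pi.smul_apply, smul_mul_assoc]
  | add y z _ _ hy hz =>
    funext q
    simp only [map_add, LinearMap.add_apply, hy, hz, Pi.add_apply, add_mul]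
  | mul y z _ _ hy hz =>
    simp only [map_mul, Module.End.mul_apply, hz, hy]

theorem induced_incl_single (h : Hecke n) :
    induced n (incl n h) (Pi.single (Fin.last n) 1) = Pi.single (Fin.last n) h := by
  have hs : ∀ z : Hecke n, (Pi.single (Fin.last n) z : Fin (n + 1) → Hecke n) =
      fun q => (Pi.single (Fin.last n) 1 : Fin (n + 1) → Hecke n) q * z := by
    intro z
    funext q
    by_cases hq : q = Fin.last n
    · subst hq; simp
    · simp [Pi.single_eq_of_ne hq]
  have hx : h ∈ Algebra.adjoin GroundRing (Set.range (T : Gen n → Hecke n)) :=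
    adjoin_T ▸ Algebra.mem_top
  induction hx using Algebra.adjoin_induction with
  | mem y hy =>
    obtain ⟨j, rfl⟩ := hy
    funext q
    have hj := j.2
    have hne : ∀ p : Fin (n + 1), p.1 < n →
        (Pi.single (Fin.last n) 1 : Fin (n + 1) → Hecke n) p = 0 := fun p hp =>
      Pi.single_eq_of_ne (fun e => by rw [e] at hp; simp at hp) _
    have hne' : ∀ p : Fin (n + 1), p.1 < n →
        (Pi.single (Fin.last n) (T j) : Fin (n + 1) → Hecke n) p = 0 := fun p hp =>
      Pi.single_eq_of_ne (fun e => by rw [e] at hp; simp at hp) _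
    have hl : (j.up.lo).1 < n := by change j.1 < n; omega
    have hh : (j.up.hi).1 < n := by change j.1 + 1 < n; omega
    rw [incl_T, induced_T]
    rcases Gen.cases_position j.up q with h | h | h | h
    · have : q.1 < n := h.trans hl
      rw [inducedGen_of_lt _ h, hne q this, hne' q this, mul_zero]
    · subst h
      rw [inducedGen_lo _ rfl, hne _ hl, hne _ hh, hne' _ hl, smul_zero, add_zero]
    · subst h
      rw [inducedGen_hi _ rfl, hne _ hl, hne' _ hh, smul_zero]
    · rw [inducedGen_of_gt _ h]
      by_cases hq : q = Fin.last n
      · subst hq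
        rw [Pi.single_eq_same, Pi.single_eq_same, mul_one]
        exact gen_eq j.2
      · simp [Pi.single_eq_of_ne hq]
  | algebraMap r =>
    rw [AlgHom.commutes, AlgHom.commutes, Module.algebraMap_end_apply, ← Pi.single_smul,
      Algebra.algebraMap_eq_smul_one]
  | add y z _ _ hy hz => rw [map_add, map_add, LinearMap.add_apply, hy, hz, Pi.single_add]
  | mul y z _ _ hy hz =>
    rw [map_mul, map_mul, Module.End.mul_apply, hz, hs z, induced_mul_right, hy, hs (y * z)]
    funext q
    rw [hs y, mul_assoc]

end Induced

/-- The product `T_q T_{q+1} ⋯ T_{n-2}` in `ℋ_n`. -/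
def tailProd (n q : ℕ) : Hecke n := ((List.range' q (n - 1 - q)).map (gen n)).prod

theorem tailProd_of_lt {n q : ℕ} (h : q + 1 < n) : tailProd n q = gen n q * tailProd n (q + 1) := by
  rw [tailProd, tailProd, show n - 1 - q = (n - 1 - (q + 1)) + 1 by omega, List.range'_succ,
    List.map_cons, List.prod_cons]

theorem tailProd_of_le {n q : ℕ} (h : n ≤ q + 1) : tailProd n q = 1 := by
  rw [tailProd, show n - 1 - q = 0 by omega]; rfl

theorem gen_mul_tailProd_of_lt {n j q : ℕ} (h : j + 1 < q) :
    gen n j * tailProd n q = tailProd n q * gen n j := by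
  induction hk : n - q generalizing q with
  | zero => rw [tailProd_of_le (by omega), one_mul, mul_one]
  | succ k ih =>
    by_cases hq : q + 1 < n
    · rw [tailProd_of_lt hq, ← mul_assoc, gen_comm (Or.inl h), mul_assoc,
        ih (q := q + 1) (by omega) (by omega), mul_assoc]
    · rw [tailProd_of_le (by omega), one_mul, mul_one]

theorem gen_mul_tailProd_of_gt {n j q : ℕ} (h : q < j) (hj : j + 1 < n) :
    gen n j * tailProd n q = tailProd n q * gen n (j - 1) := by
  induction hk : n - q generalizing q with
  | zero => omega
  | succ k ih =>
    rw [tailProd_of_lt (q := q) (by omega)]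
    by_cases hq : q + 1 < j
    · rw [← mul_assoc, gen_comm (Or.inr hq), mul_assoc, ih hq (by omega), mul_assoc]
    · obtain rfl : j = q + 1 := by omega
      rw [tailProd_of_lt hj, ← mul_assoc, ← mul_assoc, ← mul_assoc, ← gen_braid, mul_assoc,
        gen_mul_tailProd_of_lt (by omega), ← mul_assoc, Nat.add_sub_cancel]

/-- The value at `1` of the conditional expectation, `(1 - u²) / v`. -/
def loopValue : GroundRing := (1 - (u : GroundRing) ^ 2) * vInv

theorem v_mul_loopValue : v * loopValue = 1 - (u : GroundRing) ^ 2 := by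
  rw [loopValue, mul_left_comm, v_mul_vInv, mul_one]

section CondExp

variable {n : ℕ}

variable (n) in
/-- The value of the conditional expectation `ℋ_{n+1} → ℋ_n` at `c_q = T_q T_{q+1} ⋯ T_{n-1}`. -/
def weight (q : Fin (n + 1)) : Hecke n :=
  if q = Fin.last n then algebraMap GroundRing _ loopValue else tailProd n q

variable (n) in
/-- The `ℋ_n`-linear function on `⊕_q c_q ℋ_n` given by the weights. -/
def weightSum : (Fin (n + 1) → Hecke n) →ₗ[GroundRing] Hecke n where
  toFun m := ∑ q, weight n q * m q
  map_add' m m' := by simp [mul_add, Finset.sum_add_distrib]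
  map_smul' r m := by simp [Finset.smul_sum]

theorem weight_of_lt {q : Fin (n + 1)} (h : q.1 < n) : weight n q = tailProd n q :=
  if_neg fun e => by rw [e] at h; simp at h

theorem weightSum_inducedGen (j : Gen n) (m : Fin (n + 1) → Hecke n) :
    weightSum n (inducedGen j.up m) = T j * weightSum n m := by
  have hj := j.2
  have hT : T j = gen n j.1 := (gen_eq j.2).symm
  have hlo : j.up.lo.1 < n := by change j.1 < n; omega
  have hhi : j.up.hi.1 < n := by change j.1 + 1 < n; omega
  have hwlo : weight n j.up.lo = tailProd n j.1 := weight_of_lt hlo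
  have hwhi : weight n j.up.hi = tailProd n (j.1 + 1) := weight_of_lt hhi
  have htail := tailProd_of_lt hj
  rw [← sub_eq_zero]
  change ∑ q, weight n q * inducedGen j.up m q - T j * ∑ q, weight n q * m q = 0
  rw [Finset.mul_sum, ← Finset.sum_sub_distrib,
    ← Finset.sum_subset (Finset.subset_univ {j.up.lo, j.up.hi}), Finset.sum_pair j.up.lo_ne_hi,
    inducedGen_lo _ rfl, inducedGen_hi _ rfl, hwlo, hwhi, ← mul_assoc, ← mul_assoc, hT]
  · rw [← htail, htail, ← mul_assoc, gen_sq hj]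
    simp only [mul_add, add_mul, mul_smul_comm, smul_mul_assoc, ← Algebra.smul_def]
    abel
  · intro q _ hq
    simp only [Finset.mem_insert, Finset.mem_singleton, not_or] at hq
    rw [sub_eq_zero]
    rcases Gen.cases_position j.up q with h | h | h | h
    · rw [inducedGen_of_lt _ h, weight_of_lt (h.trans hlo), hT, ← mul_assoc, ← mul_assoc]
      exact congrArg (· * m q) (gen_mul_tailProd_of_gt h hj).symm
    · exact absurd h hq.1
    · exact absurd h hq.2
    · rw [inducedGen_of_gt _ h, hT, ← mul_assoc, ← mul_assoc]
      congr 1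
      by_cases hl : q = Fin.last n
      · rw [weight, if_pos hl]
        exact Algebra.commutes _ _
      · have hqn : q.1 < n := by
          have := q.2
          have : q.1 ≠ n := fun e => hl (Fin.ext e)
          omega
        rw [weight_of_lt hqn]
        exact (gen_mul_tailProd_of_lt h).symm

variable (n) in
/-- The conditional expectation `ℋ_{n+1} → ℋ_n`: the `ℋ_n`-bimodule map that sends `1` to
`(1 - u²) / v` and, for `n ≥ 1`, the newest generator to `1`. -/
def condExp : Hecke (n + 1) →ₗ[GroundRing] Hecke n where
  toFun x := weightSum n (induced n x (Pi.single (Fin.last n) 1))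
  map_add' x y := by simp
  map_smul' r x := by simp

theorem condExp_one : condExp n 1 = algebraMap GroundRing _ loopValue := by
  change ∑ q, weight n q * (induced n 1 (Pi.single (Fin.last n) 1)) q = _
  rw [map_one, Finset.sum_eq_single (Fin.last n)]
  · simp [weight]
  · intro q _ hq; simp [Pi.single_eq_of_ne hq]
  · simp

theorem condExp_mul_incl (x : Hecke (n + 1)) (h : Hecke n) :
    condExp n (x * incl n h) = condExp n x * h := by
  have hs : (Pi.single (Fin.last n) h : Fin (n + 1) → Hecke n) =
      fun q => (Pi.single (Fin.last n) 1 : Fin (n + 1) → Hecke n) q * h := by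
    funext q
    by_cases hq : q = Fin.last n
    · subst hq; simp
    · simp [Pi.single_eq_of_ne hq]
  change ∑ q, weight n q * (induced n (x * incl n h) (Pi.single (Fin.last n) 1)) q =
    (∑ q, weight n q * (induced n x (Pi.single (Fin.last n) 1)) q) * h
  rw [map_mul, Module.End.mul_apply, induced_incl_single, hs, induced_mul_right, Finset.sum_mul]
  simp only [mul_assoc]

theorem condExp_incl_mul (h : Hecke n) (x : Hecke (n + 1)) :
    condExp n (incl n h * x) = h * condExp n x := by
  have hx : h ∈ Algebra.adjoin GroundRing (Set.range (T : Gen n → Hecke n)) :=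
    adjoin_T ▸ Algebra.mem_top
  induction hx using Algebra.adjoin_induction generalizing x with
  | mem y hy =>
    obtain ⟨j, rfl⟩ := hy
    change weightSum n (induced n (incl n (T j) * x) _) = _
    rw [incl_T, map_mul, Module.End.mul_apply, induced_T, weightSum_inducedGen]
    rfl
  | algebraMap r => rw [AlgHom.commutes, ← Algebra.smul_def, map_smul, Algebra.smul_def]
  | add y z _ _ hy hz => rw [map_add, add_mul, map_add, hy, hz, add_mul]
  | mul y z _ _ hy hz => rw [map_mul (incl n), mul_assoc, hy, hz, mul_assoc]

theorem condExp_incl (h : Hecke n) : condExp n (incl n h) = loopValue • h := by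
  rw [← one_mul (incl n h), condExp_mul_incl, condExp_one, ← Algebra.smul_def]

theorem condExp_T_last (n : ℕ) : condExp (n + 1) (T (Gen.last n)) = 1 := by
  change ∑ q, weight (n + 1) q *
    (induced (n + 1) (T (Gen.last n)) (Pi.single (Fin.last (n + 1)) 1)) q = _
  have hlo : (Pi.single (Fin.last (n + 1)) 1 : Fin (n + 2) → Hecke (n + 1)) (Gen.last n).lo = 0 :=
    Pi.single_eq_of_ne (by simp [Gen.lo, Gen.last, Fin.ext_iff]) _
  have hhi : (Pi.single (Fin.last (n + 1)) 1 : Fin (n + 2) → Hecke (n + 1)) (Gen.last n).hi = 1 :=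
    Pi.single_eq_same _ _
  rw [induced_T, Finset.sum_eq_single (Gen.last n).lo]
  · rw [inducedGen_lo _ rfl, hlo, hhi, smul_zero, add_zero, mul_one,
      weight_of_lt (Nat.lt_succ_self n)]
    exact tailProd_of_le le_rfl
  · intro q _ hq
    rcases Gen.cases_position (Gen.last n) q with h | h | h | h
    · rw [inducedGen_of_lt _ h, Pi.single_eq_of_ne (fun e => by
        rw [e] at h; change n + 1 < n at h; omega), mul_zero, mul_zero]
    · exact absurd h hq
    · rw [inducedGen_hi _ h, hlo, smul_zero, mul_zero]
    · exact absurd q.2 (by change n + 1 < q.1 at h; omega)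
  · simp

theorem condExp_T_mul_T (n : ℕ) : condExp (n + 1) (T (Gen.last n) * T (Gen.last n)) =
    algebraMap GroundRing _ ((u : GroundRing) ^ 2 * loopValue + v) := by
  rw [T_sq, map_add, map_smul, condExp_T_last, Algebra.algebraMap_eq_smul_one, map_smul,
    condExp_one, map_add, map_mul, Algebra.algebraMap_eq_smul_one v, ← Algebra.smul_def]

/-- Conjugation by the newest generator, for elements of the next smaller Hecke algebra. -/
theorem condExp_T_incl_T (b : Hecke (n + 2)) :
    condExp (n + 2) (T (Gen.last (n + 1)) * incl (n + 2) b * T (Gen.last (n + 1))) =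
      ((u : GroundRing) ^ 2) • incl (n + 1) (condExp (n + 1) b) + v • b := by
  have hb : b ∈ Submodule.span GroundRing _ := span_eq_top n ▸ Submodule.mem_top
  induction hb using Submodule.span_induction with
  | mem b hb =>
    obtain ⟨c, rfl⟩ | ⟨⟨c, e⟩, rfl⟩ := hb
    · rw [← incl_incl_mul_T_last, mul_assoc, condExp_incl_mul, condExp_T_mul_T, condExp_incl,
        map_smul, ← Algebra.commutes, ← Algebra.smul_def, add_smul, mul_smul]
    · simp only [map_mul]
      rw [mul_mul_mul_of_braid (incl_incl_mul_T_last c) (incl_incl_mul_T_last e) T_last_braid,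
        ← map_mul, ← map_mul, condExp_mul_incl, condExp_incl_mul, condExp_T_last,
        condExp_mul_incl, condExp_incl_mul, condExp_T_last, mul_one, mul_one, map_mul, ← mul_assoc,
        mul_assoc _ (T _) (T _), T_sq, mul_add, add_mul, mul_smul_comm, smul_mul_assoc,
        ← Algebra.commutes, mul_assoc, ← Algebra.smul_def]
  | zero => simp
  | add b c _ _ hb hc =>
    simp only [map_add, mul_add, add_mul, hb, hc, smul_add]
    abel
  | smul r b _ hb =>
    simp only [map_smul, mul_smul_comm, smul_mul_assoc, hb, smul_add]
    rw [smul_comm r, smul_comm r]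

end CondExp

theorem commute_of_le_one {n : ℕ} (hn : n ≤ 1) (x y : Hecke n) : x * y = y * x := by
  obtain ⟨r, rfl⟩ := exists_algebraMap_eq hn x
  exact Algebra.commutes _ _

/-- The augmentation of `ℋ_0` and `ℋ_1`. -/
def smallTrace {n : ℕ} (hn : n ≤ 1) : Hecke n →ₐ[GroundRing] GroundRing :=
  lift (fun _ => 0) (fun _ _ _ => rfl) (fun _ _ _ => rfl) fun i => absurd i.2 (by omega)

/-- The normalized Markov trace, as an iterated conditional expectation. -/
def iteratedTrace : ∀ n : ℕ, Hecke n →ₗ[GroundRing] GroundRing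
  | 0 => (smallTrace (n := 0) (by omega)).toLinearMap
  | 1 => (smallTrace (n := 1) (by omega)).toLinearMap
  | n + 2 => iteratedTrace (n + 1) ∘ₗ condExp (n + 1)

theorem iteratedTrace_add_two (n : ℕ) (x : Hecke (n + 2)) :
    iteratedTrace (n + 2) x = iteratedTrace (n + 1) (condExp (n + 1) x) := rfl

/-- The symmetric form behind the trace property at the newest generator. -/
theorem iteratedTrace_condExp_T_incl_T {n : ℕ}
    (ih : ∀ x y : Hecke (n + 1), iteratedTrace (n + 1) (x * y) = iteratedTrace (n + 1) (y * x))
    (a b : Hecke (n + 1)) :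
    iteratedTrace (n + 1)
        (a * condExp (n + 1) (T (Gen.last n) * incl (n + 1) b * T (Gen.last n))) =
      iteratedTrace (n + 1)
        (condExp (n + 1) (T (Gen.last n) * incl (n + 1) a * T (Gen.last n)) * b) := by
  cases n with
  | zero =>
    obtain ⟨r, rfl⟩ := exists_algebraMap_eq (n := 0 + 1) (by omega) a
    obtain ⟨s, rfl⟩ := exists_algebraMap_eq (n := 0 + 1) (by omega) b
    simp only [AlgHom.commutes, ← Algebra.commutes, ← Algebra.smul_def, smul_mul_assoc,
      map_smul]
    rw [smul_comm]
  | succ n =>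
    rw [condExp_T_incl_T, condExp_T_incl_T, mul_add, add_mul, map_add, map_add, mul_smul_comm,
      smul_mul_assoc, mul_smul_comm, smul_mul_assoc]
    congr 1
    simp only [map_smul]
    rw [iteratedTrace_add_two, iteratedTrace_add_two, condExp_mul_incl, condExp_incl_mul]

theorem iteratedTrace_mul_comm (n : ℕ) (x y : Hecke (n + 1)) :
    iteratedTrace (n + 1) (x * y) = iteratedTrace (n + 1) (y * x) := by
  induction n with
  | zero => rw [commute_of_le_one (n := 0 + 1) (by omega)]
  | succ n ih =>
    have hy : y ∈ Algebra.adjoin GroundRing (Set.range (T : Gen (n + 2) → Hecke (n + 2))) :=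
      adjoin_T ▸ Algebra.mem_top
    induction hy using Algebra.adjoin_induction generalizing x with
    | mem y hy =>
      obtain ⟨i, rfl⟩ := hy
      obtain ⟨j, rfl⟩ | rfl := Gen.eq_up_or_last i
      · rw [← incl_T, iteratedTrace_add_two, iteratedTrace_add_two, condExp_mul_incl,
          condExp_incl_mul, ih]
      · have hx : x ∈ Submodule.span GroundRing _ := span_eq_top n ▸ Submodule.mem_top
        induction hx using Submodule.span_induction with
        | mem x hx =>
          obtain ⟨c, rfl⟩ | ⟨⟨c, e⟩, rfl⟩ := hx
          · rw [iteratedTrace_add_two, iteratedTrace_add_two, condExp_mul_incl, condExp_incl_mul,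
              condExp_T_last, one_mul, mul_one]
          · dsimp only
            rw [iteratedTrace_add_two, iteratedTrace_add_two, ← mul_assoc (T _), ← mul_assoc (T _),
              condExp_mul_incl, ← iteratedTrace_condExp_T_incl_T ih, ← condExp_incl_mul]
            simp only [mul_assoc]
        | zero => simp
        | add x z _ _ hx hz => rw [add_mul, mul_add, map_add, map_add, hx, hz]
        | smul r x _ hx => rw [smul_mul_assoc, mul_smul_comm, map_smul, map_smul, hx]
    | algebraMap r => rw [Algebra.commutes]
    | add y z _ _ hy hz => rw [add_mul, mul_add, map_add, map_add, hy, hz]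
    | mul y z _ _ hy hz => rw [← mul_assoc, hz, ← mul_assoc, hy, ← mul_assoc]

theorem isNormalizedMarkovTrace_iteratedTrace : IsNormalizedMarkovTrace iteratedTrace where
  zero := map_one (smallTrace _)
  one := map_one (smallTrace _)
  trace := iteratedTrace_mul_comm
  markov n x := by
    change iteratedTrace (n + 1) (condExp (n + 1) (incl (n + 1) x * T (Gen.last n))) = _
    rw [condExp_incl_mul, condExp_T_last, mul_one]
  markov_inv n x := by
    change iteratedTrace (n + 1) (condExp (n + 1) (incl (n + 1) x *
      (((u⁻¹ : GroundRingˣ) : GroundRing) ^ 2) • (T (Gen.last n) - algebraMap GroundRing _ v))) = _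
    rw [mul_smul_comm, map_smul, condExp_incl_mul, map_sub, condExp_T_last,
      Algebra.algebraMap_eq_smul_one, map_smul (condExp (n + 1)) v, condExp_one,
      Algebra.algebraMap_eq_smul_one, smul_smul, v_mul_loopValue, sub_smul, one_smul,
      sub_sub_cancel, mul_smul_comm, mul_one, smul_smul, u_inv_sq_mul, one_smul]

theorem existsUnique_isNormalizedMarkovTrace :
    ∃! τ : ∀ n : ℕ, Hecke n →ₗ[GroundRing] GroundRing, IsNormalizedMarkovTrace τ :=
  ⟨_, isNormalizedMarkovTrace_iteratedTrace, fun _ h =>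
    isNormalizedMarkovTrace_unique h isNormalizedMarkovTrace_iteratedTrace⟩

end Hecke

theorem heckeTrace_spec : IsNormalizedMarkovTrace heckeTrace :=
  Classical.epsilon_spec ⟨_, Hecke.isNormalizedMarkovTrace_iteratedTrace⟩

theorem heckeTrace_mul_comm {n : ℕ} (x y : Hecke n) :
    heckeTrace n (x * y) = heckeTrace n (y * x) := by
  cases n with
  | zero => rw [Hecke.commute_of_le_one (by omega)]
  | succ n => exact heckeTrace_spec.trace n x y

/-! ### Monomial matrices -/

section Monomial

variable {X A : Type*} [DecidableEq X] [Semiring A]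

/-- The matrix whose row `x` has the single entry `c x`, in column `σ x`. -/
def monomial (σ : X → X) (c : X → A) : Matrix X X A := fun x y => if y = σ x then c x else 0

theorem monomial_apply (σ : X → X) (c : X → A) (x y : X) :
    monomial σ c x y = if y = σ x then c x else 0 := rfl

variable [Fintype X]

theorem monomial_mul_apply (σ : X → X) (c : X → A) (B : Matrix X X A) (x y : X) :
    (monomial σ c * B) x y = c x * B (σ x) y := by
  rw [Matrix.mul_apply, Finset.sum_eq_single (σ x)]
  · rw [monomial_apply, if_pos rfl]
  · intro z _ hz; rw [monomial_apply, if_neg hz, zero_mul]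
  · simp

theorem monomial_mul_monomial (σ σ' : X → X) (c c' : X → A) :
    monomial σ c * monomial σ' c' = monomial (σ' ∘ σ) fun x => c x * c' (σ x) := by
  ext x y
  rw [monomial_mul_apply, monomial_apply, monomial_apply, mul_ite, mul_zero]
  rfl

theorem monomial_mul_diagonal (σ : X → X) (c f : X → A) :
    monomial σ c * Matrix.diagonal f = monomial σ fun x => c x * f (σ x) := by
  ext x y
  rw [monomial_mul_apply, Matrix.diagonal_apply, monomial_apply]
  by_cases h : y = σ x
  · subst h; simp
  · rw [if_neg h, if_neg (Ne.symm h), mul_zero]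

theorem diagonal_mul_monomial (σ : X → X) (c f : X → A) :
    Matrix.diagonal f * monomial σ c = monomial σ fun x => f x * c x := by
  ext x y
  rw [Matrix.diagonal_mul, monomial_apply, monomial_apply, mul_ite, mul_zero]

theorem single_mul_monomial (σ : X → X) (c : X → A) (x y : X) (b : A) :
    Matrix.single x y b * monomial σ c = Matrix.single x (σ y) (b * c y) := by
  ext z w
  rw [Matrix.mul_apply, Finset.sum_eq_single y]
  · simp only [Matrix.single_apply, monomial_apply, and_true]
    by_cases hz : x = z <;> by_cases hw : w = σ y <;> simp [hz, hw, eq_comm]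
  · intro k _ hk; simp [Ne.symm hk]
  · simp

end Monomial

/-! ### Characters and ranks of letters -/

section Characters

variable {d n : ℕ}

theorem act_one (χ : Char d n) : act 1 χ = χ := rfl

theorem act_mul (w w' : Equiv.Perm (Fin n)) (χ : Char d n) : act (w * w') χ = act w (act w' χ) := by
  funext i; simp [act]

theorem act_apply (w : Equiv.Perm (Fin n)) (χ : Char d n) (i : Fin n) : act w χ (w i) = χ i := by
  simp [act]

theorem act_simpleRefl (i : Gen n) (χ : Char d n) (p : Fin n) :
    act (simpleRefl i) χ p = χ (simpleRefl i p) := by simp [act]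

theorem act_simpleRefl_act (i : Gen n) (χ : Char d n) :
    act (simpleRefl i) (act (simpleRefl i) χ) = χ := by
  rw [← act_mul, simpleRefl_mul_self, act_one]

theorem compOf_act (w : Equiv.Perm (Fin n)) (χ : Char d n) : compOf (act w χ) = compOf χ := by
  refine Subtype.ext (funext fun a => ?_)
  change (Finset.univ.filter fun j => χ (w⁻¹ j) = a).card =
    (Finset.univ.filter fun j => χ j = a).card
  refine Finset.card_bij (fun j _ => w⁻¹ j) (by simp) (fun _ _ _ _ h => w⁻¹.injective h) ?_
  intro b hb
  exact ⟨w b, by simpa using hb, by simp⟩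

theorem compOf_apply (χ : Char d n) (a : Fin d) :
    (compOf χ).1 a = (Finset.univ.filter fun j => χ j = a).card := rfl

/-- The action of a permutation on an orbit of characters. -/
def Orbit.act {μ : Comp d n} (w : Equiv.Perm (Fin n)) (χ : Orbit μ) : Orbit μ :=
  ⟨YH.act w χ.1, (compOf_act w χ.1).trans χ.2⟩

theorem act_simpleRefl_of_eq {i : Gen n} {χ : Char d n} (h : χ i.lo = χ i.hi) :
    act (simpleRefl i) χ = χ := by
  funext p
  rw [act_simpleRefl]
  by_cases h1 : p = i.lo
  · rw [h1, simpleRefl_lo, h]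
  · by_cases h2 : p = i.hi
    · rw [h2, simpleRefl_hi, h]
    · rw [simpleRefl_of_ne h1 h2]

/-- The rank of the letter `p` among the letters with the same value of `χ`. -/
def rank (χ : Char d n) (p : Fin n) : ℕ := (Finset.univ.filter fun l => l < p ∧ χ l = χ p).card

theorem rank_lt_rank {χ : Char d n} {p q : Fin n} (h : χ p = χ q) (hpq : p < q) :
    rank χ p < rank χ q := by
  refine Finset.card_lt_card ⟨fun l hl => ?_, fun hsub => ?_⟩
  · simp only [Finset.mem_filter, Finset.mem_univ, true_and] at hl ⊢
    exact ⟨hl.1.trans hpq, hl.2.trans h⟩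
  · have := hsub (Finset.mem_filter.2 ⟨Finset.mem_univ p, hpq, h⟩)
    simp at this

theorem rank_hi {χ : Char d n} {i : Gen n} (h : χ i.lo = χ i.hi) :
    rank χ i.hi = rank χ i.lo + 1 := by
  have hn : i.lo ∉ Finset.univ.filter fun l => l < i.lo ∧ χ l = χ i.lo := by simp
  rw [rank, rank, ← Finset.card_insert_of_notMem hn]
  congr 1
  ext l
  simp only [Finset.mem_filter, Finset.mem_univ, true_and, Finset.mem_insert]
  constructor
  · rintro ⟨hl, hχ⟩
    by_cases hlo : l = i.lo
    · exact Or.inl hlo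
    · refine Or.inr ⟨?_, hχ.trans h.symm⟩
      simp only [Gen.lo, Gen.hi, Fin.lt_def, Fin.ext_iff] at *
      omega
  · rintro (rfl | ⟨hl, hχ⟩)
    · exact ⟨i.lo_lt_hi, h⟩
    · exact ⟨hl.trans i.lo_lt_hi, hχ.trans h⟩

theorem rank_lt_compOf (χ : Char d n) (p : Fin n) : rank χ p < (compOf χ).1 (χ p) := by
  rw [compOf_apply]
  refine Finset.card_lt_card ⟨fun l hl => ?_, fun hsub => ?_⟩
  · simp only [Finset.mem_filter, Finset.mem_univ, true_and] at hl ⊢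
    exact hl.2
  · have := hsub (Finset.mem_filter.2 ⟨Finset.mem_univ p, rfl⟩)
    simp at this

theorem rank_act {χ : Char d n} {i : Gen n} (h : χ i.lo ≠ χ i.hi) (p : Fin n) :
    rank (act (simpleRefl i) χ) (simpleRefl i p) = rank χ p := by
  refine Finset.card_bij (fun l _ => simpleRefl i l) ?_
    (fun _ _ _ _ h => (simpleRefl i).injective h) ?_
  · intro l hl
    simp only [Finset.mem_filter, Finset.mem_univ, true_and, act_simpleRefl,
      simpleRefl_apply_apply] at hl ⊢
    refine ⟨?_, hl.2⟩
    have := simpleRefl_lt hl.1 (i := i) (by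
      rintro ⟨h1, h2⟩
      rw [h1, h2, simpleRefl_lo] at hl
      have h3 : p = i.lo := by rw [← simpleRefl_apply_apply i p, h2, simpleRefl_hi]
      exact h (h3 ▸ hl.2).symm)
    simpa using this
  · intro l hl
    simp only [Finset.mem_filter, Finset.mem_univ, true_and] at hl
    refine ⟨simpleRefl i l, ?_, by simp⟩
    simp only [Finset.mem_filter, Finset.mem_univ, true_and, act_simpleRefl,
      simpleRefl_apply_apply]
    refine ⟨simpleRefl_lt hl.1 ?_, hl.2⟩
    rintro ⟨h1, h2⟩
    rw [h1, h2] at hl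
    exact h hl.2

theorem rank_act_of_ne {χ : Char d n} {i : Gen n} {p : Fin n} (h1 : p ≠ i.lo) (h2 : p ≠ i.hi) :
    rank (act (simpleRefl i) χ) p = rank χ p := by
  by_cases h : χ i.lo = χ i.hi
  · rw [act_simpleRefl_of_eq h]
  · conv_lhs => rw [← simpleRefl_of_ne h1 h2]
    exact rank_act h p

end Characters

/-! ### The matrix representations of the Yokonuma--Hecke algebra -/

section Coefficients

variable {d n : ℕ}

/-- The generator `T_k` of the tensor factor of index `a`, with the value `0` for a label out of
range. -/
def tgen (m : Fin d → ℕ) (a : Fin d) (k : ℕ) : ⨂[GroundRing] a : Fin d, Hecke (m a) :=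
  PiTensorProduct.singleAlgHom (R := GroundRing) (A := fun a => Hecke (m a)) a (Hecke.gen (m a) k)

theorem tgen_comm (m : Fin d → ℕ) {a b : Fin d} (k l : ℕ) (h : a = b → k + 1 < l ∨ l + 1 < k) :
    tgen m a k * tgen m b l = tgen m b l * tgen m a k := by
  by_cases hab : a = b
  · subst hab
    rw [tgen, tgen, ← map_mul, ← map_mul, Hecke.gen_comm (h rfl)]
  · exact (Pi.mulSingle_commute hab _ _).tprod

theorem tgen_braid (m : Fin d → ℕ) (a : Fin d) (k : ℕ) :
    tgen m a k * tgen m a (k + 1) * tgen m a k =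
      tgen m a (k + 1) * tgen m a k * tgen m a (k + 1) := by
  simp only [tgen, ← map_mul]
  rw [Hecke.gen_braid]

theorem tgen_sq (m : Fin d → ℕ) (a : Fin d) {k : ℕ} (h : k + 1 < m a) :
    tgen m a k * tgen m a k =
      algebraMap GroundRing _ ((u : GroundRing) ^ 2) + v • tgen m a k := by
  rw [tgen, ← map_mul, Hecke.gen_sq h, map_add, map_smul, AlgHom.commutes]

/-- The nonzero entry of the matrix of `g_i` in the row of `χ`. -/
def coef (m : Fin d → ℕ) (i : Gen n) (χ : Char d n) : ⨂[GroundRing] a : Fin d, Hecke (m a) :=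
  if χ i.lo = χ i.hi then tgen m (χ i.lo) (rank χ i.lo)
  else algebraMap GroundRing _ (u : GroundRing)

variable {m : Fin d → ℕ}

theorem coef_of_eq {i : Gen n} {χ : Char d n} (h : χ i.lo = χ i.hi) :
    coef m i χ = tgen m (χ i.lo) (rank χ i.lo) := if_pos h

theorem coef_of_ne {i : Gen n} {χ : Char d n} (h : χ i.lo ≠ χ i.hi) :
    coef m i χ = algebraMap GroundRing _ (u : GroundRing) := if_neg h

theorem coef_congr {i j : Gen n} {χ ψ : Char d n} (hlo : χ i.lo = ψ j.lo) (hhi : χ i.hi = ψ j.hi)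
    (h : χ i.lo = χ i.hi → rank χ i.lo = rank ψ j.lo) : coef m i χ = coef m j ψ := by
  by_cases hχ : χ i.lo = χ i.hi
  · rw [coef_of_eq hχ, coef_of_eq (by rw [← hlo, hχ, hhi]), h hχ, hlo]
  · rw [coef_of_ne hχ, coef_of_ne (by rwa [← hlo, ← hhi])]

theorem coef_act_of_far {i j : Gen n} (h : i.1 + 1 < j.1 ∨ j.1 + 1 < i.1) (χ : Char d n) :
    coef m j (act (simpleRefl i) χ) = coef m j χ := by
  have h1 : j.lo ≠ i.lo := by simp only [Gen.lo, ne_eq, Fin.ext_iff]; omega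
  have h2 : j.lo ≠ i.hi := by simp only [Gen.lo, Gen.hi, ne_eq, Fin.ext_iff]; omega
  have h3 : j.hi ≠ i.lo := by simp only [Gen.lo, Gen.hi, ne_eq, Fin.ext_iff]; omega
  have h4 : j.hi ≠ i.hi := by simp only [Gen.hi, ne_eq, Fin.ext_iff]; omega
  refine coef_congr ?_ ?_ fun _ => rank_act_of_ne h1 h2
  · rw [act_simpleRefl, simpleRefl_of_ne h1 h2]
  · rw [act_simpleRefl, simpleRefl_of_ne h3 h4]

theorem rank_lo_of_far {i j : Gen n} (h : i.1 + 1 < j.1) {χ : Char d n} (hi : χ i.lo = χ i.hi)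
    (hij : χ i.lo = χ j.lo) : rank χ i.lo + 1 < rank χ j.lo := by
  rw [← rank_hi hi]
  exact rank_lt_rank (hi.symm.trans hij) (by simp only [Gen.lo, Gen.hi, Fin.lt_def]; omega)

theorem coef_comm {i j : Gen n} (h : i.1 + 1 < j.1 ∨ j.1 + 1 < i.1) (χ : Char d n) :
    coef m i χ * coef m j (act (simpleRefl i) χ) =
      coef m j χ * coef m i (act (simpleRefl j) χ) := by
  rw [coef_act_of_far h, coef_act_of_far h.symm]
  by_cases hi : χ i.lo = χ i.hi
  · by_cases hj : χ j.lo = χ j.hi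
    · rw [coef_of_eq hi, coef_of_eq hj]
      exact tgen_comm m _ _ fun hij => h.imp (fun h => rank_lo_of_far h hi hij)
        fun h => rank_lo_of_far h hj hij.symm
    · rw [coef_of_ne hj]
      exact (Algebra.commutes _ _).symm
  · rw [coef_of_ne hi]
    exact Algebra.commutes _ _

theorem coef_braid {i j : Gen n} (h : j.1 = i.1 + 1) (χ : Char d n) :
    coef m i χ * coef m j (act (simpleRefl i) χ) *
        coef m i (act (simpleRefl j) (act (simpleRefl i) χ)) =
      coef m j χ * coef m i (act (simpleRefl j) χ) *
        coef m j (act (simpleRefl i) (act (simpleRefl j) χ)) := by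
  have hb := Gen.hi_eq_lo h
  have hlo1 : i.lo ≠ j.lo := hb ▸ i.lo_ne_hi
  have hlo2 : i.lo ≠ j.hi := by simp only [Gen.lo, Gen.hi, ne_eq, Fin.ext_iff]; omega
  have hhi2 : j.hi ≠ i.hi := hb ▸ j.lo_ne_hi.symm
  have sjlo : simpleRefl j i.lo = i.lo := simpleRefl_of_ne hlo1 hlo2
  have sihi : simpleRefl i j.hi = j.hi := simpleRefl_of_ne hlo2.symm hhi2
  have sihi' : simpleRefl i j.lo = i.lo := by rw [← hb, simpleRefl_hi]
  have sjhi' : simpleRefl j i.hi = j.hi := by rw [hb, simpleRefl_lo]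
  by_cases hall : χ i.lo = χ i.hi ∧ χ j.lo = χ j.hi
  · rw [act_simpleRefl_of_eq hall.1, act_simpleRefl_of_eq hall.2, act_simpleRefl_of_eq hall.1,
      coef_of_eq hall.1, coef_of_eq hall.2]
    have hr := rank_hi hall.1
    rw [hb] at hr
    rw [hr, ← hb, ← hall.1, tgen_braid]
  -- the three factors on either side are the entries for the three pairs of letters
  have e1 : coef m i (act (simpleRefl j) (act (simpleRefl i) χ)) = coef m j χ := by
    refine coef_congr ?_ ?_ fun hEq => ?_
    · simp only [act_simpleRefl, sjlo, simpleRefl_lo, hb]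
    · simp only [act_simpleRefl, sjhi', sihi]
    · simp only [act_simpleRefl, sjlo, simpleRefl_lo, sjhi', sihi] at hEq
      have hne : χ i.lo ≠ χ i.hi := fun he => hall ⟨he, hb ▸ hEq⟩
      rw [rank_act_of_ne hlo1 hlo2]
      conv_lhs => rw [← simpleRefl_hi i]
      rw [rank_act hne, hb]
  have e2 : coef m j (act (simpleRefl i) (act (simpleRefl j) χ)) = coef m i χ := by
    refine coef_congr ?_ ?_ fun hEq => ?_
    · simp only [act_simpleRefl, sihi', sjlo]
    · simp only [act_simpleRefl, sihi, simpleRefl_hi, hb]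
    · simp only [act_simpleRefl, sjlo, sihi, simpleRefl_hi, ← hb] at hEq
      have hne : χ j.lo ≠ χ j.hi := fun he => hall ⟨hEq, he⟩
      have hne' : act (simpleRefl j) χ i.lo ≠ act (simpleRefl j) χ i.hi := by
        simp only [act_simpleRefl, sjlo, sjhi']
        rw [hEq, hb]
        exact hne
      rw [← hb]
      conv_lhs => rw [← simpleRefl_lo i]
      rw [rank_act hne', rank_act_of_ne hlo1 hlo2]
  have e3 : coef m j (act (simpleRefl i) χ) = coef m i (act (simpleRefl j) χ) := by
    refine coef_congr ?_ ?_ fun hEq => ?_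
    · simp only [act_simpleRefl, sihi', sjlo]
    · simp only [act_simpleRefl, sihi, sjhi']
    · simp only [act_simpleRefl, sihi', sihi] at hEq
      have hne : χ i.lo ≠ χ i.hi := fun he => hall ⟨he, by rw [← hb, ← he, hEq]⟩
      rw [rank_act_of_ne hlo1 hlo2, ← hb]
      conv_lhs => rw [← simpleRefl_lo i]
      rw [rank_act hne]
  rw [e1, e2, ← e3]
  by_cases h1 : χ i.lo = χ i.hi
  · have h2 : χ j.lo ≠ χ j.hi := fun he => hall ⟨h1, he⟩
    have h3 : act (simpleRefl i) χ j.lo ≠ act (simpleRefl i) χ j.hi := by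
      simp only [act_simpleRefl, sihi', sihi]
      rw [h1, hb]
      exact h2
    rw [coef_of_ne h2, coef_of_ne h3, ← map_mul, mul_assoc, ← map_mul]
    exact (Algebra.commutes _ _).symm
  · rw [coef_of_ne h1]
    by_cases h2 : χ j.lo = χ j.hi
    · have h3 : act (simpleRefl i) χ j.lo ≠ act (simpleRefl i) χ j.hi := by
        simp only [act_simpleRefl, sihi', sihi]
        rw [← h2, ← hb]
        exact h1
      rw [coef_of_ne h3, ← map_mul, mul_assoc, ← map_mul]
      exact Algebra.commutes _ _
    · rw [coef_of_ne h2]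

theorem coef_sq {i : Gen n} {μ : Comp d n} (χ : Orbit μ) :
    coef μ.1 i χ.1 * coef μ.1 i (act (simpleRefl i) χ.1) =
      algebraMap GroundRing _ ((u : GroundRing) ^ 2) +
        if χ.1 i.lo = χ.1 i.hi then v • coef μ.1 i χ.1 else 0 := by
  by_cases h : χ.1 i.lo = χ.1 i.hi
  · rw [act_simpleRefl_of_eq h, if_pos h, coef_of_eq h, tgen_sq]
    have h1 := rank_lt_compOf χ.1 i.hi
    rwa [rank_hi h, χ.2, ← h] at h1
  · have h' : act (simpleRefl i) χ.1 i.lo ≠ act (simpleRefl i) χ.1 i.hi := by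
      rw [act_simpleRefl, act_simpleRefl, simpleRefl_lo, simpleRefl_hi]
      exact Ne.symm h
    rw [if_neg h, coef_of_ne h, coef_of_ne h', add_zero, ← map_mul, pow_two]

end Coefficients

/-! ### Averages over the roots of unity -/

section Averages

variable {d : ℕ} (ξ : Fin d ≃ rootsOfUnity d ℂ)

theorem avg_map {A B : Type} [Ring A] [Algebra GroundRing A] [Ring B] [Algebra GroundRing B]
    (f : A →ₐ[GroundRing] B) (a b : A) : f (avg d a b) = avg d (f a) (f b) := Yoko.map_avg d f a b

/-- The root of unity `ξ_a` as an element of the ground ring. -/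
def root (a : Fin d) : GroundRing := const ((ξ a : ℂˣ) : ℂ)

theorem xi_pow (a : Fin d) : ((ξ a : ℂˣ) : ℂ) ^ d = 1 := by
  rw [← Units.val_pow_eq_pow_val, show ((ξ a : ℂˣ)) ^ d = 1 from (ξ a).2, Units.val_one]

theorem root_pow (a : Fin d) : root ξ a ^ d = 1 := by rw [root, ← map_pow, xi_pow, map_one]

theorem avg_root (a b : Fin d) : avg d (root ξ a) (root ξ b) = if a = b then 1 else 0 := by
  have hd0 : (d : ℂ) ≠ 0 := Nat.cast_ne_zero.2 (by have := a.2; omega)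
  have key : ∑ s ∈ Finset.range d, ((ξ a : ℂˣ) : ℂ) ^ s * ((ξ b : ℂˣ) : ℂ) ^ (d - s) =
      if a = b then (d : ℂ) else 0 := by
    split_ifs with hab
    · subst hab
      rw [Finset.sum_congr rfl (g := fun _ => (1 : ℂ)) (fun s hs => by
        rw [← pow_add, Nat.add_sub_cancel' (Finset.mem_range.1 hs).le, xi_pow])]
      simp
    · have hne : ((ξ a : ℂˣ) : ℂ) - ((ξ b : ℂˣ) : ℂ) ≠ 0 := fun h =>
        hab (ξ.injective (Subtype.ext (Units.ext (sub_eq_zero.1 h))))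
      have h := (Commute.all ((ξ a : ℂˣ) : ℂ) ((ξ b : ℂˣ) : ℂ)).geom_sum₂_mul d
      rw [xi_pow, xi_pow, sub_self] at h
      have h' := (mul_eq_zero.1 h).resolve_right hne
      rw [← zero_mul ((ξ b : ℂˣ) : ℂ), ← h', Finset.sum_mul]
      refine Finset.sum_congr rfl fun s hs => ?_
      have : d - s = (d - 1 - s) + 1 := by have := Finset.mem_range.1 hs; omega
      rw [this, pow_succ, mul_assoc]
  simp only [avg, root, smul_eq_mul, ← map_pow, ← map_mul, ← map_sum, key]
  split_ifs
  · rw [inv_mul_cancel₀ hd0, map_one]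
  · rw [mul_zero, map_zero]

theorem sum_xi_pow {s : ℕ} (hs : s < d) :
    ∑ a, ((ξ a : ℂˣ) : ℂ) ^ s = if s = 0 then (d : ℂ) else 0 := by
  split_ifs with h
  · subst h; simp
  · have : NeZero d := ⟨by omega⟩
    let _ : Fintype (rootsOfUnity d ℂ) := Fintype.ofEquiv _ ξ
    let f : rootsOfUnity d ℂ →* ℂ :=
      ((Units.coeHom ℂ).comp (rootsOfUnity d ℂ).subtype).comp (powMonoidHom s)
    have hf : f ≠ 1 := by
      intro hf
      have hζ := Complex.isPrimitiveRoot_exp d (NeZero.ne d)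
      have h1 := DFunLike.congr_fun hf hζ.toRootsOfUnity
      have h2 : Complex.exp (2 * Real.pi * Complex.I / d) ^ s = 1 := by simpa [f] using h1
      exact h (Nat.eq_zero_of_dvd_of_lt (hζ.dvd_of_pow_eq_one s h2) hs)
    calc ∑ a, ((ξ a : ℂˣ) : ℂ) ^ s = ∑ z : rootsOfUnity d ℂ, f z :=
          Fintype.sum_equiv ξ _ _ fun a => by simp [f]
      _ = 0 := sum_hom_units_eq_zero f hf

theorem sum_avg_root {A : Type} [Ring A] [Algebra GroundRing A] (hd : 1 ≤ d) {b : A}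
    (hb : b ^ d = 1) : ∑ a, avg d (algebraMap GroundRing A (root ξ a)) b = 1 := by
  have hd0 : (d : ℂ) ≠ 0 := Nat.cast_ne_zero.2 (by omega)
  simp only [avg]
  rw [← Finset.smul_sum, Finset.sum_comm]
  have h : ∀ s ∈ Finset.range d, ∑ a, algebraMap GroundRing A (root ξ a) ^ s * b ^ (d - s) =
      if s = 0 then const (d : ℂ) • (1 : A) else 0 := by
    intro s hs
    rw [← Finset.sum_mul]
    simp only [← map_pow, root]
    rw [← map_sum, ← map_sum, sum_xi_pow ξ (Finset.mem_range.1 hs)]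
    split_ifs with h
    · subst h
      rw [Nat.sub_zero, hb, mul_one, Algebra.algebraMap_eq_smul_one]
    · simp
  rw [Finset.sum_congr rfl h, Finset.sum_ite_eq' (Finset.range d) 0, if_pos (by simp; omega),
    smul_smul, ← map_mul, inv_mul_cancel₀ hd0, map_one, one_smul]

end Averages

/-! ### The idempotents of the Yokonuma--Hecke algebra -/

section Torus

variable {d n : ℕ}

theorem Yoko.adjoin_generators : Algebra.adjoin GroundRing
    (Set.range (g : Gen n → Yoko d n) ∪ Set.range (t : Fin n → Yoko d n)) = ⊤ := by
  have h : Set.range (g : Gen n → Yoko d n) ∪ Set.range (t : Fin n → Yoko d n) =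
      mk d n '' Set.range (FreeAlgebra.ι GroundRing) := by
    ext x
    constructor
    · rintro (⟨i, rfl⟩ | ⟨j, rfl⟩)
      · exact ⟨_, ⟨YGen.g i, rfl⟩, rfl⟩
      · exact ⟨_, ⟨YGen.t j, rfl⟩, rfl⟩
    · rintro ⟨_, ⟨i | j, rfl⟩, rfl⟩
      · exact Or.inl ⟨i, rfl⟩
      · exact Or.inr ⟨j, rfl⟩
  rw [h, ← AlgHom.map_adjoin, FreeAlgebra.adjoin_range_ι, Algebra.map_top, AlgHom.range_eq_top]
  exact RingQuot.mkAlgHom_surjective GroundRing _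

variable (d n) in
/-- The commutative subalgebra generated by the `t_j`. -/
def torus : Subalgebra GroundRing (Yoko d n) := Algebra.adjoin GroundRing (Set.range Yoko.t)

instance torusCommRing : CommRing (torus d n) :=
  { (torus d n).toRing with
    mul_comm := fun x y => by
      have := Algebra.isMulCommutative_adjoin GroundRing
        (s := Set.range (Yoko.t : Fin n → Yoko d n))
        (by rintro _ ⟨i, rfl⟩ _ ⟨j, rfl⟩; exact Yoko.t_comm i j)
      exact this.is_comm.comm x y }

/-- The generator `t_j` as an element of the torus. -/
def torusT (j : Fin n) : torus d n := ⟨Yoko.t j, Algebra.subset_adjoin ⟨j, rfl⟩⟩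

variable (ξ : Fin d ≃ rootsOfUnity d ℂ)

/-- The factor of index `j` of `E_χ`, in the torus. -/
def torusProj (a : Fin d) (j : Fin n) : torus d n :=
  avg d (algebraMap GroundRing _ (root ξ a)) (torusT j)

theorem val_torusProj (a : Fin d) (j : Fin n) : (torus d n).val (torusProj ξ a j) = proj ξ a j := by
  rw [torusProj, avg_map, AlgHom.commutes]; rfl

theorem noncommProd_proj {m : ℕ} (χ : Fin m → Fin d) (f : Fin m → Fin n) (comm) :
    Finset.univ.noncommProd (fun i => proj ξ (χ i) (f i)) comm =
      (torus d n).val (∏ i, torusProj ξ (χ i) (f i)) := by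
  rw [← Finset.noncommProd_eq_prod]
  refine Eq.trans ?_ (Finset.map_noncommProd _ _ _ (torus d n).val).symm
  exact Finset.noncommProd_congr rfl (fun i _ => (val_torusProj ξ _ _).symm) _

theorem Echi_eq (χ : Char d n) : Echi ξ χ = (torus d n).val (∏ i, torusProj ξ (χ i) i) :=
  noncommProd_proj ξ χ id _

theorem sum_Echi (hd : 1 ≤ d) : ∑ χ : Char d n, Echi ξ χ = 1 := by
  have h : ∀ j : Fin n, ∑ a, (torusProj ξ a j : torus d n) = 1 := fun j =>
    sum_avg_root ξ hd (Subtype.ext (Yoko.t_pow j))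
  simp only [Echi_eq, ← map_sum]
  have h2 := Finset.prod_univ_sum (fun _ : Fin n => (Finset.univ : Finset (Fin d)))
    (fun i a => (torusProj ξ a i : torus d n))
  rw [Fintype.piFinset_univ] at h2
  rw [← h2, Finset.prod_congr rfl fun j _ => h j, Finset.prod_const_one, map_one]

theorem torusT_mul_torusProj (a : Fin d) (j : Fin n) :
    (torusT j : torus d n) * torusProj ξ a j = root ξ a • torusProj ξ a j := by
  apply Subtype.ext
  change Yoko.t j * (torus d n).val (torusProj ξ a j) = root ξ a • (torus d n).val (torusProj ξ a j)
  rw [val_torusProj, t_mul_proj]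
  rfl

theorem Echi_commute_t (χ : Char d n) (j : Fin n) : Commute (Echi ξ χ) (Yoko.t j) := by
  rw [Echi_eq]
  change (torus d n).val _ * (torus d n).val (torusT j) =
    (torus d n).val (torusT j) * (torus d n).val _
  rw [← map_mul, mul_comm, map_mul]

theorem Echi_mul_t (χ : Char d n) (j : Fin n) :
    Echi ξ χ * Yoko.t j = root ξ (χ j) • Echi ξ χ := by
  rw [(Echi_commute_t ξ χ j).eq, Echi_eq]
  change (torus d n).val (torusT j) * _ = _
  rw [← map_mul, ← map_smul, ← Finset.mul_prod_erase _ _ (Finset.mem_univ j), ← mul_assoc,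
    torusT_mul_torusProj, smul_mul_assoc]

theorem Echi_mul_avg (χ : Char d n) (i j : Fin n) :
    Echi ξ χ * avg d (Yoko.t i) (Yoko.t j) = if χ i = χ j then Echi ξ χ else 0 := by
  have hpow : ∀ (j : Fin n) (s : ℕ), Echi ξ χ * Yoko.t j ^ s = root ξ (χ j) ^ s • Echi ξ χ := by
    intro j s
    induction s with
    | zero => simp
    | succ s ih => rw [pow_succ, ← mul_assoc, ih, smul_mul_assoc, Echi_mul_t, smul_smul, ← pow_succ]
  have h : Echi ξ χ * avg d (Yoko.t i) (Yoko.t j) =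
      avg d (root ξ (χ i)) (root ξ (χ j)) • Echi ξ χ := by
    simp only [avg]
    rw [mul_smul_comm, Finset.mul_sum, smul_assoc, Finset.sum_smul]
    congr 1
    refine Finset.sum_congr rfl fun s _ => ?_
    rw [← mul_assoc, hpow, smul_mul_assoc, hpow, smul_smul]
  rw [h, avg_root]
  split_ifs <;> simp

theorem Echi_mul_e (χ : Char d n) (i : Gen n) :
    Echi ξ χ * Yoko.e i = if χ i.lo = χ i.hi then Echi ξ χ else 0 := Echi_mul_avg ξ χ _ _

theorem g_mul_proj (i : Gen n) (a : Fin d) (j : Fin n) :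
    Yoko.g i * proj ξ a j = proj ξ a (simpleRefl i j) * Yoko.g i := by
  simp only [proj, avg, mul_smul_comm, smul_mul_assoc, Finset.mul_sum, Finset.sum_mul]
  congr 1
  refine Finset.sum_congr rfl fun s _ => ?_
  rw [← map_pow, ← mul_assoc, ← Algebra.commutes, mul_assoc, Yoko.g_mul_t_pow, mul_assoc]

theorem g_mul_Echi (i : Gen n) (χ : Char d n) :
    Yoko.g i * Echi ξ χ = Echi ξ (act (simpleRefl i) χ) * Yoko.g i := by
  have h : ∀ s : Finset (Fin n), Yoko.g i * (torus d n).val (∏ j ∈ s, torusProj ξ (χ j) j) =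
      (torus d n).val (∏ j ∈ s, torusProj ξ (χ j) (simpleRefl i j)) * Yoko.g i := by
    intro s
    induction s using Finset.induction_on with
    | empty => simp
    | insert j s hj ih =>
      rw [Finset.prod_insert hj, Finset.prod_insert hj, map_mul, map_mul, ← mul_assoc,
        val_torusProj, val_torusProj, g_mul_proj, mul_assoc, ih, mul_assoc]
  rw [Echi_eq, h, Echi_eq, ← Equiv.prod_comp (simpleRefl i)]
  simp only [act_simpleRefl, simpleRefl_apply_apply]

theorem gtilde_mul_t (w : Equiv.Perm (Fin n)) (j : Fin n) :
    (Yoko.gtilde w * Yoko.t j : Yoko d n) = Yoko.t (w j) * Yoko.gtilde w := by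
  induction w using perm_induction generalizing j with
  | one => simp [Yoko.gtilde_one]
  | step w i h ih =>
    rw [Yoko.gtilde_mul h, smul_mul_assoc, mul_assoc, Yoko.g_t, ← mul_assoc, ih, mul_assoc,
      mul_smul_comm]
    rfl

theorem gtilde_mul_Echi (w : Equiv.Perm (Fin n)) (χ : Char d n) :
    Yoko.gtilde w * Echi ξ χ = Echi ξ (act w χ) * Yoko.gtilde w := by
  induction w using perm_induction generalizing χ with
  | one => simp [Yoko.gtilde_one, act_one]
  | step w i h ih =>
    rw [Yoko.gtilde_mul h, smul_mul_assoc, mul_assoc, g_mul_Echi, ← mul_assoc, ih, mul_assoc,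
      mul_smul_comm, act_mul]

theorem gtilde_mul_avg (w : Equiv.Perm (Fin n)) (i j : Fin n) :
    (Yoko.gtilde w * avg d (Yoko.t i) (Yoko.t j) : Yoko d n) =
      avg d (Yoko.t (w i)) (Yoko.t (w j)) * Yoko.gtilde w := by
  simp only [avg, mul_smul_comm, smul_mul_assoc, Finset.mul_sum, Finset.sum_mul]
  congr 1
  refine Finset.sum_congr rfl fun s _ => ?_
  have h : ∀ j, SemiconjBy (Yoko.gtilde w : Yoko d n) (Yoko.t j) (Yoko.t (w j)) := gtilde_mul_t w
  exact ((h i).pow_right s).mul_right ((h j).pow_right _)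

theorem gtilde_mul_g_of_lt {w : Equiv.Perm (Fin n)} {i : Gen n} (h : w i.lo < w i.hi) :
    (Yoko.gtilde w * Yoko.g i : Yoko d n) = (u : GroundRing) • Yoko.gtilde (w * simpleRefl i) := by
  rw [Yoko.gtilde_mul h, smul_smul, Units.mul_inv, one_smul]

/-- The elements `E_χ g̃_w` span the Yokonuma--Hecke algebra. -/
theorem span_Echi_mul_gtilde (hd : 1 ≤ d) : Submodule.span GroundRing
    (Set.range fun p : Char d n × Equiv.Perm (Fin n) => Echi ξ p.1 * Yoko.gtilde p.2) = ⊤ := by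
  have hmem : ∀ χ w, Echi ξ χ * Yoko.gtilde w ∈ Submodule.span GroundRing
      (Set.range fun p : Char d n × Equiv.Perm (Fin n) => Echi ξ p.1 * Yoko.gtilde p.2) :=
    fun χ w => Submodule.subset_span ⟨(χ, w), rfl⟩
  refine eq_top_of_mul_mem Yoko.adjoin_generators ?_ ?_
  · rw [← sum_Echi ξ hd]
    refine Submodule.sum_mem _ fun χ _ => ?_
    simpa [Yoko.gtilde_one] using hmem χ 1
  · rintro _ (⟨i, rfl⟩ | ⟨j, rfl⟩) <;> refine mul_mem_of_span ?_ <;> rintro _ ⟨⟨χ, w⟩, rfl⟩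
    · dsimp only
      rcases lt_or_gt_of_ne (apply_lo_ne_apply_hi w i) with hlt | hgt
      · rw [mul_assoc, gtilde_mul_g_of_lt hlt, mul_smul_comm]
        exact Submodule.smul_mem _ _ (hmem _ _)
      · have hw' : (w * simpleRefl i) i.lo < (w * simpleRefl i) i.hi := by simpa using hgt
        have hw : (Yoko.gtilde w : Yoko d n) = ((u⁻¹ : GroundRingˣ) : GroundRing) •
            (Yoko.gtilde (w * simpleRefl i) * Yoko.g i) := by
          rw [← Yoko.gtilde_mul hw', mul_simpleRefl_cancel]
        rw [hw, mul_smul_comm, smul_mul_assoc]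
        refine Submodule.smul_mem _ _ ?_
        rw [mul_assoc, mul_assoc (Yoko.gtilde _), Yoko.g_sq, mul_add, mul_add, ← Algebra.commutes,
          ← Algebra.smul_def, mul_smul_comm, mul_smul_comm, mul_smul_comm]
        refine add_mem (Submodule.smul_mem _ _ (hmem _ _)) (Submodule.smul_mem _ _ ?_)
        rw [← mul_assoc (Yoko.gtilde _) (Yoko.e _), Yoko.e, gtilde_mul_avg,
          mul_assoc (avg _ _ _), ← mul_assoc (Echi _ _), Echi_mul_avg,
          gtilde_mul_g_of_lt hw', mul_simpleRefl_cancel]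
        split_ifs
        · rw [mul_smul_comm]; exact Submodule.smul_mem _ _ (hmem _ _)
        · rw [zero_mul]; exact Submodule.zero_mem _
    · dsimp only
      rw [mul_assoc, gtilde_mul_t, ← mul_assoc, Echi_mul_t, smul_mul_assoc]
      exact Submodule.smul_mem _ _ (hmem _ _)

end Torus

namespace Yoko

variable {d n : ℕ} {A : Type} [Ring A] [Algebra GroundRing A]

/-- The function on the generators of the Yokonuma--Hecke algebra given by images of the `g_i` and
of the `t_j`. -/
def onGen (G : Gen n → A) (S : Fin n → A) : YGen n → A
  | .g i => G i
  | .t j => S j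

/-- The homomorphism from the Yokonuma--Hecke algebra given by elements that satisfy its
relations. -/
def lift (G : Gen n → A) (S : Fin n → A)
    (comm : ∀ i j : Gen n, (i.1 + 1 < j.1 ∨ j.1 + 1 < i.1) → G i * G j = G j * G i)
    (braid : ∀ i j : Gen n, j.1 = i.1 + 1 → G i * G j * G i = G j * G i * G j)
    (tcomm : ∀ i j, S i * S j = S j * S i)
    (gt : ∀ i j, G i * S j = S (simpleRefl i j) * G i) (tpow : ∀ j, S j ^ d = 1)
    (quad : ∀ i, G i * G i = algebraMap GroundRing A ((u : GroundRing) ^ 2) +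
      v • (avg d (S i.lo) (S i.hi) * G i)) :
    Yoko d n →ₐ[GroundRing] A :=
  RingQuot.liftAlgHom GroundRing ⟨FreeAlgebra.lift GroundRing (onGen G S), by
    intro x y h
    induction h with
    | comm i j h => simpa [fg, onGen] using comm i j h
    | braid i j h => simpa [fg, onGen] using braid i j h
    | t_comm i j => simpa [ft, onGen] using tcomm i j
    | g_t i j => simpa [fg, ft, onGen] using gt i j
    | t_pow j => simpa [ft, onGen] using tpow j
    | quad i => simpa [fg, ft, onGen, pow_two, map_avg] using quad i⟩

theorem lift_g (G : Gen n → A) (S : Fin n → A) (h1) (h2) (h3) (h4) (h5) (h6) (i : Gen n) :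
    lift (d := d) G S h1 h2 h3 h4 h5 h6 (g i) = G i :=
  (RingQuot.liftAlgHom_mkAlgHom_apply GroundRing
    (FreeAlgebra.lift GroundRing (onGen G S)) _ (fg i)).trans
    (FreeAlgebra.lift_ι_apply (onGen G S) (YGen.g i))

theorem lift_t (G : Gen n → A) (S : Fin n → A) (h1) (h2) (h3) (h4) (h5) (h6) (j : Fin n) :
    lift (d := d) G S h1 h2 h3 h4 h5 h6 (t j) = S j :=
  (RingQuot.liftAlgHom_mkAlgHom_apply GroundRing
    (FreeAlgebra.lift GroundRing (onGen G S)) _ (ft j)).trans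
    (FreeAlgebra.lift_ι_apply (onGen G S) (YGen.t j))

end Yoko

section Representation

variable {d n : ℕ} (ξ : Fin d ≃ rootsOfUnity d ℂ) (μ : Comp d n)

/-- Diagonal matrices with scalar entries. -/
def scalarDiagonal : (Orbit μ → GroundRing) →ₐ[GroundRing]
    Matrix (Orbit μ) (Orbit μ) (HeckeTensor μ) :=
  (Matrix.diagonalAlgHom GroundRing).comp
    ((Algebra.ofId GroundRing (HeckeTensor μ)).compLeft (Orbit μ))

theorem scalarDiagonal_apply (f : Orbit μ → GroundRing) :
    scalarDiagonal μ f = Matrix.diagonal fun χ => algebraMap GroundRing (HeckeTensor μ) (f χ) := rfl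

theorem avg_pi {X : Type} (f g : X → GroundRing) (x : X) : avg d f g x = avg d (f x) (g x) :=
  avg_map (Pi.evalAlgHom GroundRing (fun _ : X => GroundRing) x) f g

/-- The matrix of the generator `g_i`. -/
def reprG (i : Gen n) : Matrix (Orbit μ) (Orbit μ) (HeckeTensor μ) :=
  monomial (Orbit.act (simpleRefl i)) fun χ => coef μ.1 i χ.1

/-- The matrix of the generator `t_j`. -/
def reprT (j : Fin n) : Matrix (Orbit μ) (Orbit μ) (HeckeTensor μ) :=
  scalarDiagonal μ fun χ => root ξ (χ.1 j)

theorem avg_reprT (i j : Fin n) : avg d (reprT ξ μ i) (reprT ξ μ j) =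
    scalarDiagonal μ fun χ => if χ.1 i = χ.1 j then 1 else 0 := by
  rw [reprT, reprT, ← avg_map]
  congr 1
  funext χ
  rw [avg_pi, avg_root]

/-- The homomorphism from the Yokonuma--Hecke algebra to the matrices over `ℋ^μ` whose restriction
to the block of `μ` is `Ψ_μ`: the generator `g_i` acts by a monomial matrix that permutes the
characters, with entry `u` where `χ` changes and a generator of `ℋ^μ` where `χ` is fixed. -/
def repr : Yoko d n →ₐ[GroundRing] Matrix (Orbit μ) (Orbit μ) (HeckeTensor μ) :=
  Yoko.lift (reprG μ) (reprT ξ μ)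
    (fun i j h => by
      simp only [reprG, monomial_mul_monomial]
      congr 1
      · funext χ
        refine Subtype.ext ?_
        simp only [Function.comp_apply, Orbit.act, ← act_mul]
        rw [simpleRefl_comm h]
      · funext χ
        exact coef_comm h χ.1)
    (fun i j h => by
      simp only [reprG, monomial_mul_monomial]
      congr 1
      · funext χ
        refine Subtype.ext ?_
        simp only [Function.comp_apply, Orbit.act, ← act_mul]
        simp only [← mul_assoc]
        rw [simpleRefl_braid h]
      · funext χ
        exact coef_braid h χ.1)
    (fun i j => by rw [reprT, reprT, ← map_mul, mul_comm, map_mul])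
    (fun i j => by
      simp only [reprT, reprG, scalarDiagonal_apply, monomial_mul_diagonal, diagonal_mul_monomial]
      congr 1
      funext χ
      rw [Algebra.commutes]
      simp only [Orbit.act, act_simpleRefl])
    (fun j => by
      rw [reprT, ← map_pow]
      convert map_one (scalarDiagonal μ)
      funext χ
      exact root_pow ξ _)
    (fun i => by
      rw [avg_reprT, reprG, monomial_mul_monomial, scalarDiagonal_apply, diagonal_mul_monomial]
      ext χ ψ
      have hσ : (Orbit.act (simpleRefl i) ∘ Orbit.act (simpleRefl i)) χ = χ :=
        Subtype.ext (act_simpleRefl_act i χ.1)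
      rw [Matrix.add_apply, Matrix.smul_apply, Matrix.algebraMap_matrix_apply, monomial_apply,
        monomial_apply, hσ]
      change (if ψ = χ then coef μ.1 i χ.1 * coef μ.1 i (act (simpleRefl i) χ.1) else 0) = _
      rw [coef_sq]
      by_cases h : χ.1 i.lo = χ.1 i.hi
      · have hχ : Orbit.act (simpleRefl i) χ = χ := Subtype.ext (act_simpleRefl_of_eq h)
        rw [hχ]
        by_cases hψ : ψ = χ
        · simp [h, hψ]
        · simp [hψ, Ne.symm hψ]
      · by_cases hψ : ψ = χ
        · simp [h, hψ]
        · simp [h, hψ, Ne.symm hψ])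

theorem repr_g (i : Gen n) : repr ξ μ (Yoko.g i) = reprG μ i := Yoko.lift_g ..

theorem repr_t (j : Fin n) : repr ξ μ (Yoko.t j) = reprT ξ μ j := Yoko.lift_t ..

theorem repr_e (i : Gen n) : repr ξ μ (Yoko.e i) =
    scalarDiagonal μ fun χ => if χ.1 i.lo = χ.1 i.hi then 1 else 0 := by
  rw [Yoko.e, avg_map, repr_t, repr_t, avg_reprT]

theorem repr_proj (a : Fin d) (j : Fin n) : repr ξ μ (proj ξ a j) =
    scalarDiagonal μ fun χ => if a = χ.1 j then 1 else 0 := by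
  rw [proj, avg_map, AlgHom.commutes, repr_t, reprT, ← AlgHom.commutes (scalarDiagonal μ),
    ← avg_map]
  congr 1
  funext χ
  rw [avg_pi]
  exact avg_root ξ _ _

theorem scalarDiagonal_eq_single (χ : Orbit μ) :
    scalarDiagonal μ (fun ψ => if ψ = χ then 1 else 0) = Matrix.single χ χ 1 := by
  ext ψ ω
  rw [scalarDiagonal_apply, Matrix.diagonal_apply, Matrix.single_apply]
  by_cases h : ψ = ω
  · subst h
    by_cases h' : ψ = χ
    · simp [h']
    · simp [h', Ne.symm h']
  · rw [if_neg h, if_neg]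
    rintro ⟨rfl, rfl⟩
    exact h rfl

theorem repr_Echi (χ : Orbit μ) : repr ξ μ (Echi ξ χ.1) = Matrix.single χ χ 1 := by
  have h : repr ξ μ (Echi ξ χ.1) =
      scalarDiagonal μ (∏ j, fun ψ : Orbit μ => if χ.1 j = ψ.1 j then 1 else 0) := by
    rw [← Finset.noncommProd_eq_prod, Echi]
    refine (Finset.map_noncommProd _ _ _ (repr ξ μ)).trans (Eq.trans ?_
      (Finset.map_noncommProd _ _ _ (scalarDiagonal μ)).symm)
    exact Finset.noncommProd_congr rfl (fun j _ => repr_proj ξ μ _ _) _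
  rw [h, ← scalarDiagonal_eq_single]
  congr 1
  funext ψ
  rw [Finset.prod_apply]
  by_cases hψ : ψ = χ
  · simp [hψ]
  · obtain ⟨j, hj⟩ := Function.ne_iff.1 fun e => hψ (Subtype.ext e)
    rw [if_neg hψ]
    exact Finset.prod_eq_zero (Finset.mem_univ j) (if_neg (Ne.symm hj))

theorem repr_Emu : repr ξ μ (Emu ξ μ) = 1 := by
  rw [Emu, map_sum, Finset.sum_congr rfl fun χ _ => repr_Echi ξ μ χ, Matrix.sum_single_one]

end Representation

/-! ### Coset representatives and the map `Ψ_μ` -/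

section Representatives

variable {d n : ℕ} {μ : Comp d n}

theorem chiOne_blockEquiv (a : Fin d) (k : Fin (μ.1 a)) : chiOne μ (blockEquiv μ ⟨a, k⟩) = a := by
  simp [chiOne]

theorem blockEquiv_val (a : Fin d) (k : Fin (μ.1 a)) : (blockEquiv μ ⟨a, k⟩).1 =
    ∑ i : Fin a.1, μ.1 (Fin.castLE a.2.le i) + k.1 := finSigmaFinEquiv_apply _

/-- The letter `π_χ(a, k)`; it will turn out to be the `k`-th letter on which `χ` is `ξ_a`. -/
def pos (χ : Orbit μ) (a : Fin d) (k : Fin (μ.1 a)) : Fin n := rep χ (blockEquiv μ ⟨a, k⟩)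

variable (χ : Orbit μ)

theorem chi_pos (a : Fin d) (k : Fin (μ.1 a)) : χ.1 (pos χ a k) = a := by
  rw [pos]
  conv_lhs => rw [← (rep_spec χ).1]
  rw [act_apply, chiOne_blockEquiv]

theorem exists_pos {p : Fin n} {a : Fin d} (hp : χ.1 p = a) : ∃ k, pos χ a k = p := by
  obtain ⟨⟨b, k⟩, h⟩ : ∃ x, rep χ (blockEquiv μ x) = p :=
    ⟨(blockEquiv μ).symm ((rep χ)⁻¹ p), by simp⟩
  obtain rfl : b = a := by rw [← hp, ← h]; exact (chi_pos χ b k).symm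
  exact ⟨k, h⟩

/-- By minimality of its length, `π_χ` increases between consecutive letters of a block. -/
theorem rep_lo_lt_rep_hi {i : Gen n} (h : chiOne μ i.lo = chiOne μ i.hi) :
    rep χ i.lo < rep χ i.hi := by
  by_contra hlt
  have hlt := lt_of_le_of_ne (not_lt.1 hlt) (apply_lo_ne_apply_hi (rep χ) i).symm
  have h1 := len_mul_of_gt hlt
  have h2 := (rep_spec χ).2 (rep χ * simpleRefl i)
    (by rw [act_mul, act_simpleRefl_of_eq h, (rep_spec χ).1])
  omega

theorem pos_lt_pos_succ {a : Fin d} {k l : Fin (μ.1 a)} (h : l.1 = k.1 + 1) :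
    pos χ a k < pos χ a l := by
  have hk := blockEquiv_val a k
  have hl := blockEquiv_val a l
  let i : Gen n := ⟨(blockEquiv μ ⟨a, k⟩).1, by have := (blockEquiv μ ⟨a, l⟩).2; omega⟩
  have h1 : i.lo = blockEquiv μ ⟨a, k⟩ := rfl
  have h2 : i.hi = blockEquiv μ ⟨a, l⟩ :=
    Fin.ext (by change (blockEquiv μ ⟨a, k⟩).1 + 1 = _; omega)
  have := rep_lo_lt_rep_hi χ (i := i) (by rw [h1, h2, chiOne_blockEquiv, chiOne_blockEquiv])
  rwa [h1, h2] at this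

theorem pos_strictMono (a : Fin d) : StrictMono (pos χ a) := by
  have key : ∀ N (k l : Fin (μ.1 a)), l.1 = k.1 + N + 1 → pos χ a k < pos χ a l := by
    intro N
    induction N with
    | zero => exact fun k l hl => pos_lt_pos_succ χ hl
    | succ N ih =>
      intro k l hl
      have hlt : k.1 + N + 1 < μ.1 a := by have := l.2; omega
      exact (ih k ⟨k.1 + N + 1, hlt⟩ rfl).trans (pos_lt_pos_succ χ (k := ⟨_, hlt⟩) hl)
  intro k l hkl
  exact key (l.1 - k.1 - 1) k l (by have : k.1 < l.1 := hkl; omega)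

theorem rank_pos (a : Fin d) (k : Fin (μ.1 a)) : rank χ.1 (pos χ a k) = k.1 := by
  rw [rank, chi_pos, ← Fin.card_Iio k, ← Finset.card_map ⟨pos χ a, (pos_strictMono χ a).injective⟩]
  congr 1
  ext p
  simp only [Finset.mem_filter, Finset.mem_univ, true_and, Finset.mem_map, Finset.mem_Iio,
    Function.Embedding.coeFn_mk]
  constructor
  · rintro ⟨h, hp⟩
    obtain ⟨l, hl⟩ := exists_pos χ hp
    refine ⟨l, ?_, hl⟩
    rwa [← hl, (pos_strictMono χ _).lt_iff_lt] at h
  · rintro ⟨l, hl, rfl⟩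
    exact ⟨(pos_strictMono χ a) hl, chi_pos χ a l⟩

theorem eq_pos {a : Fin d} {k : Fin (μ.1 a)} {p : Fin n} (hp : χ.1 p = a)
    (h : rank χ.1 p = k.1) : p = pos χ a k := by
  obtain ⟨l, hl⟩ := exists_pos χ hp
  have := rank_pos χ _ l
  rw [hl, h] at this
  rw [← hl, Fin.ext this]

theorem pos_act {i : Gen n} (h : χ.1 i.lo ≠ χ.1 i.hi) (a : Fin d) (k : Fin (μ.1 a)) :
    simpleRefl i (pos χ a k) = pos (Orbit.act (simpleRefl i) χ) a k := by
  refine eq_pos _ ?_ ?_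
  · change act (simpleRefl i) χ.1 _ = a
    rw [act_simpleRefl, simpleRefl_apply_apply, chi_pos]
  · exact (rank_act h _).trans (rank_pos χ a k)

/-- In terms of the letters `π_χ(a, k)`, the equation `π_χ⁻¹ w π_ψ = y` says that `w` takes the
`k`-th letter on which `ψ` is `ξ_a` to the `y_a(k)`-th letter on which `χ` is `ξ_a`. -/
theorem young_iff {χ ψ : Orbit μ} {w : Equiv.Perm (Fin n)} {y : ∀ a, Equiv.Perm (Fin (μ.1 a))} :
    (rep χ)⁻¹ * w * rep ψ = young μ y ↔ ∀ a k, w (pos ψ a k) = pos χ a (y a k) := by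
  have hy : ∀ a k, young μ y (blockEquiv μ ⟨a, k⟩) = blockEquiv μ ⟨a, y a k⟩ := by
    intro a k
    simp [young, Equiv.permCongr_apply]
  constructor
  · intro h a k
    have := DFunLike.congr_fun h (blockEquiv μ ⟨a, k⟩)
    rw [hy, Equiv.Perm.mul_apply, Equiv.Perm.mul_apply, Equiv.Perm.inv_eq_iff_eq] at this
    exact this
  · intro h
    refine Equiv.ext fun p => ?_
    obtain ⟨⟨a, k⟩, rfl⟩ := (blockEquiv μ).surjective p
    rw [hy, Equiv.Perm.mul_apply, Equiv.Perm.mul_apply, Equiv.Perm.inv_eq_iff_eq]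
    exact h a k

theorem exists_young {χ ψ : Orbit μ} {w : Equiv.Perm (Fin n)} (h : act w ψ.1 = χ.1) :
    ∃ y : ∀ a, Equiv.Perm (Fin (μ.1 a)), (rep χ)⁻¹ * w * rep ψ = young μ y := by
  have hex : ∀ a (k : Fin (μ.1 a)), ∃ l, w (pos ψ a k) = pos χ a l := by
    intro a k
    have hw : χ.1 (w (pos ψ a k)) = a := by rw [← h, act_apply, chi_pos]
    obtain ⟨l, hl⟩ := exists_pos χ hw
    exact ⟨l, hl.symm⟩
  choose f hf using hex
  have hinj : ∀ a, Function.Injective (f a) := by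
    intro a k l hkl
    have := hf a k
    rw [hkl, ← hf a l] at this
    exact (pos_strictMono ψ a).injective (w.injective this)
  exact ⟨fun a => Equiv.ofBijective (f a) (Finite.injective_iff_bijective.1 (hinj a)),
    young_iff.2 hf⟩

/-- The images of the spanning elements of the block under the matrix representation. The proof
is by ascents of `w`: in each step, `g_i` either only permutes the characters, or multiplies by a
generator of one tensor factor, which is again an ascent there. -/
theorem repr_Echi_mul_gtilde (ξ : Fin d ≃ rootsOfUnity d ℂ) (χ ψ : Orbit μ)
    (w : Equiv.Perm (Fin n)) (y : ∀ a, Equiv.Perm (Fin (μ.1 a))) (hw : act w ψ.1 = χ.1)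
    (hy : ∀ a k, w (pos ψ a k) = pos χ a (y a k)) :
    repr ξ μ (Echi ξ χ.1 * Yoko.gtilde w) =
      Matrix.single χ ψ (⨂ₜ[GroundRing] a, Hecke.Ttilde (y a)) := by
  induction w using perm_induction generalizing ψ y with
  | one =>
    obtain rfl : ψ = χ := Subtype.ext hw
    have h1 : y = 1 := funext fun a => Equiv.ext fun k =>
      ((pos_strictMono ψ a).injective (hy a k)).symm
    subst h1
    rw [Yoko.gtilde_one, mul_one, repr_Echi]
    simp only [Pi.one_apply, Hecke.Ttilde_one]
    rfl
  | step w i hlt ih =>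
    have hw' : act w (Orbit.act (simpleRefl i) ψ).1 = χ.1 := by rw [← hw, act_mul]; rfl
    rw [Yoko.gtilde_mul hlt, mul_smul_comm, ← mul_assoc, map_smul, map_mul, repr_g, reprG]
    by_cases h : ψ.1 i.lo = ψ.1 i.hi
    · have hψ : Orbit.act (simpleRefl i) ψ = ψ := Subtype.ext (act_simpleRefl_of_eq h)
      rw [hψ] at hw'
      obtain ⟨a, ha⟩ : ∃ a, ψ.1 i.lo = a := ⟨_, rfl⟩
      obtain ⟨k, hk⟩ := exists_pos ψ ha
      obtain ⟨l, hl⟩ := exists_pos ψ (h.symm.trans ha)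
      have hrank := rank_hi h
      rw [← hk, ← hl, rank_pos, rank_pos] at hrank
      let s : Gen (μ.1 a) := ⟨k.1, by have := l.2; omega⟩
      have hslo : s.lo = k := rfl
      have hshi : s.hi = l := Fin.ext hrank.symm
      let y' : ∀ a, Equiv.Perm (Fin (μ.1 a)) := Function.update y a (y a * simpleRefl s)
      have hy' : ∀ b p, w (pos ψ b p) = pos χ b (y' b p) := by
        intro b p
        by_cases hb : b = a
        · subst hb
          have hsp : simpleRefl i (pos ψ b p) = pos ψ b (simpleRefl s p) := by
            by_cases h1 : p = s.lo
            · rw [h1, simpleRefl_lo, hslo, hshi, hk, hl, simpleRefl_lo]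
            · by_cases h2 : p = s.hi
              · rw [h2, simpleRefl_hi, hslo, hshi, hk, hl, simpleRefl_hi]
              · rw [simpleRefl_of_ne h1 h2, simpleRefl_of_ne]
                · rw [← hk]; exact fun e => h1 ((pos_strictMono ψ b).injective e)
                · rw [← hl]
                  exact fun e => h2 (((pos_strictMono ψ b).injective e).trans hshi.symm)
          have := hy b (simpleRefl s p)
          rw [← hsp, Equiv.Perm.mul_apply, simpleRefl_apply_apply] at this
          rw [this]
          simp [y']
        · have h1 : pos ψ b p ≠ i.lo := fun e => hb (by rw [← ha, ← e, chi_pos])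
          have h2 : pos ψ b p ≠ i.hi := fun e => hb (by rw [← ha, h, ← e, chi_pos])
          have := hy b p
          rw [Equiv.Perm.mul_apply, simpleRefl_of_ne h1 h2] at this
          rw [this]
          simp [y', Function.update_of_ne hb]
      have hasc : (y' a) s.lo < (y' a) s.hi := by
        rw [← (pos_strictMono χ a).lt_iff_lt, ← hy', ← hy', hslo, hshi, hk, hl]
        exact hlt
      have hya : y a = y' a * simpleRefl s := by simp [y', mul_assoc]
      have hT : Hecke.Ttilde (y' a) * Hecke.gen (μ.1 a) k.1 =
          (u : GroundRing) • Hecke.Ttilde (y a) := by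
        rw [hya, Hecke.Ttilde_mul hasc, smul_smul, Units.mul_inv, one_smul, Hecke.gen_eq s.2]
      rw [ih ψ y' hw' hy', single_mul_monomial, hψ, coef_of_eq h, ha, tgen]
      rw [← hk, rank_pos, Matrix.smul_single]
      congr 1
      have hprod : (fun b => Hecke.Ttilde (y' b)) *
          (Pi.mulSingle a (Hecke.gen (μ.1 a) k.1) : ∀ b, Hecke (μ.1 b)) =
          Function.update (fun b => Hecke.Ttilde (y b)) a
            ((u : GroundRing) • Hecke.Ttilde (y a)) := by
        funext b
        by_cases hb : b = a
        · subst hb; simp [hT]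
        · simp [hb, y']
      rw [PiTensorProduct.singleAlgHom_apply, PiTensorProduct.tprod_mul_tprod,
        MonoidHom.mulSingle_apply, hprod, MultilinearMap.map_update_smul, smul_smul, Units.inv_mul,
        one_smul]
      congr 1
      exact Function.update_eq_self _ _
    · rw [ih _ y hw' fun a k => by
          rw [← pos_act ψ h, ← hy]; rfl,
        single_mul_monomial]
      have hψ : Orbit.act (simpleRefl i) (Orbit.act (simpleRefl i) ψ) = ψ :=
        Subtype.ext (act_simpleRefl_act i ψ.1)
      have h' : (Orbit.act (simpleRefl i) ψ).1 i.lo ≠ (Orbit.act (simpleRefl i) ψ).1 i.hi := by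
        change act _ _ _ ≠ act _ _ _
        rw [act_simpleRefl, act_simpleRefl, simpleRefl_lo, simpleRefl_hi]
        exact Ne.symm h
      rw [hψ, coef_of_ne h', ← Algebra.commutes, ← Algebra.smul_def, Matrix.smul_single, smul_smul,
        Units.inv_mul, one_smul]

end Representatives

section Psi

variable {d n : ℕ} (ξ : Fin d ≃ rootsOfUnity d ℂ) (μ : Comp d n)

theorem isPsi_repr : IsPsi ξ μ ((repr ξ μ).toLinearMap.comp (block ξ μ).subtype) :=
  fun χ ψ w y hw hy => repr_Echi_mul_gtilde ξ χ ψ w y hw (young_iff.1 hy)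

theorem Emu_mul_Echi_of_ne {χ : Char d n} (h : compOf χ ≠ μ) : Emu ξ μ * Echi ξ χ = 0 := by
  rw [Emu, Finset.sum_mul]
  refine Finset.sum_eq_zero fun ψ _ => ?_
  rw [Echi_mul_Echi, if_neg]
  rintro rfl
  exact h ψ.2

variable {ξ μ} in
theorem isPsi_unique (hd : 1 ≤ d)
    {Ψ Ψ' : block ξ μ →ₗ[GroundRing] Matrix (Orbit μ) (Orbit μ) (HeckeTensor μ)}
    (h : IsPsi ξ μ Ψ) (h' : IsPsi ξ μ Ψ') : Ψ = Ψ' := by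
  let P : Yoko d n →ₗ[GroundRing] block ξ μ :=
    (LinearMap.mulLeft GroundRing (Emu ξ μ)).rangeRestrict
  have hP : Function.Surjective P := LinearMap.surjective_rangeRestrict _
  have key : Ψ ∘ₗ P = Ψ' ∘ₗ P := by
    refine LinearMap.ext_on (span_Echi_mul_gtilde ξ hd) ?_
    rintro _ ⟨⟨χ, w⟩, rfl⟩
    by_cases hχ : compOf χ = μ
    · have hp : P (Echi ξ χ * Yoko.gtilde w) =
          ⟨Echi ξ χ * Yoko.gtilde w, Echi_mul_mem ξ (⟨χ, hχ⟩ : Orbit μ) _⟩ := by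
        refine Subtype.ext ?_
        change Emu ξ μ * (Echi ξ χ * Yoko.gtilde w) = _
        rw [← mul_assoc, Emu_mul_Echi ξ (⟨χ, hχ⟩ : Orbit μ)]
      let X : Orbit μ := ⟨χ, hχ⟩
      let ψ : Orbit μ := Orbit.act w⁻¹ X
      have hw : act w ψ.1 = X.1 := by
        change act w (act w⁻¹ χ) = χ
        rw [← act_mul, mul_inv_cancel, act_one]
      obtain ⟨y, hy⟩ := exists_young hw
      change Ψ (P (Echi ξ χ * Yoko.gtilde w)) = Ψ' (P (Echi ξ χ * Yoko.gtilde w))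
      rw [hp]
      exact (h X ψ w y hw hy).trans (h' X ψ w y hw hy).symm
    · have hp : P (Echi ξ χ * Yoko.gtilde w) = 0 := by
        refine Subtype.ext ?_
        change Emu ξ μ * (Echi ξ χ * Yoko.gtilde w) = 0
        rw [← mul_assoc, Emu_mul_Echi_of_ne ξ μ hχ, zero_mul]
      change Ψ (P (Echi ξ χ * Yoko.gtilde w)) = Ψ' (P (Echi ξ χ * Yoko.gtilde w))
      rw [hp, map_zero, map_zero]
  refine LinearMap.ext fun x => ?_
  obtain ⟨z, rfl⟩ := hP x
  exact LinearMap.congr_fun key z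

theorem existsUnique_isPsi (hd : 1 ≤ d) :
    ∃! Ψ : block ξ μ →ₗ[GroundRing] Matrix (Orbit μ) (Orbit μ) (HeckeTensor μ), IsPsi ξ μ Ψ :=
  ⟨_, isPsi_repr ξ μ, fun _ h => isPsi_unique hd h (isPsi_repr ξ μ)⟩

theorem Psi_eq_repr (hd : 1 ≤ d) (x : block ξ μ) : Psi ξ μ x = repr ξ μ x.1 :=
  LinearMap.congr_fun
    (isPsi_unique hd (Classical.epsilon_spec ⟨_, isPsi_repr ξ μ⟩) (isPsi_repr ξ μ)) x

theorem blockTrace_eq (hd : 1 ≤ d) (x : Yoko d n) :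
    blockTrace ξ μ x = tensorTrace μ (repr ξ μ x).trace := by
  rw [blockTrace, Psi_eq_repr ξ μ hd, map_mul, repr_Emu, one_mul]

end Psi

/-! ### Traces on the tensor products of Hecke algebras -/

section TensorTrace

variable {d : ℕ}

theorem tensorTrace_tprod {n : ℕ} (μ : Comp d n) (x : ∀ a, Hecke (μ.1 a)) :
    tensorTrace μ (⨂ₜ[GroundRing] a, x a) = ∏ a, heckeTrace (μ.1 a) (x a) := by
  rw [tensorTrace, PiTensorProduct.lift.tprod]; rfl

theorem tensorTrace_mul_comm {n : ℕ} (μ : Comp d n) (x y : HeckeTensor μ) :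
    tensorTrace μ (x * y) = tensorTrace μ (y * x) := by
  induction x using PiTensorProduct.induction_on with
  | smul_tprod r x =>
    induction y using PiTensorProduct.induction_on with
    | smul_tprod s y =>
      simp only [smul_mul_assoc, mul_smul_comm, map_smul, PiTensorProduct.tprod_mul_tprod]
      rw [smul_comm]
      congr 2
      refine (tensorTrace_tprod μ _).trans (Eq.trans ?_ (tensorTrace_tprod μ _).symm)
      exact Finset.prod_congr rfl fun a _ => heckeTrace_mul_comm _ _
    | add y z hy hz => rw [mul_add, add_mul, map_add, map_add, hy, hz]
  | add x z hx hz => rw [mul_add, add_mul, map_add, map_add, hx, hz]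

theorem heckeTrace_inclLe_of_eq {m m' : ℕ} (h : m = m') (x : Hecke m) :
    heckeTrace m' (Hecke.inclLe h.le x) = heckeTrace m x := by
  subst h; rw [Hecke.inclLe_refl]; rfl

theorem heckeTrace_inclLe_mul_gen {m m' k : ℕ} (hm : m = k + 1) (hm' : m' = m + 1) (h : m ≤ m')
    (x : Hecke m) : heckeTrace m' (Hecke.inclLe h x * Hecke.gen m' k) = heckeTrace m x := by
  subst hm hm'
  rw [Hecke.inclLe_succ, Hecke.gen_eq (Nat.lt_succ_self (k + 1))]
  exact heckeTrace_spec.markov k x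

theorem v_mul_heckeTrace_inclLe {m m' k : ℕ} (hm : m = k + 1) (hm' : m' = m + 1) (h : m ≤ m')
    (x : Hecke m) :
    v * heckeTrace m' (Hecke.inclLe h x) = (1 - (u : GroundRing) ^ 2) * heckeTrace m x := by
  subst hm hm'
  rw [Hecke.inclLe_succ]
  exact Hecke.v_mul_trace_incl heckeTrace_spec k x

/-- The inclusion of a tensor product of Hecke algebras in a larger one. -/
def inclTensor {m m' : Fin d → ℕ} (h : ∀ a, m a ≤ m' a) :
    (⨂[GroundRing] a : Fin d, Hecke (m a)) →ₐ[GroundRing] ⨂[GroundRing] a : Fin d, Hecke (m' a) :=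
  PiTensorProduct.liftAlgHom
    ((PiTensorProduct.tprod GroundRing).compLinearMap fun a => (Hecke.inclLe (h a)).toLinearMap)
    (congrArg (PiTensorProduct.tprod GroundRing) (funext fun a => map_one (Hecke.inclLe (h a))))
    (fun x y => by
      refine Eq.trans ?_ (PiTensorProduct.tprod_mul_tprod _ _).symm
      exact congrArg (PiTensorProduct.tprod GroundRing)
        (funext fun a => map_mul (Hecke.inclLe (h a)) _ _))

theorem inclTensor_tprod {m m' : Fin d → ℕ} (h : ∀ a, m a ≤ m' a) (x : ∀ a, Hecke (m a)) :
    inclTensor h (⨂ₜ[GroundRing] a, x a) = ⨂ₜ[GroundRing] a, Hecke.inclLe (h a) (x a) :=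
  PiTensorProduct.lift.tprod _

theorem inclLe_gen {m m' k : ℕ} (h : m ≤ m') (hk : k + 1 < m) :
    Hecke.inclLe h (Hecke.gen m k) = Hecke.gen m' k := by
  rw [Hecke.gen_eq hk, Hecke.gen_eq (hk.trans_le h), Hecke.inclLe_T]

theorem inclTensor_tgen {m m' : Fin d → ℕ} (h : ∀ a, m a ≤ m' a) {a : Fin d} {k : ℕ}
    (hk : k + 1 < m a) : inclTensor h (tgen m a k) = tgen m' a k := by
  rw [tgen, PiTensorProduct.singleAlgHom_apply]
  refine (inclTensor_tprod h _).trans ?_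
  rw [tgen, PiTensorProduct.singleAlgHom_apply]
  congr 1
  funext b
  by_cases hb : b = a
  · subst hb
    simp [inclLe_gen _ hk]
  · simp [hb]

variable {n n' : ℕ} {μ : Comp d n} {μ' : Comp d n'} {a : Fin d} {k : ℕ}

/-- The Markov property of the trace on `ℋ^μ` in the tensor factor of index `a`. -/
theorem tensorTrace_inclTensor_mul_tgen (h : ∀ b, μ.1 b ≤ μ'.1 b) (hk : μ.1 a = k + 1)
    (ha : μ'.1 a = μ.1 a + 1) (hb : ∀ b, b ≠ a → μ.1 b = μ'.1 b) (x : HeckeTensor μ) :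
    tensorTrace μ' (inclTensor h x * tgen μ'.1 a k) = tensorTrace μ x := by
  induction x using PiTensorProduct.induction_on with
  | smul_tprod r x =>
    rw [map_smul, map_smul, smul_mul_assoc, map_smul]
    congr 1
    rw [inclTensor_tprod, tgen, PiTensorProduct.singleAlgHom_apply, PiTensorProduct.tprod_mul_tprod]
    refine (tensorTrace_tprod μ' _).trans (Eq.trans ?_ (tensorTrace_tprod μ _).symm)
    refine Finset.prod_congr rfl fun b _ => ?_
    by_cases hba : b = a
    · subst hba
      simpa using heckeTrace_inclLe_mul_gen hk ha (h b) (x b)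
    · simpa [hba] using heckeTrace_inclLe_of_eq (hb b hba) (x b)
  | add x y hx hy => simp only [map_add, add_mul, hx, hy]

theorem v_mul_tensorTrace_inclTensor (h : ∀ b, μ.1 b ≤ μ'.1 b) (hk : μ.1 a = k + 1)
    (ha : μ'.1 a = μ.1 a + 1) (hb : ∀ b, b ≠ a → μ.1 b = μ'.1 b) (x : HeckeTensor μ) :
    v * tensorTrace μ' (inclTensor h x) = (1 - (u : GroundRing) ^ 2) * tensorTrace μ x := by
  induction x using PiTensorProduct.induction_on with
  | smul_tprod r x =>
    have h1 : tensorTrace μ' (⨂ₜ[GroundRing] b, Hecke.inclLe (h b) (x b)) =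
        ∏ b, heckeTrace (μ'.1 b) (Hecke.inclLe (h b) (x b)) := tensorTrace_tprod μ' _
    have h2 : tensorTrace μ (⨂ₜ[GroundRing] b, x b) = ∏ b, heckeTrace (μ.1 b) (x b) :=
      tensorTrace_tprod μ _
    have h3 : ∏ b ∈ Finset.univ.erase a, heckeTrace (μ'.1 b) (Hecke.inclLe (h b) (x b)) =
        ∏ b ∈ Finset.univ.erase a, heckeTrace (μ.1 b) (x b) :=
      Finset.prod_congr rfl fun b hba =>
        heckeTrace_inclLe_of_eq (hb b (Finset.ne_of_mem_erase hba)) (x b)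
    have h4 := v_mul_heckeTrace_inclLe hk ha (h a) (x a)
    rw [← Finset.mul_prod_erase _ _ (Finset.mem_univ a), h3] at h1
    rw [← Finset.mul_prod_erase _ _ (Finset.mem_univ a)] at h2
    rw [map_smul, map_smul, map_smul, inclTensor_tprod, smul_eq_mul, smul_eq_mul]
    rw [show tensorTrace μ' (⨂ₜ[GroundRing] b, Hecke.inclLe (h b) (x b)) = _ from h1, h2]
    rw [mul_left_comm, ← mul_assoc v, h4, mul_assoc, mul_left_comm]
  | add x y hx hy => simp only [map_add, mul_add, hx, hy]

end TensorTrace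

/-! ### Restriction of the matrix representations to one strand less -/

section Restriction

variable {d n : ℕ}

/-- The character that extends `χ` by the value `ξ_a` on the new letter. -/
def extend (χ : Char d n) (a : Fin d) : Char d (n + 1) := Fin.snoc (α := fun _ => Fin d) χ a

@[simp] theorem extend_castSucc (χ : Char d n) (a : Fin d) (j : Fin n) :
    extend χ a j.castSucc = χ j := Fin.snoc_castSucc (α := fun _ => Fin d) _ _ _

@[simp] theorem extend_last (χ : Char d n) (a : Fin d) : extend χ a (Fin.last n) = a :=
  Fin.snoc_last (α := fun _ => Fin d) _ _

theorem extend_injective (a : Fin d) : Function.Injective fun χ : Char d n => extend χ a := by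
  intro χ ψ h
  funext j
  simpa using congrFun h j.castSucc

theorem compOf_extend (χ : Char d n) (a b : Fin d) :
    (compOf (extend χ a)).1 b = (compOf χ).1 b + if b = a then 1 else 0 := by
  rw [compOf_apply, compOf_apply, Finset.card_filter, Finset.card_filter, Fin.sum_univ_castSucc]
  simp [eq_comm]

theorem rank_extend (χ : Char d n) (a : Fin d) (j : Fin n) :
    rank (extend χ a) j.castSucc = rank χ j := by
  rw [rank, rank, Finset.card_filter, Finset.card_filter, Fin.sum_univ_castSucc,
    if_neg fun h => (Fin.castSucc_lt_last j).not_gt h.1, add_zero]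
  simp only [Fin.castSucc_lt_castSucc_iff, extend_castSucc]

theorem rank_last (χ : Char d (n + 1)) :
    (compOf χ).1 (χ (Fin.last n)) = rank χ (Fin.last n) + 1 := by
  rw [compOf_apply, rank, Finset.card_filter, Finset.card_filter, Fin.sum_univ_castSucc,
    Fin.sum_univ_castSucc]
  simp

theorem act_up_extend (i : Gen n) (χ : Char d n) (a : Fin d) :
    act (simpleRefl i.up) (extend χ a) = extend (act (simpleRefl i) χ) a := by
  funext p
  rw [act_simpleRefl]
  refine Fin.lastCases ?_ (fun p => ?_) p
  · have hi := i.2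
    rw [simpleRefl_of_ne, extend_last, extend_last]
    · simp only [Gen.lo, Gen.up, ne_eq, Fin.ext_iff, Fin.val_last]; omega
    · simp only [Gen.hi, Gen.up, ne_eq, Fin.ext_iff, Fin.val_last]; omega
  · rw [extend_castSucc, act_simpleRefl]
    have hlo : i.up.lo = i.lo.castSucc := rfl
    have hhi : i.up.hi = i.hi.castSucc := rfl
    by_cases h1 : p = i.lo
    · rw [h1, simpleRefl_lo, ← hlo, simpleRefl_lo, hhi, extend_castSucc]
    · by_cases h2 : p = i.hi
      · rw [h2, simpleRefl_hi, ← hhi, simpleRefl_hi, hlo, extend_castSucc]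
      · rw [simpleRefl_of_ne h1 h2, simpleRefl_of_ne, extend_castSucc]
        · rw [hlo]; exact fun e => h1 (Fin.castSucc_injective _ e)
        · rw [hhi]; exact fun e => h2 (Fin.castSucc_injective _ e)

variable {μ : Comp d n} {μ' : Comp d (n + 1)} {a : Fin d}

theorem inclTensor_coef (h : ∀ b, μ.1 b ≤ μ'.1 b) (i : Gen n) (χ : Orbit μ) :
    inclTensor h (coef μ.1 i χ.1) = coef μ'.1 i.up (extend χ.1 a) := by
  have hlo : extend χ.1 a i.up.lo = χ.1 i.lo := extend_castSucc _ _ i.lo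
  have hhi : extend χ.1 a i.up.hi = χ.1 i.hi := extend_castSucc _ _ i.hi
  by_cases hχ : χ.1 i.lo = χ.1 i.hi
  · rw [coef_of_eq hχ, coef_of_eq (by rw [hlo, hhi, hχ]), hlo, inclTensor_tgen]
    · congr 1
      exact (rank_extend χ.1 a i.lo).symm
    · have h1 := rank_lt_compOf χ.1 i.hi
      rwa [rank_hi hχ, χ.2, ← hχ] at h1
  · rw [coef_of_ne hχ, coef_of_ne (by rwa [hlo, hhi]), AlgHom.commutes]

variable (hμ : ∀ b, μ'.1 b = μ.1 b + if b = a then 1 else 0)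
include hμ

/-- Extension of the characters of an orbit by the value `ξ_a` on the new letter. -/
def Orbit.extend (χ : Orbit μ) : Orbit μ' :=
  ⟨YH.extend χ.1 a, Subtype.ext (funext fun b => by rw [compOf_extend, χ.2, hμ])⟩

theorem Orbit.le_of_extend (b : Fin d) : μ.1 b ≤ μ'.1 b := by rw [hμ]; exact Nat.le_add_right _ _

/-- The matrix of the inclusion of the characters with value `ξ_a` on the last letter. -/
def extendMatrix : Matrix (Orbit μ) (Orbit μ') (HeckeTensor μ') :=
  fun χ ω => if ω = Orbit.extend hμ χ then 1 else 0

theorem extendMatrix_mul_apply (B : Matrix (Orbit μ') (Orbit μ') (HeckeTensor μ')) (χ : Orbit μ)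
    (ω : Orbit μ') : (extendMatrix hμ * B) χ ω = B (Orbit.extend hμ χ) ω := by
  rw [Matrix.mul_apply, Finset.sum_eq_single (Orbit.extend hμ χ)]
  · simp [extendMatrix]
  · intro z _ hz; simp [extendMatrix, hz]
  · simp

/-- On the characters with a fixed value on the last letter, the algebra on one strand less acts
through the inclusion of the smaller tensor product. -/
theorem extendMatrix_mul_repr (ξ : Fin d ≃ rootsOfUnity d ℂ) (x : Yoko d n) :
    extendMatrix hμ * repr ξ μ' (Yoko.incl d n x) =
      (inclTensor (Orbit.le_of_extend hμ)).mapMatrix (repr ξ μ x) * extendMatrix hμ := by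
  have hx : x ∈ Algebra.adjoin GroundRing
      (Set.range (Yoko.g : Gen n → Yoko d n) ∪ Set.range (Yoko.t : Fin n → Yoko d n)) :=
    Yoko.adjoin_generators ▸ Algebra.mem_top
  induction hx using Algebra.adjoin_induction with
  | mem x hx =>
    obtain ⟨i, rfl⟩ | ⟨j, rfl⟩ := hx
    · ext χ ω
      have hσ : Orbit.act (simpleRefl i.up) (Orbit.extend hμ χ) =
          Orbit.extend hμ (Orbit.act (simpleRefl i) χ) := Subtype.ext (act_up_extend i χ.1 a)
      rw [extendMatrix_mul_apply, Yoko.incl_g, repr_g, repr_g, reprG, monomial_apply, hσ,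
        Matrix.mul_apply, Finset.sum_eq_single (Orbit.act (simpleRefl i) χ)]
      · rw [AlgHom.mapMatrix_apply, Matrix.map_apply, reprG, monomial_apply, if_pos rfl,
          inclTensor_coef (a := a), extendMatrix, mul_ite, mul_one, mul_zero]
        rfl
      · intro ψ _ hψ
        rw [AlgHom.mapMatrix_apply, Matrix.map_apply, reprG, monomial_apply, if_neg hψ, map_zero,
          zero_mul]
      · simp
    · ext χ ω
      rw [extendMatrix_mul_apply, Yoko.incl_t, repr_t, repr_t, reprT, reprT, scalarDiagonal_apply,
        scalarDiagonal_apply, Matrix.mul_apply, Finset.sum_eq_single χ]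
      · rw [AlgHom.mapMatrix_apply, Matrix.map_apply, Matrix.diagonal_apply_eq, AlgHom.commutes,
          Matrix.diagonal_apply, extendMatrix, mul_ite, mul_one, mul_zero]
        have h : (Orbit.extend hμ χ).1 j.castSucc = χ.1 j := extend_castSucc _ _ _
        rw [h]
        simp only [eq_comm]
      · intro ψ _ hψ
        rw [AlgHom.mapMatrix_apply, Matrix.map_apply, Matrix.diagonal_apply_ne _ (Ne.symm hψ),
          map_zero, zero_mul]
      · simp
  | algebraMap r =>
    rw [AlgHom.commutes, AlgHom.commutes, AlgHom.commutes, AlgHom.commutes,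
      Algebra.algebraMap_eq_smul_one, Algebra.algebraMap_eq_smul_one, Matrix.mul_smul,
      Matrix.smul_mul, Matrix.mul_one, Matrix.one_mul]
  | add x y _ _ hx hy => simp only [map_add, Matrix.mul_add, Matrix.add_mul, hx, hy]
  | mul x y _ _ hx hy =>
    rw [map_mul, map_mul, map_mul, map_mul, ← Matrix.mul_assoc, hx, Matrix.mul_assoc, hy,
      Matrix.mul_assoc]

theorem repr_incl_extend (ξ : Fin d ≃ rootsOfUnity d ℂ) (x : Yoko d n) (χ ψ : Orbit μ) :
    repr ξ μ' (Yoko.incl d n x) (Orbit.extend hμ χ) (Orbit.extend hμ ψ) =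
      inclTensor (Orbit.le_of_extend hμ) (repr ξ μ x χ ψ) := by
  refine (extendMatrix_mul_apply hμ _ χ _).symm.trans ?_
  rw [extendMatrix_mul_repr, Matrix.mul_apply, Finset.sum_eq_single ψ]
  · simp [extendMatrix]
  · intro ω _ hω
    have : Orbit.extend hμ ψ ≠ Orbit.extend hμ ω := fun e =>
      hω (Subtype.ext (extend_injective a (congrArg Subtype.val e))).symm
    simp [extendMatrix, this]
  · simp

theorem repr_incl_extend_of_ne (ξ : Fin d ≃ rootsOfUnity d ℂ) (x : Yoko d n) (χ : Orbit μ)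
    {ω : Orbit μ'} (hω : ω.1 (Fin.last n) ≠ a) :
    repr ξ μ' (Yoko.incl d n x) (Orbit.extend hμ χ) ω = 0 := by
  refine (extendMatrix_mul_apply hμ _ χ _).symm.trans ?_
  rw [extendMatrix_mul_repr, Matrix.mul_apply]
  refine Finset.sum_eq_zero fun ψ _ => ?_
  have : ω ≠ Orbit.extend hμ ψ := by
    rintro rfl
    exact hω (extend_last _ _)
  simp [extendMatrix, this]

end Restriction

/-! ### The Markov property of the block traces -/

section Markov

variable {d : ℕ} (ξ : Fin d ≃ rootsOfUnity d ℂ)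

theorem tensorTrace_trace_mul_comm {n : ℕ} (μ : Comp d n)
    (A B : Matrix (Orbit μ) (Orbit μ) (HeckeTensor μ)) :
    tensorTrace μ (A * B).trace = tensorTrace μ (B * A).trace := by
  simp only [Matrix.trace, Matrix.diag, Matrix.mul_apply, map_sum]
  rw [Finset.sum_comm]
  exact Finset.sum_congr rfl fun χ _ => Finset.sum_congr rfl fun ψ _ => tensorTrace_mul_comm μ _ _

/-- The contribution of a single character to the block trace. -/
def diagTrace {n : ℕ} (χ : Char d n) (x : Yoko d n) : GroundRing :=
  tensorTrace (compOf χ) (repr ξ (compOf χ) x ⟨χ, rfl⟩ ⟨χ, rfl⟩)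

theorem blockTrace_eq_sum {n : ℕ} (hd : 1 ≤ d) (μ : Comp d n) (x : Yoko d n) :
    blockTrace ξ μ x = ∑ χ : Orbit μ, diagTrace ξ χ.1 x := by
  rw [blockTrace_eq ξ μ hd, Matrix.trace, map_sum]
  refine Finset.sum_congr rfl fun χ _ => ?_
  obtain ⟨χ, rfl⟩ := χ
  rfl

theorem sum_mul_blockTrace {n : ℕ} (hd : 1 ≤ d) (f : Comp d n → GroundRing) (x : Yoko d n) :
    ∑ μ, f μ * blockTrace ξ μ x = ∑ χ : Char d n, f (compOf χ) * diagTrace ξ χ x := by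
  rw [← (Equiv.sigmaFiberEquiv (compOf : Char d n → Comp d n)).sum_comp, Fintype.sum_sigma]
  refine Finset.sum_congr rfl fun μ _ => ?_
  rw [blockTrace_eq_sum ξ hd, Finset.mul_sum]
  refine Finset.sum_congr rfl fun χ _ => ?_
  change _ = f (compOf χ.1) * diagTrace ξ χ.1 x
  rw [χ.2]

variable {n : ℕ} (χ : Char d (n + 1)) (a : Fin d) (x : Yoko d (n + 1))

theorem act_last_extend_of_eq (h : χ (Fin.last n) = a) :
    act (simpleRefl (Gen.last n)) (extend χ a) = extend χ a :=
  act_simpleRefl_of_eq ((extend_castSucc χ a (Fin.last n)).trans (h.trans (extend_last χ a).symm))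

/-- The Markov property, character by character: only the extension by the value of `χ` on its last
letter contributes. -/
theorem diagTrace_extend_g : diagTrace ξ (extend χ a)
    (Yoko.incl d (n + 1) x * Yoko.g (Gen.last n)) =
      if χ (Fin.last n) = a then diagTrace ξ χ x else 0 := by
  have hμ := compOf_extend χ a
  let χ₀ : Orbit (compOf χ) := ⟨χ, rfl⟩
  let χ₁ : Orbit (compOf (extend χ a)) := ⟨extend χ a, rfl⟩
  let σ : Orbit (compOf (extend χ a)) → Orbit (compOf (extend χ a)) :=
    Orbit.act (simpleRefl (Gen.last n))
  have hχ : Orbit.extend hμ χ₀ = χ₁ := rfl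
  have hσσ : ∀ ω, σ (σ ω) = ω := fun ω => Subtype.ext (act_simpleRefl_act _ _)
  have hlo : extend χ a (Gen.last n).lo = χ (Fin.last n) := extend_castSucc χ a (Fin.last n)
  have hhi : extend χ a (Gen.last n).hi = a := extend_last χ a
  have hentry : repr ξ _ (Yoko.incl d (n + 1) x * Yoko.g (Gen.last n)) χ₁ χ₁ =
      repr ξ _ (Yoko.incl d (n + 1) x) χ₁ (σ χ₁) *
        coef (compOf (extend χ a)).1 (Gen.last n) (σ χ₁).1 := by
    rw [map_mul, repr_g, reprG, Matrix.mul_apply, Finset.sum_eq_single (σ χ₁)]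
    · rw [monomial_apply, if_pos (hσσ χ₁).symm]
    · intro ω _ hω
      rw [monomial_apply, if_neg, mul_zero]
      intro e
      exact hω ((hσσ ω).symm.trans (congrArg σ e.symm))
    · simp
  change tensorTrace _ (repr ξ _ _ χ₁ χ₁) = _
  rw [hentry]
  split_ifs with h
  · have hσ : σ χ₁ = χ₁ := Subtype.ext (act_last_extend_of_eq χ a h)
    have hrank : rank (extend χ a) (Gen.last n).lo = rank χ (Fin.last n) :=
      rank_extend χ a (Fin.last n)
    rw [hσ, ← hχ, repr_incl_extend, hχ, coef_of_eq (hlo.trans (h.trans hhi.symm)), hlo, hrank, h]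
    refine tensorTrace_inclTensor_mul_tgen _ ?_ ?_ ?_ _
    · rw [← rank_last, h]
    · rw [hμ, if_pos rfl]
    · intro b hb; rw [hμ, if_neg hb, add_zero]
  · rw [← hχ, repr_incl_extend_of_ne, zero_mul, map_zero]
    change act _ (extend χ a) (Gen.last n).hi ≠ a
    rw [act_simpleRefl, simpleRefl_hi, hlo]
    exact h

theorem v_mul_diagTrace_extend_e : v * diagTrace ξ (extend χ a)
    (Yoko.incl d (n + 1) x * Yoko.e (Gen.last n)) =
      if χ (Fin.last n) = a then (1 - (u : GroundRing) ^ 2) * diagTrace ξ χ x else 0 := by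
  have hμ := compOf_extend χ a
  let χ₀ : Orbit (compOf χ) := ⟨χ, rfl⟩
  let χ₁ : Orbit (compOf (extend χ a)) := ⟨extend χ a, rfl⟩
  have hχ : Orbit.extend hμ χ₀ = χ₁ := rfl
  have hlo : extend χ a (Gen.last n).lo = χ (Fin.last n) := extend_castSucc χ a (Fin.last n)
  have hhi : extend χ a (Gen.last n).hi = a := extend_last χ a
  have hentry : repr ξ _ (Yoko.incl d (n + 1) x * Yoko.e (Gen.last n)) χ₁ χ₁ =
      if χ (Fin.last n) = a then inclTensor (Orbit.le_of_extend hμ) (repr ξ _ x χ₀ χ₀) else 0 := by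
    rw [map_mul, repr_e, scalarDiagonal_apply, Matrix.mul_diagonal]
    change _ * algebraMap _ _ (if extend χ a _ = extend χ a _ then 1 else 0) = _
    rw [hlo, hhi]
    split_ifs
    · rw [map_one, mul_one, ← hχ, repr_incl_extend]
    · rw [map_zero, mul_zero]
  change v * tensorTrace _ (repr ξ _ _ χ₁ χ₁) = _
  rw [hentry]
  split_ifs with h
  · refine v_mul_tensorTrace_inclTensor (k := rank χ (Fin.last n)) (a := a) _ ?_ ?_ ?_ _
    · rw [← rank_last, h]
    · rw [hμ, if_pos rfl]
    · intro b hb; rw [hμ, if_neg hb, add_zero]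
  · rw [map_zero, mul_zero]

theorem diagTrace_linear {n : ℕ} (χ : Char d n) (r s : GroundRing) (x y : Yoko d n) :
    diagTrace ξ χ (r • (x - s • y)) = r * (diagTrace ξ χ x - s * diagTrace ξ χ y) := by
  simp only [diagTrace, map_smul, map_sub, Matrix.smul_apply, Matrix.sub_apply, smul_eq_mul]

theorem diagTrace_extend_g_inv : diagTrace ξ (extend χ a)
    (Yoko.incl d (n + 1) x * (Yoko.gUnit (Gen.last n))⁻¹.val) =
      if χ (Fin.last n) = a then diagTrace ξ χ x else 0 := by
  have h : Yoko.incl d (n + 1) x * (Yoko.gUnit (Gen.last n))⁻¹.val =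
      (((u⁻¹ : GroundRingˣ) : GroundRing) ^ 2) • (Yoko.incl d (n + 1) x * Yoko.g (Gen.last n) -
        v • (Yoko.incl d (n + 1) x * Yoko.e (Gen.last n))) := by
    rw [← mul_smul_comm, ← mul_sub, ← mul_smul_comm]
    rfl
  rw [h, diagTrace_linear, diagTrace_extend_g, v_mul_diagTrace_extend_e]
  split_ifs
  · have := Hecke.u_inv_sq_mul
    linear_combination diagTrace ξ χ x * this
  · simp

theorem base_compOf_extend (h : χ (Fin.last n) = a) :
    base (compOf (extend χ a)) = base (compOf χ) := by
  refine Subtype.ext (funext fun b => ?_)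
  change (if 1 ≤ (compOf (extend χ a)).1 b then 1 else 0) = if 1 ≤ (compOf χ).1 b then 1 else 0
  rw [compOf_extend]
  by_cases hb : b = a
  · have := rank_last χ
    rw [h, ← hb] at this
    rw [if_pos (by omega), if_pos (by omega)]
  · simp [hb]

/-- The trace with parameters `α` as a family of linear maps. -/
def comboTrace (α : Comp0 d → GroundRing) (n : ℕ) : Yoko d (n + 1) →ₗ[GroundRing] GroundRing :=
  ∑ μ : Comp d (n + 1), α (base μ) •
    (tensorTrace μ ∘ₗ Matrix.traceLinearMap _ GroundRing _ ∘ₗ (repr ξ μ).toLinearMap)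

theorem comboTrace_apply (hd : 1 ≤ d) (α : Comp0 d → GroundRing) (n : ℕ) (x : Yoko d (n + 1)) :
    comboTrace ξ α n x = ∑ μ, α (base μ) * blockTrace ξ μ x := by
  rw [comboTrace, LinearMap.sum_apply]
  exact Finset.sum_congr rfl fun μ _ => by rw [blockTrace_eq ξ μ hd]; rfl

theorem sum_extend {M : Type*} [AddCommMonoid M] (f : Char d (n + 1) → M) :
    ∑ ω, f ω = ∑ χ : Char d n, ∑ a, f (extend χ a) := by
  rw [← (Fin.snocEquiv fun _ : Fin (n + 1) => Fin d).sum_comp, Fintype.sum_prod_type,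
    Finset.sum_comm]
  rfl

theorem isMarkovTrace_comboTrace (hd : 1 ≤ d) (α : Comp0 d → GroundRing) :
    IsMarkovTrace d (comboTrace ξ α) := by
  have key : ∀ (n : ℕ) (x : Yoko d (n + 1)) (z : Yoko d (n + 2)),
      (∀ χ a, diagTrace ξ (extend χ a) z =
        if χ (Fin.last n) = a then diagTrace ξ χ x else 0) →
      comboTrace ξ α (n + 1) z = comboTrace ξ α n x := by
    intro n x z hz
    rw [comboTrace_apply ξ hd, comboTrace_apply ξ hd,
      sum_mul_blockTrace ξ hd (fun μ => α (base μ)), sum_mul_blockTrace ξ hd (fun μ => α (base μ)),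
      sum_extend]
    refine Finset.sum_congr rfl fun χ _ => ?_
    rw [Finset.sum_eq_single (χ (Fin.last n))]
    · rw [hz, if_pos rfl, base_compOf_extend χ _ rfl]
    · intro a _ ha; rw [hz, if_neg (Ne.symm ha), mul_zero]
    · simp
  refine ⟨fun n x y => ?_, fun n x => ?_, fun n x => ?_⟩
  · rw [comboTrace_apply ξ hd, comboTrace_apply ξ hd]
    refine Finset.sum_congr rfl fun μ _ => ?_
    rw [blockTrace_eq ξ μ hd, blockTrace_eq ξ μ hd, map_mul, tensorTrace_trace_mul_comm, map_mul]
  · exact key n x _ fun χ a => diagTrace_extend_g ξ χ a x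
  · exact key n x _ fun χ a => diagTrace_extend_g_inv ξ χ a x

end Markov

/-! ### The bimodule decomposition of the Yokonuma--Hecke algebra -/

section Decomposition

variable {d n : ℕ} (ξ : Fin d ≃ rootsOfUnity d ℂ)

theorem commute_of_generators {A : Type*} [Ring A] [Algebra GroundRing A]
    (f : Yoko d n →ₐ[GroundRing] A) {z : A} (hg : ∀ i, Commute (f (Yoko.g i)) z)
    (ht : ∀ j, Commute (f (Yoko.t j)) z) (x : Yoko d n) : Commute (f x) z := by
  have hx : x ∈ Algebra.adjoin GroundRing
      (Set.range (Yoko.g : Gen n → Yoko d n) ∪ Set.range (Yoko.t : Fin n → Yoko d n)) :=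
    Yoko.adjoin_generators ▸ Algebra.mem_top
  induction hx using Algebra.adjoin_induction with
  | mem y hy =>
    obtain ⟨i, rfl⟩ | ⟨j, rfl⟩ := hy
    · exact hg i
    · exact ht j
  | algebraMap r => rw [AlgHom.commutes]; exact Algebra.commutes _ _
  | add y z _ _ hy hz => rw [map_add]; exact hy.add_left hz
  | mul y z _ _ hy hz => rw [map_mul]; exact hy.mul_left hz

theorem Echi_mul_proj (χ : Char d n) (a : Fin d) (j : Fin n) :
    Echi ξ χ * proj ξ a j = if χ j = a then Echi ξ χ else 0 := by
  have h : torusProj ξ (χ j) j * torusProj ξ a j = if χ j = a then torusProj ξ (χ j) j else 0 := by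
    apply Subtype.ext
    change (torus d n).val (torusProj ξ (χ j) j * torusProj ξ a j) =
      (torus d n).val (if χ j = a then torusProj ξ (χ j) j else 0)
    rw [map_mul, val_torusProj, val_torusProj, proj_mul_proj, apply_ite (torus d n).val, map_zero,
      val_torusProj]
    split_ifs with h
    · rw [h]
    · rfl
  rw [Echi_eq, ← val_torusProj, ← map_mul, ← Finset.mul_prod_erase _ _ (Finset.mem_univ j),
    mul_right_comm, h, ite_mul, zero_mul, apply_ite (torus d n).val, map_zero]

theorem eq_of_Echi_mul_eq (hd : 1 ≤ d) {x y : Yoko d n}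
    (h : ∀ χ, Echi ξ χ * x = Echi ξ χ * y) : x = y := by
  rw [← one_mul x, ← one_mul y, ← sum_Echi ξ hd, Finset.sum_mul, Finset.sum_mul]
  exact Finset.sum_congr rfl fun χ _ => h χ

theorem proj_hi_mul_e (hd : 1 ≤ d) (i : Gen n) (a : Fin d) :
    proj ξ a i.hi * Yoko.e i = proj ξ a i.lo * proj ξ a i.hi := by
  refine eq_of_Echi_mul_eq ξ hd fun χ => ?_
  rw [← mul_assoc, ← mul_assoc, Echi_mul_proj, Echi_mul_proj, ite_mul, ite_mul, zero_mul, zero_mul,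
    Echi_mul_e, Echi_mul_proj]
  split_ifs <;> simp_all

theorem proj_lo_mul_e (hd : 1 ≤ d) (i : Gen n) (a : Fin d) :
    proj ξ a i.lo * Yoko.e i = proj ξ a i.lo * proj ξ a i.hi := by
  refine eq_of_Echi_mul_eq ξ hd fun χ => ?_
  rw [← mul_assoc, ← mul_assoc, Echi_mul_proj, ite_mul, ite_mul, zero_mul, zero_mul,
    Echi_mul_e, Echi_mul_proj]
  split_ifs <;> simp_all

theorem sum_proj (hd : 1 ≤ d) (j : Fin n) : ∑ a, (proj ξ a j : Yoko d n) = 1 :=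
  sum_avg_root ξ hd (Yoko.t_pow j)

theorem incl_proj (a : Fin d) (j : Fin n) :
    Yoko.incl d n (proj ξ a j) = proj ξ a j.castSucc := by
  rw [proj, avg_map, AlgHom.commutes, Yoko.incl_t]; rfl

theorem Echi_extend (χ : Char d n) (a : Fin d) :
    Echi ξ (extend χ a) = Yoko.incl d n (Echi ξ χ) * proj ξ a (Fin.last n) := by
  have h : Yoko.incl d n (Echi ξ χ) =
      (torus d (n + 1)).val (∏ i, torusProj ξ (χ i) (Fin.castSucc i)) := by
    rw [← noncommProd_proj ξ χ Fin.castSucc (fun _ _ _ _ _ => proj_commute ξ _ _ _ _)]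
    refine (Finset.map_noncommProd _ _ _ (Yoko.incl d n)).trans ?_
    exact Finset.noncommProd_congr rfl (fun i _ => incl_proj ξ _ _) _
  rw [h, Echi_eq, Fin.prod_univ_castSucc, map_mul, extend_last, val_torusProj]
  simp only [extend_castSucc]

theorem simpleRefl_up_last (i : Gen n) : simpleRefl i.up (Fin.last n) = Fin.last n := by
  have hi := i.2
  refine simpleRefl_of_ne ?_ ?_
  · simp only [Gen.lo, Gen.up, ne_eq, Fin.ext_iff, Fin.val_last]; omega
  · simp only [Gen.hi, Gen.up, ne_eq, Fin.ext_iff, Fin.val_last]; omega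

theorem incl_commute_proj_last (x : Yoko d n) (a : Fin d) :
    Commute (Yoko.incl d n x) (proj ξ a (Fin.last n)) := by
  refine commute_of_generators _ (fun i => ?_) (fun j => ?_) x
  · rw [Yoko.incl_g, Commute, SemiconjBy, g_mul_proj, simpleRefl_up_last]
  · rw [Yoko.incl_t]; exact (proj_commute_t ξ _ _ _).symm

theorem incl_commute_t_last (x : Yoko d n) : Commute (Yoko.incl d n x) (Yoko.t (Fin.last n)) := by
  refine commute_of_generators _ (fun i => ?_) (fun j => ?_) x
  · rw [Yoko.incl_g, Commute, SemiconjBy, Yoko.g_t, simpleRefl_up_last]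
  · rw [Yoko.incl_t]; exact Yoko.t_comm _ _

/-- The newest generator `g` of `Y_{d,n+3}` commutes with `Y_{d,n+1}`. -/
theorem incl_incl_commute_g_last (x : Yoko d (n + 1)) :
    Commute (Yoko.incl d (n + 2) (Yoko.incl d (n + 1) x)) (Yoko.g (Gen.last (n + 1))) := by
  refine commute_of_generators ((Yoko.incl d (n + 2)).comp (Yoko.incl d (n + 1)))
    (fun i => ?_) (fun j => ?_) x
  · rw [AlgHom.comp_apply, Yoko.incl_g, Yoko.incl_g]
    exact Yoko.g_comm _ _ (Or.inl (by have := i.2; change i.1 + 1 < n + 1; omega))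
  · rw [AlgHom.comp_apply, Yoko.incl_t, Yoko.incl_t, Commute, SemiconjBy, Yoko.g_t,
      simpleRefl_of_ne]
    · have := j.2
      simp only [Gen.lo, Gen.last, ne_eq, Fin.ext_iff, Fin.val_castSucc]; omega
    · have := j.2
      simp only [Gen.hi, Gen.last, ne_eq, Fin.ext_iff, Fin.val_castSucc]; omega

theorem g_last_braid : (Yoko.g (Gen.last (n + 1)) * Yoko.incl d (n + 2) (Yoko.g (Gen.last n)) *
    Yoko.g (Gen.last (n + 1)) : Yoko d (n + 3)) =
      Yoko.incl d (n + 2) (Yoko.g (Gen.last n)) * Yoko.g (Gen.last (n + 1)) *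
        Yoko.incl d (n + 2) (Yoko.g (Gen.last n)) := by
  rw [Yoko.incl_g]
  exact (Yoko.g_braid _ _ rfl).symm

/-- Moving a projection on the last letter through the newest generator. -/
theorem proj_last_mul_g_last (a : Fin d) :
    proj ξ a (Fin.last (n + 1)) * Yoko.g (Gen.last n) =
      Yoko.g (Gen.last n) * Yoko.incl d (n + 1) (proj ξ a (Fin.last n)) := by
  rw [incl_proj, g_mul_proj]
  congr 2
  exact (simpleRefl_lo (Gen.last n)).symm

/-- The span of `Y g Y` and of the `Y p_a`, where `Y = Y_{d,n+1}`, `g` is the newest generator of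
`Y_{d,n+2}` and `p_a` is the projection that forces the value `ξ_a` on the last letter. -/
def decomposition (n : ℕ) : Submodule GroundRing (Yoko d (n + 2)) :=
  Submodule.span GroundRing
    ((Set.range fun p : Yoko d (n + 1) × Fin d =>
        Yoko.incl d (n + 1) p.1 * proj ξ p.2 (Fin.last (n + 1))) ∪
      Set.range fun p : Yoko d (n + 1) × Yoko d (n + 1) =>
        Yoko.incl d (n + 1) p.1 * Yoko.g (Gen.last n) * Yoko.incl d (n + 1) p.2)

theorem mem_decomposition_proj (x : Yoko d (n + 1)) (a : Fin d) :
    Yoko.incl d (n + 1) x * proj ξ a (Fin.last (n + 1)) ∈ decomposition ξ n :=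
  Submodule.subset_span (Or.inl ⟨(x, a), rfl⟩)

theorem mem_decomposition_g (x y : Yoko d (n + 1)) :
    Yoko.incl d (n + 1) x * Yoko.g (Gen.last n) * Yoko.incl d (n + 1) y ∈ decomposition ξ n :=
  Submodule.subset_span (Or.inr ⟨(x, y), rfl⟩)

theorem mul_g_mul_proj_mul_g_mem (hd : 1 ≤ d) (x c : Yoko d (n + 1)) (a : Fin d)
    (hc : Commute (Yoko.incl d (n + 1) c) (Yoko.g (Gen.last n))) :
    Yoko.incl d (n + 1) x * Yoko.g (Gen.last n) *
      Yoko.incl d (n + 1) (c * proj ξ a (Fin.last n)) * Yoko.g (Gen.last n) ∈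
        decomposition ξ n := by
  have h1 : Yoko.incl d (n + 1) x * Yoko.g (Gen.last n) *
      Yoko.incl d (n + 1) (c * proj ξ a (Fin.last n)) * Yoko.g (Gen.last n) =
      Yoko.incl d (n + 1) (x * c) * (proj ξ a (Fin.last (n + 1)) *
        (Yoko.g (Gen.last n) * Yoko.g (Gen.last n))) := by
    rw [← mul_assoc (proj ξ a _), proj_last_mul_g_last, map_mul, map_mul]
    simp only [mul_assoc]
    rw [← mul_assoc (Yoko.g (Gen.last n)) (Yoko.incl d (n + 1) c), ← hc.eq, mul_assoc]
  have h2 : proj ξ a (Fin.last (n + 1)) * (Yoko.g (Gen.last n) * Yoko.g (Gen.last n)) =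
      ((u : GroundRing) ^ 2) • proj ξ a (Fin.last (n + 1)) +
        v • (Yoko.incl d (n + 1) (proj ξ a (Fin.last n)) * Yoko.g (Gen.last n) *
          Yoko.incl d (n + 1) (proj ξ a (Fin.last n))) := by
    have h3 : proj ξ a (Fin.last (n + 1)) * Yoko.e (Gen.last n) =
        Yoko.incl d (n + 1) (proj ξ a (Fin.last n)) * proj ξ a (Fin.last (n + 1)) := by
      rw [incl_proj]; exact proj_hi_mul_e ξ hd (Gen.last n) a
    rw [Yoko.g_sq, mul_add, ← Algebra.commutes, ← Algebra.smul_def, mul_smul_comm, ← mul_assoc, h3,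
      mul_assoc, proj_last_mul_g_last, mul_assoc]
  rw [h1, h2, mul_add, mul_smul_comm, mul_smul_comm, ← mul_assoc, ← mul_assoc, ← map_mul]
  exact add_mem (Submodule.smul_mem _ _ (mem_decomposition_proj ξ _ _))
    (Submodule.smul_mem _ _ (mem_decomposition_g ξ _ _))

theorem one_mem_decomposition (hd : 1 ≤ d) : 1 ∈ decomposition ξ n := by
  rw [← sum_proj ξ hd (Fin.last (n + 1))]
  exact Submodule.sum_mem _ fun a _ => by
    simpa using mem_decomposition_proj ξ (1 : Yoko d (n + 1)) a

/-- For the decomposition of `Y_{d,n+2}` it is enough to bring the elements of `Y g Y g` in the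
required form. -/
theorem decomposition_eq_top_of (hd : 1 ≤ d)
    (h : ∀ x y : Yoko d (n + 1), Yoko.incl d (n + 1) x * Yoko.g (Gen.last n) *
      Yoko.incl d (n + 1) y * Yoko.g (Gen.last n) ∈ decomposition ξ n) :
    decomposition ξ n = ⊤ := by
  refine eq_top_of_mul_mem Yoko.adjoin_generators (one_mem_decomposition ξ hd) ?_
  rintro _ (⟨i, rfl⟩ | ⟨j, rfl⟩)
  · refine mul_mem_of_span ?_
    obtain ⟨i, rfl⟩ | rfl := Gen.eq_up_or_last i
    · rw [← Yoko.incl_g]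
      rintro _ (⟨⟨x, a⟩, rfl⟩ | ⟨⟨x, y⟩, rfl⟩)
      · dsimp only
        rw [mul_assoc, ← (incl_commute_proj_last ξ _ a).eq, ← mul_assoc, ← map_mul]
        exact mem_decomposition_proj ξ _ _
      · dsimp only
        rw [mul_assoc, ← map_mul]
        exact mem_decomposition_g ξ _ _
    · rintro _ (⟨⟨x, a⟩, rfl⟩ | ⟨⟨x, y⟩, rfl⟩)
      · dsimp only
        rw [mul_assoc, proj_last_mul_g_last, ← mul_assoc]
        exact mem_decomposition_g ξ _ _
      · exact h x y
  · refine mul_mem_of_span ?_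
    refine Fin.lastCases ?_ (fun j => ?_) j
    · rintro _ (⟨⟨x, a⟩, rfl⟩ | ⟨⟨x, y⟩, rfl⟩)
      · dsimp only
        rw [mul_assoc, (proj_commute_t ξ a _ _).eq, t_mul_proj, mul_smul_comm]
        exact Submodule.smul_mem _ _ (mem_decomposition_proj ξ _ _)
      · dsimp only
        have h1 : (Yoko.g (Gen.last n) * Yoko.t (Fin.last (n + 1)) : Yoko d (n + 2)) =
            Yoko.incl d (n + 1) (Yoko.t (Fin.last n)) * Yoko.g (Gen.last n) := by
          rw [Yoko.g_t, Yoko.incl_t]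
          congr 2
          exact simpleRefl_hi (Gen.last n)
        rw [mul_assoc, (incl_commute_t_last y).eq, mul_assoc, ← mul_assoc (Yoko.g _), h1,
          mul_assoc, ← mul_assoc, ← mul_assoc, ← map_mul]
        exact mem_decomposition_g ξ _ _
    · rw [← Yoko.incl_t]
      rintro _ (⟨⟨x, a⟩, rfl⟩ | ⟨⟨x, y⟩, rfl⟩)
      · dsimp only
        rw [mul_assoc, ← (incl_commute_proj_last ξ _ a).eq, ← mul_assoc, ← map_mul]
        exact mem_decomposition_proj ξ _ _
      · dsimp only
        rw [mul_assoc, ← map_mul]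
        exact mem_decomposition_g ξ _ _

theorem span_proj_eq_top (hd : 1 ≤ d) : Submodule.span GroundRing
    (Set.range fun a : Fin d => (proj ξ a (Fin.last 0) : Yoko d 1)) = ⊤ := by
  rw [eq_top_iff, ← span_Echi_mul_gtilde ξ hd, Submodule.span_le]
  rintro _ ⟨⟨χ, w⟩, rfl⟩
  obtain rfl : w = 1 := Subsingleton.elim _ _
  refine Submodule.subset_span ⟨χ 0, ?_⟩
  dsimp only
  rw [Yoko.gtilde_one, mul_one, Echi_eq, Fin.prod_univ_one, val_torusProj]
  rfl

/-- `Y_{d,n+2} = ∑_a Y_{d,n+1} p_a + Y_{d,n+1} g Y_{d,n+1}`, where `g` is the newest generator and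
`p_a` is the projection that forces the value `ξ_a` on the last letter. -/
theorem decomposition_eq_top (hd : 1 ≤ d) (n : ℕ) :
    decomposition ξ n = (⊤ : Submodule GroundRing (Yoko d (n + 2))) := by
  induction n with
  | zero =>
    refine decomposition_eq_top_of ξ hd fun x y => ?_
    have hy : y ∈ Submodule.span GroundRing _ := span_proj_eq_top ξ hd ▸ Submodule.mem_top
    induction hy using Submodule.span_induction with
    | mem y hy =>
      obtain ⟨a, rfl⟩ := hy
      simpa using mul_g_mul_proj_mul_g_mem ξ hd x 1 a (by rw [map_one]; exact Commute.one_left _)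
    | zero => simp
    | add b c _ _ hb hc => rw [map_add, mul_add, add_mul]; exact add_mem hb hc
    | smul r b _ hb =>
      rw [map_smul, mul_smul_comm, smul_mul_assoc]; exact Submodule.smul_mem _ _ hb
  | succ n ih =>
    refine decomposition_eq_top_of ξ hd fun x y => ?_
    have hy : y ∈ decomposition ξ n := ih ▸ Submodule.mem_top
    rw [decomposition] at hy
    induction hy using Submodule.span_induction with
    | mem y hy =>
      obtain ⟨⟨c, a⟩, rfl⟩ | ⟨⟨c, e⟩, rfl⟩ := hy
      · exact mul_g_mul_proj_mul_g_mem ξ hd x _ a (incl_incl_commute_g_last c)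
      · dsimp only
        have h := mem_decomposition_g ξ (x * (Yoko.incl d (n + 1) c * Yoko.g (Gen.last n)))
          (Yoko.g (Gen.last n) * Yoko.incl d (n + 1) e)
        have h1 := mul_mul_mul_of_braid (incl_incl_commute_g_last c).eq
          (incl_incl_commute_g_last e).eq g_last_braid
        simp only [map_mul, mul_assoc] at h h1 ⊢
        rw [h1]
        exact h
    | zero => simp
    | add b c _ _ hb hc => rw [map_add, mul_add, add_mul]; exact add_mem hb hc
    | smul r b _ hb =>
      rw [map_smul, mul_smul_comm, smul_mul_assoc]; exact Submodule.smul_mem _ _ hb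

end Decomposition

/-! ### Markov traces are determined by their values on the `E_χ` with `χ` injective -/

section Uniqueness

variable {d : ℕ} (ξ : Fin d ≃ rootsOfUnity d ℂ)

theorem isUnit_gtilde {n : ℕ} (w : Equiv.Perm (Fin n)) :
    IsUnit (Yoko.gtilde w : Yoko d n) := by
  induction w using perm_induction with
  | one => rw [Yoko.gtilde_one]; exact isUnit_one
  | step w i h ih =>
    rw [Yoko.gtilde_mul h, Algebra.smul_def]
    exact (u⁻¹.isUnit.map _).mul (ih.mul (Yoko.gUnit i).isUnit)

variable {ρ : ∀ n : ℕ, Yoko d (n + 1) →ₗ[GroundRing] GroundRing} (hρ : IsMarkovTrace d ρ)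
include hρ

theorem IsMarkovTrace.v_mul_incl_mul_e (n : ℕ) (x : Yoko d (n + 1)) :
    v * ρ (n + 1) (Yoko.incl d (n + 1) x * Yoko.e (Gen.last n)) =
      (1 - (u : GroundRing) ^ 2) * ρ n x := by
  have h : v • (Yoko.e (Gen.last n) : Yoko d (n + 2)) = (Yoko.gUnit (Gen.last n)).val -
      ((u : GroundRing) ^ 2) • (Yoko.gUnit (Gen.last n))⁻¹.val := by
    change _ = Yoko.g _ - ((u : GroundRing) ^ 2) • (((u⁻¹ : GroundRingˣ) : GroundRing) ^ 2) •
      (Yoko.g _ - v • Yoko.e _)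
    rw [smul_smul, mul_comm, Hecke.u_inv_sq_mul, one_smul, sub_sub_cancel]
  have h1 := congrArg (ρ (n + 1)) (congrArg (Yoko.incl d (n + 1) x * ·) h)
  simp only [mul_sub, mul_smul_comm, map_sub, map_smul, hρ.markov, hρ.markov_inv,
    smul_eq_mul] at h1
  rw [h1]; ring

theorem IsMarkovTrace.incl_mul_g_mul_incl (n : ℕ) (x y : Yoko d (n + 1)) :
    ρ (n + 1) (Yoko.incl d (n + 1) x * Yoko.g (Gen.last n) * Yoko.incl d (n + 1) y) =
      ρ n (y * x) := by
  rw [hρ.trace, ← mul_assoc, ← map_mul]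
  exact hρ.markov n _

/-- Conjugation by `g̃_w` permutes the idempotents `E_χ`. -/
theorem IsMarkovTrace.exists_Echi_act (n : ℕ) (w : Equiv.Perm (Fin (n + 1))) (χ : Char d (n + 1))
    (x : Yoko d (n + 1)) : ∃ y, ρ n (Echi ξ χ * x) = ρ n (Echi ξ (act w χ) * y) := by
  obtain ⟨W, hW⟩ := isUnit_gtilde (d := d) w
  refine ⟨W * x * W⁻¹.val, ?_⟩
  have h := gtilde_mul_Echi ξ w χ
  rw [← hW] at h
  have h1 : Echi ξ (act w χ) * (W * x * W⁻¹.val) = W.val * (Echi ξ χ * x) * W⁻¹.val := by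
    simp only [← mul_assoc, h]
  rw [h1, hρ.trace n (W.val * _), Units.inv_mul_cancel_left]

theorem IsMarkovTrace.Echi_act (n : ℕ) (w : Equiv.Perm (Fin (n + 1))) (χ : Char d (n + 1)) :
    ρ n (Echi ξ (act w χ)) = ρ n (Echi ξ χ) := by
  obtain ⟨W, hW⟩ := isUnit_gtilde (d := d) w
  have h := gtilde_mul_Echi ξ w χ
  rw [← hW] at h
  have h1 : Echi ξ (act w χ) = W.val * Echi ξ χ * W⁻¹.val := by rw [h, Units.mul_inv_cancel_right]
  rw [h1, hρ.trace, Units.inv_mul_cancel_left]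

theorem IsMarkovTrace.Echi_extend_mul_eq_zero (hd : 1 ≤ d) {n : ℕ} (h : ρ n = 0)
    (χ : Char d (n + 1)) (x : Yoko d (n + 2)) :
    ρ (n + 1) (Echi ξ (extend χ (χ (Fin.last n))) * x) = 0 := by
  have hχ : Echi ξ χ * proj ξ (χ (Fin.last n)) (Fin.last n) = Echi ξ χ := by
    rw [Echi_mul_proj, if_pos rfl]
  have hx : x ∈ decomposition ξ n := decomposition_eq_top ξ hd n ▸ Submodule.mem_top
  rw [Echi_extend]
  rw [decomposition] at hx
  generalize χ (Fin.last n) = b at hχ ⊢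
  induction hx using Submodule.span_induction with
  | mem x hx =>
    obtain ⟨⟨y, c⟩, rfl⟩ | ⟨⟨y, z⟩, rfl⟩ := hx
    · dsimp only
      rw [mul_assoc, ← mul_assoc (proj ξ b _), ← (incl_commute_proj_last ξ y b).eq,
        mul_assoc (Yoko.incl d (n + 1) y), proj_mul_proj]
      split_ifs with hbc
      · subst hbc
        -- The trace turns `E_χ y p_b` into `y E_χ p_b`, and `E_χ p_b = E_χ e` for the newest `e`.
        have he : Yoko.incl d (n + 1) (Echi ξ χ) * proj ξ b (Fin.last (n + 1)) =
            Yoko.incl d (n + 1) (Echi ξ χ) * Yoko.e (Gen.last n) := by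
          have h1 := proj_lo_mul_e ξ hd (Gen.last n) b
          change proj ξ b (Fin.last n).castSucc * _ =
            proj ξ b (Fin.last n).castSucc * proj ξ b (Fin.last (n + 1)) at h1
          rw [← hχ, map_mul, incl_proj, mul_assoc, mul_assoc, h1]
        rw [hρ.trace, mul_assoc, ← (incl_commute_proj_last ξ (Echi ξ χ) b).eq, he, ← mul_assoc,
          ← map_mul]
        refine Hecke.eq_of_v_mul_eq ?_
        rw [hρ.v_mul_incl_mul_e, h, LinearMap.zero_apply, mul_zero, mul_zero]
      · rw [mul_zero, mul_zero, map_zero]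
    · have h1 : Yoko.incl d (n + 1) (Echi ξ χ) * proj ξ b (Fin.last (n + 1)) *
          (Yoko.incl d (n + 1) y * Yoko.g (Gen.last n) * Yoko.incl d (n + 1) z) =
          Yoko.incl d (n + 1) (Echi ξ χ * y) * Yoko.g (Gen.last n) *
            Yoko.incl d (n + 1) (proj ξ b (Fin.last n) * z) := by
        rw [map_mul, map_mul, ← mul_assoc, ← mul_assoc, mul_assoc (Yoko.incl d (n + 1) (Echi ξ χ)),
          ← (incl_commute_proj_last ξ y b).eq]
        simp only [mul_assoc]
        rw [← mul_assoc (proj ξ b _) (Yoko.g _), proj_last_mul_g_last, mul_assoc]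
      dsimp only
      rw [h1, hρ.incl_mul_g_mul_incl, h, LinearMap.zero_apply]
  | zero => rw [mul_zero, map_zero]
  | add x y _ _ hx hy => rw [mul_add, map_add, hx, hy, add_zero]
  | smul r x _ hx => rw [mul_smul_comm, map_smul, hx, smul_zero]

theorem IsMarkovTrace.Echi_mul_eq_zero_of_not_injective (hd : 1 ≤ d) {n : ℕ} (h : ρ n = 0)
    {χ : Char d (n + 2)} (hχ : ¬ Function.Injective χ) (x : Yoko d (n + 2)) :
    ρ (n + 1) (Echi ξ χ * x) = 0 := by
  obtain ⟨p, q, hpq, hne⟩ : ∃ p q, χ p = χ q ∧ p ≠ q := by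
    simpa [Function.Injective] using hχ
  let r : Fin (n + 2) := (Fin.last n).castSucc
  let s : Fin (n + 2) := Fin.last (n + 1)
  have hrs : r ≠ s := (Fin.castSucc_lt_last _).ne
  -- A permutation that sends `p` and `q` to the last two letters.
  let w : Equiv.Perm (Fin (n + 2)) := Equiv.swap (Equiv.swap p r q) s * Equiv.swap p r
  have hp : w p = r := by
    change Equiv.swap (Equiv.swap p r q) s (Equiv.swap p r p) = r
    rw [Equiv.swap_apply_left, Equiv.swap_apply_of_ne_of_ne _ hrs]
    intro e
    exact hne ((Equiv.swap p r).injective ((Equiv.swap_apply_left p r).trans e))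
  have hq : w q = s := Equiv.swap_apply_left _ _
  have hr : act w χ r = χ p := hp ▸ act_apply w χ p
  have hs : act w χ s = χ q := hq ▸ act_apply w χ q
  obtain ⟨y, hy⟩ := hρ.exists_Echi_act ξ (n + 1) w χ x
  have hext : act w χ =
      extend (fun j : Fin (n + 1) => act w χ j.castSucc) (act w χ (Fin.last n).castSucc) := by
    funext j
    refine Fin.lastCases ?_ (fun j => ?_) j
    · rw [extend_last]; exact hs.trans (hpq.symm.trans hr.symm)
    · rw [extend_castSucc]
  rw [hy, hext]
  exact hρ.Echi_extend_mul_eq_zero ξ hd h (fun j : Fin (n + 1) => act w χ j.castSucc) y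

theorem IsMarkovTrace.Echi_mul_eq_zero_of_injective (hd : 1 ≤ d) {n : ℕ} {χ : Char d (n + 1)}
    (hχ : Function.Injective χ) (h : ρ n (Echi ξ χ) = 0) (x : Yoko d (n + 1)) :
    ρ n (Echi ξ χ * x) = 0 := by
  have hx : x ∈ Submodule.span GroundRing _ := span_Echi_mul_gtilde ξ hd ▸ Submodule.mem_top
  induction hx using Submodule.span_induction with
  | mem x hx =>
    obtain ⟨⟨ψ, w⟩, rfl⟩ := hx
    dsimp only
    rw [← mul_assoc, Echi_mul_Echi]
    split_ifs with hψ
    · subst hψ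
      rw [← one_mul (Echi ξ χ), one_mul, ← if_pos (rfl : χ = χ) (t := Echi ξ χ) (e := 0),
        ← Echi_mul_Echi, mul_assoc, hρ.trace, mul_assoc, gtilde_mul_Echi, ← mul_assoc,
        Echi_mul_Echi]
      split_ifs with hw
      · have : w = 1 := by
          refine Equiv.ext fun j => ?_
          have h1 := congrFun hw (w j)
          rw [act_apply] at h1
          exact hχ h1
        rw [this, Yoko.gtilde_one, mul_one, act_one, h]
      · rw [zero_mul, map_zero]
    · rw [zero_mul, map_zero]
  | zero => rw [mul_zero, map_zero]
  | add x y _ _ hx hy => rw [mul_add, map_add, hx, hy, add_zero]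
  | smul r x _ hx => rw [mul_smul_comm, map_smul, hx, smul_zero]

theorem IsMarkovTrace.eq_zero (hd : 1 ≤ d)
    (h : ∀ (n : ℕ) (χ : Char d (n + 1)), Function.Injective χ → ρ n (Echi ξ χ) = 0) (n : ℕ) :
    ρ n = 0 := by
  have key : ∀ n, (∀ (χ : Char d (n + 1)) x, ρ n (Echi ξ χ * x) = 0) → ρ n = 0 := by
    intro n hn
    refine LinearMap.ext fun x => ?_
    rw [← one_mul x, ← sum_Echi ξ hd, Finset.sum_mul, map_sum]
    exact Finset.sum_eq_zero fun χ _ => hn χ x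
  induction n with
  | zero =>
    refine key 0 fun χ x => ?_
    have hχ : Function.Injective χ := fun p q _ => Subsingleton.elim (α := Fin 1) p q
    exact hρ.Echi_mul_eq_zero_of_injective ξ hd hχ (h 0 χ hχ) x
  | succ n ih =>
    refine key (n + 1) fun χ x => ?_
    by_cases hχ : Function.Injective χ
    · exact hρ.Echi_mul_eq_zero_of_injective ξ hd hχ (h _ χ hχ) x
    · exact hρ.Echi_mul_eq_zero_of_not_injective ξ hd ih hχ x

end Uniqueness

/-! ### Evaluation of Markov traces and the basis of the module of Markov traces -/

section Evaluation

variable {d : ℕ} (ξ : Fin d ≃ rootsOfUnity d ℂ)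

theorem compOf_chiOne {n : ℕ} (μ : Comp d n) : compOf (chiOne μ) = μ := by
  refine Subtype.ext (funext fun a => ?_)
  rw [compOf_apply, Finset.card_filter, ← (blockEquiv μ).sum_comp, Fintype.sum_sigma]
  simp [chiOne_blockEquiv]

theorem compOf_le_one_of_injective {n : ℕ} {χ : Char d n} (hχ : Function.Injective χ) (a : Fin d) :
    (compOf χ).1 a ≤ 1 := by
  rw [compOf_apply, Finset.card_le_one]
  intro p hp q hq
  exact hχ ((Finset.mem_filter.1 hp).2.trans (Finset.mem_filter.1 hq).2.symm)

theorem base_val_of_le_one {n : ℕ} {μ : Comp d (n + 1)} (h : ∀ a, μ.1 a ≤ 1) :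
    (base μ).1 = μ.1 := by
  funext a
  have := h a
  change (if 1 ≤ μ.1 a then 1 else 0) = μ.1 a
  split_ifs <;> omega

theorem tensorTrace_one {n : ℕ} {μ : Comp d n} (h : ∀ a, μ.1 a ≤ 1) : tensorTrace μ 1 = 1 := by
  refine (tensorTrace_tprod μ fun _ => 1).trans (Finset.prod_eq_one fun a _ => ?_)
  have h1 : ∀ m, m ≤ 1 → heckeTrace m 1 = 1 := by
    intro m hm
    obtain rfl | rfl : m = 0 ∨ m = 1 := by omega
    · exact heckeTrace_spec.zero
    · exact heckeTrace_spec.one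
  exact h1 _ (h a)

theorem diagTrace_Echi {n : ℕ} (ω χ : Char d n) (h : ∀ a, (compOf χ).1 a ≤ 1) :
    diagTrace ξ ω (Echi ξ χ) = if ω = χ then 1 else 0 := by
  have h1 : ∀ x, diagTrace ξ ω (Echi ξ ω * x) = diagTrace ξ ω x := fun x => by
    refine congrArg (tensorTrace (compOf ω)) ?_
    rw [map_mul, repr_Echi ξ (compOf ω) ⟨ω, rfl⟩, Matrix.single_mul_apply_same, one_mul]
  rw [← h1, Echi_mul_Echi]
  split_ifs with hω
  · subst hω
    have h2 : repr ξ (compOf ω) (Echi ξ ω) ⟨ω, rfl⟩ ⟨ω, rfl⟩ = 1 := by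
      rw [repr_Echi ξ (compOf ω) ⟨ω, rfl⟩, Matrix.single_apply_same]
    exact (congrArg (tensorTrace (compOf ω)) h2).trans (tensorTrace_one h)
  · rw [diagTrace, map_zero, Matrix.zero_apply, map_zero]

theorem comboTrace_Echi (hd : 1 ≤ d) (α : Comp0 d → GroundRing) {n : ℕ} (χ : Char d (n + 1))
    (h : ∀ a, (compOf χ).1 a ≤ 1) : comboTrace ξ α n (Echi ξ χ) = α (base (compOf χ)) := by
  rw [comboTrace_apply ξ hd, sum_mul_blockTrace ξ hd (fun μ => α (base μ)),
    Finset.sum_eq_single χ]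
  · rw [diagTrace_Echi ξ χ χ h, if_pos rfl, mul_one]
  · intro ω _ hω; rw [diagTrace_Echi ξ ω χ h, if_neg hω, mul_zero]
  · simp

/-- An element of `Comp_d^0` as a composition of the number of its nonzero parts. -/
def Comp0.toComp (ν : Comp0 d) : Comp d (∑ a, ν.1 a - 1 + 1) :=
  ⟨ν.1, (Nat.sub_add_cancel ν.2.2).symm⟩

theorem Comp0.le_one (ν : Comp0 d) (a : Fin d) : ν.1 a ≤ 1 := by
  rcases ν.2.1 a with h | h <;> omega

theorem Comp0.base_toComp (ν : Comp0 d) : base ν.toComp = ν :=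
  Subtype.ext (base_val_of_le_one ν.le_one)

/-- The value of a family of linear functions at the idempotent `E_χ` for the distinguished
character `χ` of composition `ν`. -/
def evalAt (ρ : ∀ n : ℕ, Yoko d (n + 1) →ₗ[GroundRing] GroundRing) (ν : Comp0 d) : GroundRing :=
  ρ (∑ a, ν.1 a - 1) (Echi ξ (chiOne ν.toComp))

theorem evalAt_comboTrace (hd : 1 ≤ d) (α : Comp0 d → GroundRing) :
    evalAt ξ (comboTrace ξ α) = α := by
  funext ν
  rw [evalAt, comboTrace_Echi ξ hd, compOf_chiOne, ν.base_toComp]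
  rw [compOf_chiOne]
  exact ν.le_one

theorem IsMarkovTrace.Echi_eq_evalAt {ρ : ∀ n : ℕ, Yoko d (n + 1) →ₗ[GroundRing] GroundRing}
    (hρ : IsMarkovTrace d ρ) {n : ℕ} {χ : Char d (n + 1)} (hχ : Function.Injective χ) :
    ρ n (Echi ξ χ) = evalAt ξ ρ (base (compOf χ)) := by
  obtain ⟨π, hπ⟩ := exists_rep (⟨χ, rfl⟩ : Orbit (compOf χ))
  have h1 : ρ n (Echi ξ χ) = ρ n (Echi ξ (chiOne (compOf χ))) := by
    rw [← hρ.Echi_act ξ n π (chiOne (compOf χ)), hπ]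
  have h2 : ∀ (m : ℕ) (μ : Comp d (m + 1)), μ.1 = (compOf χ).1 →
      ρ n (Echi ξ (chiOne (compOf χ))) = ρ m (Echi ξ (chiOne μ)) := by
    intro m μ hμ
    obtain rfl : n = m := by
      have h3 := μ.2
      rw [hμ, (compOf χ).2] at h3
      omega
    rw [show μ = compOf χ from Subtype.ext hμ]
  rw [h1]
  exact h2 _ (base (compOf χ)).toComp (base_val_of_le_one (compOf_le_one_of_injective hχ))

theorem IsMarkovTrace.eq_of_evalAt_eq (hd : 1 ≤ d)
    {ρ σ : ∀ n : ℕ, Yoko d (n + 1) →ₗ[GroundRing] GroundRing} (hρ : IsMarkovTrace d ρ)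
    (hσ : IsMarkovTrace d σ) (h : evalAt ξ ρ = evalAt ξ σ) : ρ = σ := by
  have hsub : IsMarkovTrace d (ρ - σ) :=
    (markovTraces d).sub_mem (x := ρ) (y := σ) hρ hσ
  refine sub_eq_zero.1 (funext fun n => hsub.eq_zero ξ hd (fun n χ hχ => ?_) n)
  change ρ n _ - σ n _ = 0
  rw [hρ.Echi_eq_evalAt ξ hχ, hσ.Echi_eq_evalAt ξ hχ, h, sub_self]

/-- A Markov trace is determined by its values on the idempotents `E_χ` for the `2^d - 1`
distinguished characters `χ` without repeated values, and these values are arbitrary. -/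
def markovTracesEquiv (hd : 1 ≤ d) : markovTraces d ≃ₗ[GroundRing] (Comp0 d → GroundRing) where
  toFun ρ := evalAt ξ ρ.1
  map_add' _ _ := rfl
  map_smul' _ _ := rfl
  invFun α := ⟨comboTrace ξ α, isMarkovTrace_comboTrace ξ hd α⟩
  left_inv ρ := Subtype.ext ((isMarkovTrace_comboTrace ξ hd _).eq_of_evalAt_eq ξ hd ρ.2
    (evalAt_comboTrace ξ hd _))
  right_inv α := evalAt_comboTrace ξ hd α

/-- Elements of `Comp_d^0` correspond to nonempty subsets of the set of indices. -/
def comp0Equiv (d : ℕ) : Comp0 d ≃ {s : Finset (Fin d) // s ≠ ∅} where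
  toFun ν := ⟨Finset.univ.filter fun a => ν.1 a = 1, fun h => by
    have h1 : ∑ a, ν.1 a = 0 := Finset.sum_eq_zero fun a _ => by
      have h2 := Finset.filter_eq_empty_iff.1 h (Finset.mem_univ a)
      exact (ν.2.1 a).resolve_right h2
    have := ν.2.2
    omega⟩
  invFun s := ⟨fun a => if a ∈ s.1 then 1 else 0, fun a => by dsimp only; split_ifs <;> simp, by
    obtain ⟨a, ha⟩ := Finset.nonempty_iff_ne_empty.2 s.2
    exact (Finset.single_le_sum (f := fun a => if a ∈ s.1 then 1 else 0)
      (fun _ _ => Nat.zero_le _) (Finset.mem_univ a)).trans' (by simp [ha])⟩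
  left_inv ν := Subtype.ext (funext fun a => by
    rcases ν.2.1 a with h | h <;> simp [h])
  right_inv s := Subtype.ext (by ext a; simp)

instance : Finite (Comp0 d) := Finite.of_equiv _ (comp0Equiv d).symm

theorem card_comp0 (d : ℕ) : Nat.card (Comp0 d) = 2 ^ d - 1 := by
  rw [Nat.card_congr (comp0Equiv d), Nat.card_eq_fintype_card, Fintype.card_subtype_compl]
  simp

end Evaluation

end

end YH

theorem theorem5p2 (d : ℕ) (hd : 1 ≤ d) (ξ : Fin d ≃ rootsOfUnity d ℂ) :
    (∃! τ : ∀ n : ℕ, YH.Hecke n →ₗ[YH.GroundRing] YH.GroundRing, YH.IsNormalizedMarkovTrace τ) ∧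
    (∀ (n : ℕ) (μ : YH.Comp d (n + 1)),
      ∃! Ψ : YH.block ξ μ →ₗ[YH.GroundRing]
        Matrix (YH.Orbit μ) (YH.Orbit μ) (YH.HeckeTensor μ), YH.IsPsi ξ μ Ψ) ∧
    (∀ ρ : ∀ n : ℕ, YH.Yoko d (n + 1) →ₗ[YH.GroundRing] YH.GroundRing,
      YH.IsMarkovTrace d ρ ↔
        ∃ α : YH.Comp0 d → YH.GroundRing, ∀ (n : ℕ) (x : YH.Yoko d (n + 1)),
          ρ n x = ∑ μ : YH.Comp d (n + 1), α (YH.base μ) * YH.blockTrace ξ μ x) ∧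
    Module.Free YH.GroundRing (YH.markovTraces d) ∧
    Module.finrank YH.GroundRing (YH.markovTraces d) = 2 ^ d - 1 ∧
    ∃ b : Module.Basis (YH.Comp0 d) YH.GroundRing (YH.markovTraces d),
      ∀ (ν : YH.Comp0 d) (n : ℕ) (x : YH.Yoko d (n + 1)),
        (b ν).1 n x =
          ∑ μ : YH.Comp d (n + 1) with YH.base μ = ν, YH.blockTrace ξ μ x := by
  let b := Module.Basis.ofEquivFun (YH.markovTracesEquiv ξ hd)
  refine ⟨YH.Hecke.existsUnique_isNormalizedMarkovTrace,
    fun n μ => YH.existsUnique_isPsi ξ μ hd,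
    fun ρ => ⟨fun hρ => ⟨YH.evalAt ξ ρ, fun n x => ?_⟩, ?_⟩,
    Module.Free.of_basis b, ?_, b, fun ν n x => ?_⟩
  · have h := hρ.eq_of_evalAt_eq ξ hd (YH.isMarkovTrace_comboTrace ξ hd (YH.evalAt ξ ρ))
      (YH.evalAt_comboTrace ξ hd _).symm
    rw [← YH.comboTrace_apply ξ hd, ← h]
  · rintro ⟨α, hα⟩
    have h : ρ = YH.comboTrace ξ α := funext fun n => LinearMap.ext fun x =>
      (hα n x).trans (YH.comboTrace_apply ξ hd α n x).symm
    exact h ▸ YH.isMarkovTrace_comboTrace ξ hd α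
  · rw [Module.finrank_eq_nat_card_basis b, YH.card_comp0]
  · classical
    have h : (b ν).1 = YH.comboTrace ξ (Pi.single ν 1) := by
      simp only [b, Module.Basis.coe_ofEquivFun]
      rfl
    rw [h, YH.comboTrace_apply ξ hd, Finset.sum_filter]
    refine Finset.sum_congr rfl fun μ _ => ?_
    rw [Pi.single_apply, ite_mul, one_mul, zero_mul]
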